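/- **Setting.** Let $M$ be an $m$-dimensional smooth manifold, $G$ a $d$-dimensional Lie group with Lie algebra $\mathfrak g$, and $k\ge 1$. For $j\ge 0$ let $T^jM$ be the bundle of $j$-jets at $0$ of curves in $M$, with natural coordinates $(q_0,\dots,q_j)$, where $q_i$ is the $i$-th derivative at $0$ of the curve in a chart of $M$. By left trivialization write $T^j(M\times G)=T^jM\times G\times j\mathfrak g$, with natural coordinates $(q_0,\dots,q_j,g,\xi^0,\dots,\xi^{j-1})$, where $\xi=g^{-1}\dot g$ and $\xi^i=\xi^{(i)}(0)$. Let $$W=T^k(M\times G)\times_{T^{k-1}(M\times G)}T^*(T^{k-1}(M\times G)),$$ whose points are the pairs $(a,\alpha)$ with $a\in T^k(M\times G)$ and $\alpha$ a covector at the projection of $a$ to $T^{k-1}(M\times G)$. Let $\Omega$ be the pullback to $W$ of the canonical symplectic form $-d\theta$ of $T^*(T^{k-1}(M\times G))$, where $\theta$ is the Liouville form. Let $C(a,\alpha)=\langle\alpha,\jmath(a)\rangle$, where $\jmath:T^k(M\times G)\to T(T^{k-1}(M\times G))$ is the canonical embedding, which sends $a$ to the vector $(q_1,\dots,q_k,g\xi^0,\xi^1,\dots,\xi^{k-1})$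 at $(q_0,\dots,q_{k-1},g,\xi^0,\dots,\xi^{k-2})$. Let $L$ and $\Phi^1,\dots,\Phi^n$ be smooth real functions on $T^k(M\times G)$ such that the differentials $d\Phi^1,\dots,d\Phi^n$ are linearly independent at every common zero of the $\Phi^a$. Regard these functions also as functions on $W$, and put $H=C-L$. For $w\in W$, call $\lambda\in\mathbb R^n$ a multiplier at $w$ if $dH+\lambda_a\,d\Phi^a$ vanishes on $\ker\Omega_w$. Let $$W_c=\{w\in W:\ \Phi^a(w)=0 \text{ for all } a,\ \text{and there is a multiplier at } w\},$$ with inclusion $\iota:W_c\to W$. In coordinates, the multiplier condition says that the momenta conjugate to $(q_{k-1},\xi^{k-2})$ (to $(q_0,g)$ if $k=1$) are the derivatives of $L-\lambda_a\Phi^a$ with respect to $(q_k,\xi^{k-1})$, where for $k=1$ the momentum conjugate to $g$ is left-trivialized. **Theorem.** 1. The following are equivalent. * $(W_c,\Omega_{W_c})$ with $\Omega_{W_c}=\iota^*\Omega$ is a symplectic manifold; that is, $W_c$ is an embedded submanifold of $W$, and $\iota^*\Omega$ is a smooth closed nondegenerate $2$-form on it. * At every point of $W_c$, for every multiplier $\lambda$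 at this point and in all natural coordinates around it, the symmetric $(m+d+n)\times(m+d+n)$ matrix $$\begin{pmatrix}\dfrac{\partial^2(L-\lambda_a\Phi^a)}{\partial(q_k,\xi^{k-1})^2} & \left(\dfrac{\partial\Phi}{\partial(q_k,\xi^{k-1})}\right)^{T}\\[2mm] \dfrac{\partial\Phi}{\partial(q_k,\xi^{k-1})}&0\end{pmatrix}$$ is nondegenerate, where $\lambda$ is held constant in the derivatives. 2. If these conditions hold, the dynamics is given by a unique vector field. More precisely, there is a smooth vector field $X$ on $W_c$ which is the unique vector field on $W_c$ with $$i(X)\Omega_{W_c}=d(H|_{W_c}),$$ and which is also the unique vector field on $W_c$ (that is, the unique field along $W_c$ tangent to $W_c$) such that, at each point of $W_c$, $i(X)\Omega-dH$ annihilates $\bigcap_a\ker d\Phi^a\subset TW$, i.e. lies in the span of the $d\Phi^a$. -/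

import Mathlib

open scoped Manifold ContDiff Bundle Topology
open Set

noncomputable section

section Jets

variable (E : Type*) [NormedAddCommGroup E] [NormedSpace ℝ E]
  (M : Type*) [TopologicalSpace M] [ChartedSpace E M]

/-- Curves in the manifold `M` that are smooth at `0`. -/
def SmoothCurve : Type _ := {γ : ℝ → M // ContMDiffAt 𝓘(ℝ, ℝ) 𝓘(ℝ, E) ∞ γ 0}

/-- Two curves have the same `k`-jet at `0`: they have the same value at `0`, and the same
derivatives at `0` up to order `k` in the charts of `M` around this value. -/
def jetSetoid (k : ℕ) : Setoid (SmoothCurve E M) where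
  r γ₁ γ₂ := γ₁.1 0 = γ₂.1 0 ∧ ∀ e ∈ atlas E M, γ₁.1 0 ∈ e.source → ∀ i ≤ k,
    iteratedDeriv i (e ∘ γ₁.1) 0 = iteratedDeriv i (e ∘ γ₂.1) 0
  iseqv :=
    { refl := fun _ => ⟨rfl, fun _ _ _ _ _ => rfl⟩
      symm := fun h => ⟨h.1.symm, fun e he hs i hi => (h.2 e he (h.1 ▸ hs) i hi).symm⟩
      trans := fun h h' => ⟨h.1.trans h'.1, fun e he hs i hi =>
        (h.2 e he hs i hi).trans (h'.2 e he (h.1 ▸ hs) i hi)⟩ }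

/-- The `k`-th order tangent bundle `T^k M`: the `k`-jets at `0` of curves in `M`. -/
def Jet (k : ℕ) : Type _ := Quotient (jetSetoid E M k)

variable {E M}

/-- The jet `j^k_0 γ`. -/
def Jet.mk (k : ℕ) (γ : SmoothCurve E M) : Jet E M k := Quotient.mk (jetSetoid E M k) γ

/-- The base point `γ 0` of the jet `j^k_0 γ`. -/
def Jet.base {k : ℕ} (j : Jet E M k) : M :=
  Quotient.lift (s := jetSetoid E M k) (fun γ : SmoothCurve E M => γ.1 0)
    (fun _ _ (h : (jetSetoid E M k).r _ _) => h.1) j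

/-- The coordinates `(q_0, …, q_k)` of a jet `j^k_0 γ` in a chart `e` in the atlas of `M`:
`q_i` is the `i`-th derivative of `e ∘ γ` at `0` (junk if the base point is not in the
domain of `e`). -/
def Jet.coord {k : ℕ} (e : OpenPartialHomeomorph M E) (j : Jet E M k) : Fin (k + 1) → E :=
  fun i => iteratedDeriv (i : ℕ) (e ∘ (Quotient.out j).1) 0

theorem Jet.coord_mk {k : ℕ} {e : OpenPartialHomeomorph M E} (he : e ∈ atlas E M)
    (γ : SmoothCurve E M) (h : γ.1 0 ∈ e.source) :
    Jet.coord e (Jet.mk k γ) = fun i : Fin (k + 1) => iteratedDeriv (i : ℕ) (e ∘ γ.1) 0 := by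
  have h1 : (jetSetoid E M k).r (Quotient.out (Jet.mk k γ)) γ :=
    Quotient.mk_out (s := jetSetoid E M k) γ
  funext i
  exact h1.2 e he (by rw [h1.1]; exact h) i (Nat.lt_succ_iff.mp i.2)

/-- The polynomial curve with derivatives `q_0, …, q_k` at `0`. -/
def taylorCurve {k : ℕ} (q : Fin (k + 1) → E) (t : ℝ) : E :=
  ∑ i : Fin (k + 1), ((Nat.factorial i : ℝ)⁻¹ * t ^ (i : ℕ)) • q i

theorem taylorCurve_zero {k : ℕ} (q : Fin (k + 1) → E) : taylorCurve q 0 = q 0 := by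
  rw [taylorCurve, Finset.sum_eq_single 0]
  · simp
  · intro b _ hb
    have : (b : ℕ) ≠ 0 := fun h => hb (Fin.ext h)
    simp [this]
  · simp

theorem contDiff_taylorCurve {k : ℕ} (q : Fin (k + 1) → E) {n : WithTop ℕ∞} :
    ContDiff ℝ n (taylorCurve q) := by
  unfold taylorCurve; fun_prop

theorem iteratedDeriv_taylorCurve {k : ℕ} (q : Fin (k + 1) → E) (i : Fin (k + 1)) :
    iteratedDeriv (i : ℕ) (taylorCurve q) 0 = q i := by
  have key : ∀ (n m : ℕ) (v : E), iteratedDeriv n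
      (fun t : ℝ => ((Nat.factorial m : ℝ)⁻¹ * t ^ m) • v) 0 = if m = n then v else 0 := by
    intro n m v
    have h2 : (fun t : ℝ => ((Nat.factorial m : ℝ)⁻¹ * t ^ m) • v)
        = (ContinuousLinearMap.toSpanSingleton ℝ v) ∘
          (fun t : ℝ => (Nat.factorial m : ℝ)⁻¹ * t ^ m) := by
      funext t; simp
    have h1 : iteratedDeriv n (fun t : ℝ => (Nat.factorial m : ℝ)⁻¹ * t ^ m) 0
        = if m = n then 1 else 0 := by
      rw [show (fun t : ℝ => (Nat.factorial m : ℝ)⁻¹ * t ^ m)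
        = (Nat.factorial m : ℝ)⁻¹ • (fun t : ℝ => t ^ m) from rfl,
        iteratedDeriv_const_smul_field, iteratedDeriv_eq_iterate, iter_deriv_pow]
      rcases lt_trichotomy m n with h | h | h
      · rw [Finset.prod_eq_zero (Finset.mem_range.mpr h) (by simp)]
        simp [h.ne]
      · subst h
        have : ∏ i ∈ Finset.range m, ((m : ℝ) - i) = Nat.factorial m := by
          rw [← Finset.prod_range_reflect, ← Finset.prod_range_add_one_eq_factorial]
          push_cast
          refine Finset.prod_congr rfl fun j hj => ?_
          have hj' := Finset.mem_range.mp hj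
          rw [Nat.cast_sub (by omega), Nat.cast_sub (by omega)]; push_cast; ring
        rw [this]
        have := Nat.factorial_ne_zero m
        simp; field_simp
      · have : m - n ≠ 0 := by omega
        simp [this, h.ne']
    rw [h2, iteratedDeriv_eq_iteratedFDeriv,
      ContinuousLinearMap.iteratedFDeriv_comp_left (n := n) _ (by fun_prop) le_rfl]
    rw [ContinuousLinearMap.compContinuousMultilinearMap_coe, Function.comp_apply,
      ← iteratedDeriv_eq_iteratedFDeriv, h1]
    split_ifs <;> simp
  unfold taylorCurve
  rw [iteratedDeriv_fun_sum (fun j _ => by fun_prop)]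
  simp only [key]
  rw [Finset.sum_eq_single i] <;> simp +contextual [Fin.ext_iff]

/-- The components of the jet of a composition are polynomials in the jet of the inner curve. -/
theorem iteratedDeriv_comp_taylorCurve {k : ℕ} {φ : E → E} {c : ℝ → E}
    (hφ : ContDiffAt ℝ ∞ φ (c 0)) (hc : ContDiffAt ℝ ∞ c 0) {i : ℕ} (hi : i ≤ k) :
    iteratedDeriv i (φ ∘ c) 0 = iteratedDeriv i
      (φ ∘ taylorCurve (fun j : Fin (k + 1) => iteratedDeriv (j : ℕ) c 0)) 0 := by
  set q : Fin (k + 1) → E := fun j => iteratedDeriv (j : ℕ) c 0 with hq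
  have h0 : taylorCurve q 0 = c 0 := by simp [taylorCurve_zero, hq]
  rw [iteratedDeriv_vcomp_eq_sum_orderedFinpartition (n := ∞) hφ hc (by exact_mod_cast le_top),
    iteratedDeriv_vcomp_eq_sum_orderedFinpartition (n := ∞) (by rwa [h0])
      (contDiff_taylorCurve q).contDiffAt (by exact_mod_cast le_top), h0]
  refine Finset.sum_congr rfl fun p _ => ?_
  congr 1
  funext j
  exact (iteratedDeriv_taylorCurve q ⟨p.partSize j, by have := p.partSize_le j; omega⟩).symm

theorem contDiffOn_iteratedDeriv_comp_taylorCurve {k : ℕ} {φ : E → E} {s : Set E}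
    (hs : IsOpen s) (hφ : ContDiffOn ℝ ∞ φ s) (i : Fin (k + 1)) :
    ContDiffOn ℝ ∞ (fun q : Fin (k + 1) → E => iteratedDeriv (i : ℕ) (φ ∘ taylorCurve q) 0)
      {q | q 0 ∈ s} := by
  have : ContDiffOn ℝ ∞ (fun q : Fin (k + 1) → E => ∑ p : OrderedFinpartition (i : ℕ),
      iteratedFDeriv ℝ p.length φ (q 0) fun j =>
        q ⟨p.partSize j, by have := p.partSize_le j; omega⟩) {q | q 0 ∈ s} := by
    refine ContDiffOn.sum fun p _ => ?_
    intro q hq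
    have h1 : ContDiffAt ℝ ∞ (iteratedFDeriv ℝ p.length φ) (q 0) :=
      (hφ.contDiffAt (hs.mem_nhds hq)).iteratedFDeriv_right (by exact_mod_cast le_top)
    have h2 : ContDiffAt ℝ ∞ (fun q : Fin (k + 1) → E =>
        (iteratedFDeriv ℝ p.length φ (q 0), fun j : Fin p.length =>
          q ⟨p.partSize j, by have := p.partSize_le j; omega⟩)) q := by
      refine ContDiffAt.prodMk (h1.comp q (by fun_prop)) ?_
      rw [contDiffAt_pi]
      intro j
      fun_prop
    exact ((((ContinuousLinearMap.id ℝ (E [×p.length]→L[ℝ] E)).cpolynomialAt_uncurry_of_multilinear).contDiffAt).comp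
      q h2).contDiffWithinAt
  refine this.congr fun q hq => ?_
  have h0 : φ (taylorCurve q 0) = φ (q 0) := by rw [taylorCurve_zero]
  rw [iteratedDeriv_vcomp_eq_sum_orderedFinpartition (n := ∞)
    (by rw [taylorCurve_zero]; exact hφ.contDiffAt (hs.mem_nhds hq))
    (contDiff_taylorCurve q).contDiffAt (by exact_mod_cast le_top), taylorCurve_zero]
  refine Finset.sum_congr rfl fun p _ => ?_
  congr 1
  funext j
  exact iteratedDeriv_taylorCurve q ⟨p.partSize j, by have := p.partSize_le j; omega⟩

theorem contDiffAt_chart_comp [IsManifold 𝓘(ℝ, E) ∞ M] {e : OpenPartialHomeomorph M E}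
    (he : e ∈ atlas E M) (γ : SmoothCurve E M) (h : γ.1 0 ∈ e.source) :
    ContDiffAt ℝ ∞ (e ∘ γ.1) 0 := by
  rw [← contMDiffAt_iff_contDiffAt]
  have h1 := contMDiffOn_of_mem_maximalAtlas (I := 𝓘(ℝ, E)) (n := ∞)
    (IsManifold.subset_maximalAtlas he)
  exact (h1.contMDiffAt (e.open_source.mem_nhds h)).comp (0 : ℝ) γ.2

/-- The curve whose coordinate expression in the chart `e` is the polynomial curve with
derivatives `q_0, …, q_k` at `0` (and a constant curve if `q_0` is not in the image of `e`). -/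
def chartCurve [IsManifold 𝓘(ℝ, E) ∞ M] {k : ℕ} (e : OpenPartialHomeomorph M E)
    (he : e ∈ atlas E M) (q : Fin (k + 1) → E) : SmoothCurve E M :=
  letI : Decidable (q 0 ∈ e.target) := Classical.propDecidable _
  if h : q 0 ∈ e.target then
    ⟨e.symm ∘ taylorCurve q, by
      have h1 := contMDiffOn_symm_of_mem_maximalAtlas (I := 𝓘(ℝ, E)) (n := ∞)
        (IsManifold.subset_maximalAtlas he)
      have h2 := h1.contMDiffAt (x := taylorCurve q 0)
        (e.open_target.mem_nhds (by rwa [taylorCurve_zero]))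
      exact h2.comp (0 : ℝ) (contDiff_taylorCurve q).contDiffAt.contMDiffAt⟩
  else ⟨fun _ => e.symm (q 0), contMDiffAt_const⟩

theorem chartCurve_of_mem [IsManifold 𝓘(ℝ, E) ∞ M] {k : ℕ} {e : OpenPartialHomeomorph M E}
    (he : e ∈ atlas E M) {q : Fin (k + 1) → E} (h : q 0 ∈ e.target) :
    (chartCurve e he q).1 = e.symm ∘ taylorCurve q := by
  simp [chartCurve, h]

theorem contDiffOn_chart_transition [IsManifold 𝓘(ℝ, E) ∞ M] {e e' : OpenPartialHomeomorph M E}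
    (he : e ∈ atlas E M) (he' : e' ∈ atlas E M) :
    ContDiffOn ℝ ∞ (e' ∘ e.symm) (e.symm.trans e').source := by
  have := contMDiffOn_of_mem_contDiffGroupoid
    ((contDiffGroupoid ∞ 𝓘(ℝ, E)).compatible he he')
  rw [contMDiffOn_iff_contDiffOn] at this
  exact this

/-- The jet chart of `T^k M` induced by a chart `e` of `M`: the natural coordinates
`(q_0, …, q_k)`. -/
def jetChart [IsManifold 𝓘(ℝ, E) ∞ M] (k : ℕ) (e : OpenPartialHomeomorph M E)
    (he : e ∈ atlas E M) : PartialEquiv (Jet E M k) (Fin (k + 1) → E) where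
  toFun := Jet.coord e
  invFun q := Jet.mk k (chartCurve e he q)
  source := {j | j.base ∈ e.source}
  target := {q | q 0 ∈ e.target}
  map_source' := by
    rintro ⟨γ⟩ (h : γ.1 0 ∈ e.source)
    have : Jet.coord e (Jet.mk k γ) 0 = e (γ.1 0) := by rw [Jet.coord_mk he γ h]; simp
    change Jet.coord e (Jet.mk k γ) 0 ∈ e.target
    rw [this]
    exact e.map_source h
  map_target' := by
    intro q (hq : q 0 ∈ e.target)
    change (chartCurve e he q).1 0 ∈ e.source
    rw [chartCurve_of_mem he hq, Function.comp_apply, taylorCurve_zero]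
    exact e.map_target hq
  left_inv' := by
    rintro ⟨γ⟩ (h : γ.1 0 ∈ e.source)
    change Jet.mk k (chartCurve e he (Jet.coord e (Jet.mk k γ))) = Jet.mk k γ
    rw [Jet.coord_mk he γ h]
    set q : Fin (k + 1) → E := fun i => iteratedDeriv (i : ℕ) (e ∘ γ.1) 0 with hq
    have hq0 : q 0 = e (γ.1 0) := by simp [hq]
    have hqt : q 0 ∈ e.target := by rw [hq0]; exact e.map_source h
    refine Quotient.sound (s := jetSetoid E M k) ?_
    have hb : (chartCurve e he q).1 0 = γ.1 0 := by
      rw [chartCurve_of_mem he hqt, Function.comp_apply, taylorCurve_zero, hq0, e.left_inv h]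
    refine ⟨hb, fun e' he' h' i hi => ?_⟩
    rw [chartCurve_of_mem he hqt, ← Function.comp_assoc]
    have hs : e (γ.1 0) ∈ (e.symm.trans e').source := by
      rw [hb] at h'
      simp [e.map_source h, e.left_inv h, h']
    have h3 := iteratedDeriv_comp_taylorCurve (k := k) (c := e ∘ γ.1) (φ := e' ∘ e.symm)
      ((contDiffOn_chart_transition he he').contDiffAt
        ((e.symm.trans e').open_source.mem_nhds hs)) (contDiffAt_chart_comp he γ h) hi
    rw [← h3]
    refine Filter.EventuallyEq.iteratedDeriv_eq i ?_
    filter_upwards [γ.2.continuousAt.preimage_mem_nhds (e.open_source.mem_nhds h)] with t ht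
    simp [e.left_inv ht]
  right_inv' := by
    intro q (hq : q 0 ∈ e.target)
    have hs : (chartCurve e he q).1 0 ∈ e.source := by
      rw [chartCurve_of_mem he hq, Function.comp_apply, taylorCurve_zero]
      exact e.map_target hq
    rw [Jet.coord_mk he _ hs]
    funext i
    rw [← iteratedDeriv_taylorCurve q i]
    refine Filter.EventuallyEq.iteratedDeriv_eq _ ?_
    have hc : ContinuousAt (taylorCurve q) 0 :=
      (contDiff_taylorCurve q (n := 0)).continuous.continuousAt
    filter_upwards [hc.preimage_mem_nhds
      (e.open_target.mem_nhds (by rwa [taylorCurve_zero]))] with t ht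
    rw [chartCurve_of_mem he hq]
    exact e.right_inv ht

theorem jetChart_trans_source [IsManifold 𝓘(ℝ, E) ∞ M] {k : ℕ} {e e' : OpenPartialHomeomorph M E}
    (he : e ∈ atlas E M) (he' : e' ∈ atlas E M) :
    ((jetChart k e he).symm.trans (jetChart k e' he')).source
      = {q | q 0 ∈ (e.symm.trans e').source} := by
  ext q
  have key : q 0 ∈ e.target →
      ((Jet.mk k (chartCurve e he q)).base ∈ e'.source ↔ e.symm (q 0) ∈ e'.source) := by
    intro h
    change (chartCurve e he q).1 0 ∈ e'.source ↔ _
    rw [chartCurve_of_mem he h, Function.comp_apply, taylorCurve_zero]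
  simp only [PartialEquiv.trans_source, PartialEquiv.symm_source,
    OpenPartialHomeomorph.trans_source, OpenPartialHomeomorph.symm_source, mem_inter_iff,
    mem_preimage, mem_ofPred_eq]
  exact and_congr_right key

theorem contDiffOn_jetChart_transition [IsManifold 𝓘(ℝ, E) ∞ M] {k : ℕ}
    {e e' : OpenPartialHomeomorph M E} (he : e ∈ atlas E M) (he' : e' ∈ atlas E M) :
    ContDiffOn ℝ ∞ ((jetChart k e he).symm.trans (jetChart k e' he'))
      ((jetChart k e he).symm.trans (jetChart k e' he')).source := by
  rw [jetChart_trans_source, contDiffOn_pi]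
  intro i
  refine (contDiffOn_iteratedDeriv_comp_taylorCurve (e.symm.trans e').open_source
    (contDiffOn_chart_transition he he') i).congr fun q hq => ?_
  have hq1 : q 0 ∈ e.target := hq.1
  have hs : (chartCurve e he q).1 0 ∈ e'.source := by
    rw [chartCurve_of_mem he hq1, Function.comp_apply, taylorCurve_zero]
    exact hq.2
  change Jet.coord e' (Jet.mk k (chartCurve e he q)) i = _
  rw [Jet.coord_mk he' _ hs, chartCurve_of_mem he hq1, Function.comp_assoc]

variable (E M)

/-- The natural atlas of `T^k M`, formed by the jet charts. -/
def jetChartedSpaceCore [IsManifold 𝓘(ℝ, E) ∞ M] (k : ℕ) :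
    ChartedSpaceCore (Fin (k + 1) → E) (Jet E M k) where
  atlas := {c | ∃ (e : OpenPartialHomeomorph M E) (he : e ∈ atlas E M), c = jetChart k e he}
  chartAt j := jetChart k (chartAt E j.base) (chart_mem_atlas E j.base)
  mem_chart_source j := mem_chart_source E j.base
  chart_mem_atlas j := ⟨_, _, rfl⟩
  open_source := by
    rintro _ _ ⟨e, he, rfl⟩ ⟨e', he', rfl⟩
    rw [jetChart_trans_source]
    exact (e.symm.trans e').open_source.preimage (continuous_apply 0)
  continuousOn_toFun := by
    rintro _ _ ⟨e, he, rfl⟩ ⟨e', he', rfl⟩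
    exact (contDiffOn_jetChart_transition he he').continuousOn

variable {E M}

instance [IsManifold 𝓘(ℝ, E) ∞ M] (k : ℕ) : TopologicalSpace (Jet E M k) :=
  (jetChartedSpaceCore E M k).toTopologicalSpace

instance [IsManifold 𝓘(ℝ, E) ∞ M] (k : ℕ) : ChartedSpace (Fin (k + 1) → E) (Jet E M k) :=
  (jetChartedSpaceCore E M k).toChartedSpace

instance [IsManifold 𝓘(ℝ, E) ∞ M] (k : ℕ) :
    IsManifold 𝓘(ℝ, Fin (k + 1) → E) ∞ (Jet E M k) := by
  refine isManifold_of_contDiffOn _ _ _ fun c c' hc hc' => ?_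
  obtain ⟨_, ⟨e, he, rfl⟩, rfl⟩ := mem_iUnion₂.mp hc
  obtain ⟨_, ⟨e', he', rfl⟩, rfl⟩ := mem_iUnion₂.mp hc'
  have := contDiffOn_jetChart_transition (k := k) he he'
  simpa using! this

/-- The projection `T^{k+1} M → T^k M`, `j^{k+1}_0 γ ↦ j^k_0 γ`. -/
def Jet.proj (k : ℕ) (j : Jet E M (k + 1)) : Jet E M k :=
  Quotient.map' (s₁ := jetSetoid E M (k + 1)) (s₂ := jetSetoid E M k) id
    (fun _ _ h => ⟨h.1, fun e he hs i hi => h.2 e he hs i (Nat.le_succ_of_le hi)⟩) j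

theorem Jet.coord_proj {k : ℕ} {e : OpenPartialHomeomorph M E} (he : e ∈ atlas E M)
    (j : Jet E M (k + 1)) (h : j.base ∈ e.source) (i : Fin (k + 1)) :
    Jet.coord e (Jet.proj k j) i = Jet.coord e j i.castSucc := by
  obtain ⟨γ⟩ := j
  have h1 := Jet.coord_mk (k := k) he γ h
  have h2 := Jet.coord_mk (k := k + 1) he γ h
  exact (congrFun h1 i).trans (congrFun h2 i.castSucc).symm

theorem Jet.contMDiff_proj [IsManifold 𝓘(ℝ, E) ∞ M] (k : ℕ) :
    ContMDiff 𝓘(ℝ, Fin (k + 1 + 1) → E) 𝓘(ℝ, Fin (k + 1) → E) ∞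
      (Jet.proj k : Jet E M (k + 1) → Jet E M k) := by
  intro j
  have hbase : ∀ j : Jet E M (k + 1), (Jet.proj k j).base = j.base := by rintro ⟨γ⟩; rfl
  have hsub : MapsTo (Jet.proj k) (extChartAt 𝓘(ℝ, Fin (k + 1 + 1) → E) j).source
      (extChartAt 𝓘(ℝ, Fin (k + 1) → E) (Jet.proj k j)).source := by
    intro j' hj'
    rw [extChartAt_source] at hj' ⊢
    change (Jet.proj k j').base ∈ (chartAt E (Jet.proj k j).base).source
    rw [hbase, hbase]
    exact hj'
  refine ContMDiffOn.contMDiffAt ?_ (extChartAt_source_mem_nhds (I := 𝓘(ℝ, Fin (k + 1 + 1) → E)) j)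
  rw [contMDiffOn_iff_of_subset_source' (y := Jet.proj k j) subset_rfl hsub]
  have hlin : ContDiff ℝ ∞ (fun (q : Fin (k + 1 + 1) → E) (i : Fin (k + 1)) => q i.castSucc) := by
    fun_prop
  refine hlin.contDiffOn.congr ?_
  rintro _ ⟨j', hj', rfl⟩
  rw [Function.comp_apply, Function.comp_apply, (extChartAt _ j).left_inv hj']
  rw [extChartAt_source] at hj'
  change Jet.coord (chartAt E (Jet.proj k j).base) (Jet.proj k j') =
    fun i : Fin (k + 1) => Jet.coord (chartAt E j.base) j' i.castSucc
  funext i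
  rw [hbase]
  exact Jet.coord_proj (chart_mem_atlas E j.base) j' hj' i

end Jets


section Forms

variable {E : Type*} [NormedAddCommGroup E] [NormedSpace ℝ E]
  {H : Type*} [TopologicalSpace H] (I : ModelWithCorners ℝ E H)
  (X : Type*) [TopologicalSpace X] [ChartedSpace H X]
  {E' : Type*} [NormedAddCommGroup E'] [NormedSpace ℝ E']
  {H' : Type*} [TopologicalSpace H'] {I' : ModelWithCorners ℝ E' H'}
  {Y : Type*} [TopologicalSpace Y] [ChartedSpace H' Y]

/-- (Not necessarily smooth) differential `n`-forms on a manifold. -/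
abbrev DiffForm (n : ℕ) : Type _ := ∀ x : X, TangentSpace I x [⋀^Fin n]→L[ℝ] ℝ

variable {I X} {n : ℕ}

/-- The local expression of a differential form in the preferred chart at `x₀`: its pullback
under the inverse of this chart. -/
def DiffForm.inChart (σ : DiffForm I X n) (x₀ : X) (y : E) : E [⋀^Fin n]→L[ℝ] ℝ :=
  (σ ((extChartAt I x₀).symm y)).compContinuousLinearMap
    (mfderivWithin 𝓘(ℝ, E) I (extChartAt I x₀).symm (range I) y)

/-- The exterior derivative of a differential form. At the point `x` it is the exterior derivative
of the local expression in the preferred chart at `x`, which is the chart through which the tangent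
space at `x` is identified with the model vector space. -/
def DiffForm.d (σ : DiffForm I X n) : DiffForm I X (n + 1) := fun x =>
  (extDerivWithin (σ.inChart x) (range I) (extChartAt I x x) : E [⋀^Fin (n + 1)]→L[ℝ] ℝ)

/-- Smoothness of a differential form. -/
def DiffForm.IsSmooth (σ : DiffForm I X n) : Prop :=
  ∀ x, ContDiffWithinAt ℝ ∞ (σ.inChart x) (range I) (extChartAt I x x)

/-- The pullback `f^* σ`. -/
def DiffForm.pullback (σ : DiffForm I' Y n) (f : X → Y) : DiffForm I X n :=
  fun x => (σ (f x)).compContinuousLinearMap (mfderiv I I' f x)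

/-- The differential of a real-valued function. -/
def differential (I : ModelWithCorners ℝ E H) (f : X → ℝ) (x : X) : TangentSpace I x →L[ℝ] ℝ :=
  mfderiv I 𝓘(ℝ, ℝ) f x

/-- Symplectic forms: smooth, closed and nondegenerate differential `2`-forms. -/
structure DiffForm.IsSymplectic (σ : DiffForm I X 2) : Prop where
  smooth : σ.IsSmooth
  closed : σ.d = 0
  nondegenerate : ∀ x, ∀ v : TangentSpace I x,
    (∀ w : TangentSpace I x, σ x ![v, w] = 0) → v = 0

/-- `(S, ι^* σ)` is a symplectic manifold, where `ι : S → Y` is the inclusion: `S` is an embedded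
submanifold of `Y` and the pullback of `σ` to `S` is a symplectic form. -/
def IsSymplecticSubmanifold (σ : DiffForm I' Y 2) (S : Set Y) : Prop :=
  ∃ (r : ℕ) (_ : ChartedSpace (EuclideanSpace ℝ (Fin r)) S),
    IsManifold (𝓡 r) ∞ S ∧
    Manifold.IsSmoothEmbedding (𝓡 r) I' ∞ (Subtype.val : S → Y) ∧
    DiffForm.IsSymplectic (I := 𝓡 r) (σ.pullback (Subtype.val : S → Y))

end Forms

section Mechanics

variable (E : Type*) [NormedAddCommGroup E] [NormedSpace ℝ E]
  (M : Type*) [TopologicalSpace M] [ChartedSpace E M]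
  (F : Type*) [NormedAddCommGroup F] [NormedSpace ℝ F]
  (G : Type*) [TopologicalSpace G] [ChartedSpace F G] [Group G]
  (k : ℕ)

/-- The Lie algebra `𝔤 = T_e G`. In Mathlib, the underlying vector space of a tangent space
is the model space, which provides the norm. -/
def LieAlg : Type _ := GroupLieAlgebra 𝓘(ℝ, F) G

instance : NormedAddCommGroup (LieAlg F G) := inferInstanceAs (NormedAddCommGroup F)
instance : NormedSpace ℝ (LieAlg F G) := inferInstanceAs (NormedSpace ℝ F)

/-- The higher-order tangent bundle `T^k (M × G) = T^k M × G × k𝔤` (left-trivialized).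
Its points are `(j, g, ξ)` with `ξ = (ξ^0, …, ξ^{k-1})`: a curve `g(t)` in `G` has the `k`-jet given
by `g(0)` and `ξ^i = d^i/dt^i (g(t)⁻¹ g'(t))` at `t = 0`. -/
abbrev HigherTangent : Type _ := Jet E M k × G × (Fin k → LieAlg F G)

/-- The vector space on which `T^k (M × G)` is modelled. -/
abbrev HigherTangentModel : Type _ := (Fin (k + 1) → E) × F × (Fin k → LieAlg F G)

/-- The model with corners of `T^k (M × G)` (a manifold without boundary). -/
abbrev htI : ModelWithCorners ℝ (HigherTangentModel E F G k)
    (ModelProd (Fin (k + 1) → E) (ModelProd F (Fin k → LieAlg F G))) :=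
  𝓘(ℝ, Fin (k + 1) → E).prod (𝓘(ℝ, F).prod 𝓘(ℝ, Fin k → LieAlg F G))

variable [IsManifold 𝓘(ℝ, E) ∞ M] [LieGroup 𝓘(ℝ, F) ∞ G]

/-- The projection `T^{k+1} (M × G) → T^k (M × G)`. -/
def htProj : C^∞⟮htI E F G (k + 1), HigherTangent E M F G (k + 1);
    htI E F G k, HigherTangent E M F G k⟯ where
  val a := (Jet.proj k a.1, a.2.1, fun i => a.2.2 i.castSucc)
  property := by
    refine ((Jet.contMDiff_proj k).comp contMDiff_fst).prodMk
      ((contMDiff_fst.comp contMDiff_snd).prodMk ?_)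
    have h : ContDiff ℝ ∞ (fun (ξ : Fin (k + 1) → LieAlg F G) (i : Fin k) => ξ i.castSucc) := by
      fun_prop
    exact h.contMDiff.comp (contMDiff_snd.comp contMDiff_snd)

/-- The cotangent spaces of `T^k (M × G)`. -/
abbrev Cotangent (b : HigherTangent E M F G k) : Type _ :=
  TangentSpace (htI E F G k) b →L[ℝ] Bundle.Trivial (HigherTangent E M F G k) ℝ b

/-- The Pontryagin bundle `W = T^{k+1} (M × G) ×_{T^k (M × G)} T^* (T^k (M × G))`, as the pullback
of the cotangent bundle of `T^k (M × G)` under the projection. A point is a pair `⟨a, α⟩` with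
`a` in `T^{k+1} (M × G)` and `α` a covector at the image of `a` in `T^k (M × G)`. -/
abbrev Pontryagin : Type _ :=
  Bundle.TotalSpace (HigherTangentModel E F G k →L[ℝ] ℝ)
    ((htProj E M F G k) *ᵖ (Cotangent E M F G k))

/-- The model with corners of the Pontryagin bundle (a manifold without boundary). -/
abbrev ponI := (htI E F G (k + 1)).prod 𝓘(ℝ, HigherTangentModel E F G k →L[ℝ] ℝ)

variable {E M F G k}

/-- The covector `α` at a point `⟨a, α⟩` of the Pontryagin bundle. -/
def Pontryagin.covector (w : Pontryagin E M F G k) :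
    TangentSpace (htI E F G k) (htProj E M F G k w.1) →L[ℝ] ℝ := w.2

/-- The canonical embedding `T^{k+1} (M × G) → T (T^k (M × G))`: in natural coordinates,
`(q_0, …, q_{k+1}, g, ξ^0, …, ξ^k)` is mapped to the vector
`(q_1, …, q_{k+1}, g ξ^0, ξ^1, …, ξ^k)` at `(q_0, …, q_k, g, ξ^0, …, ξ^{k-1})`. -/
def htEmbed (a : HigherTangent E M F G (k + 1)) :
    TangentSpace (htI E F G k) (htProj E M F G k a) :=
  ((fun i : Fin (k + 1) => Jet.coord (chartAt E (Jet.proj k a.1).base) a.1 i.succ,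
    mulInvariantVectorField (I := 𝓘(ℝ, F)) (a.2.2 0) a.2.1,
    fun i : Fin k => a.2.2 i.succ) : HigherTangentModel E F G k)

/-- The coupling function `⟨a, α⟩ ↦ α(a)`. -/
def coupling (w : Pontryagin E M F G k) : ℝ := w.covector (htEmbed w.1)

/-- The Hamiltonian `H = C - L`. -/
def hamiltonian (L : HigherTangent E M F G (k + 1) → ℝ) (w : Pontryagin E M F G k) : ℝ :=
  coupling w - L w.1

variable (E M F G k)

/-- The pullback to the Pontryagin bundle of the Liouville `1`-form of `T^* (T^k (M × G))`. -/
def liouvilleForm : DiffForm (ponI E F G k) (Pontryagin E M F G k) 1 := fun w =>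
  ContinuousAlternatingMap.ofSubsingleton ℝ _ ℝ 0
    (w.covector.comp (mfderiv (ponI E F G k) (htI E F G k)
      (fun w : Pontryagin E M F G k => htProj E M F G k w.1) w))

/-- The presymplectic form `Ω` of the Pontryagin bundle, i.e. the pullback of the canonical
symplectic form `ω = -dθ` of `T^* (T^k (M × G))`. -/
def presymplecticForm : DiffForm (ponI E F G k) (Pontryagin E M F G k) 2 :=
  -(liouvilleForm E M F G k).d

variable {E M F G k}

variable {n : ℕ} (L : HigherTangent E M F G (k + 1) → ℝ)
  (Φ : Fin n → HigherTangent E M F G (k + 1) → ℝ)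

/-- `l` are Lagrange multipliers at `w`: `dH + l_a dΦ^a` vanishes on the kernel of `Ω` at `w`. -/
def IsMultiplier (w : Pontryagin E M F G k) (l : Fin n → ℝ) : Prop :=
  ∀ Y : TangentSpace (ponI E F G k) w,
    (∀ Z : TangentSpace (ponI E F G k) w, presymplecticForm E M F G k w ![Y, Z] = 0) →
    differential (ponI E F G k) (hamiltonian L) w Y +
      ∑ a, l a * differential (ponI E F G k)
        (fun w' : Pontryagin E M F G k => Φ a w'.1) w Y = 0

/-- The compatibility submanifold `W_c`. -/
def compatSet : Set (Pontryagin E M F G k) :=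
  {w | (∀ a, Φ a w.1 = 0) ∧ ∃ l, IsMultiplier L Φ w l}

/-- Moves the top-order coordinates `(q_{k+1}, ξ^k)` of the point `a` of `T^{k+1} (M × G)` by
`v`, in the natural coordinates induced by the chart `e` of `M`, all other coordinates being
fixed. -/
def topShift (e : OpenPartialHomeomorph M E) (he : e ∈ atlas E M)
    (a : HigherTangent E M F G (k + 1)) (v : E × LieAlg F G) : HigherTangent E M F G (k + 1) :=
  ((jetChart (k + 1) e he).symm (Jet.coord e a.1 + Pi.single (Fin.last (k + 1)) v.1),
    a.2.1, a.2.2 + Pi.single (Fin.last k) v.2)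

/-- The Hessian of `L - l_a Φ^a` in the top-order coordinates `(q_{k+1}, ξ^k)`, bordered by the
Jacobian of the `Φ^a` in these coordinates. -/
def borderedMatrix {m d : ℕ} (bM : Module.Basis (Fin m) ℝ E)
    (bG : Module.Basis (Fin d) ℝ (LieAlg F G)) (l : Fin n → ℝ)
    (e : OpenPartialHomeomorph M E) (he : e ∈ atlas E M) (a : HigherTangent E M F G (k + 1)) :
    Matrix ((Fin m ⊕ Fin d) ⊕ Fin n) ((Fin m ⊕ Fin d) ⊕ Fin n) ℝ :=
  let f : E × LieAlg F G → ℝ := fun v =>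
    L (topShift e he a v) - ∑ c, l c * Φ c (topShift e he a v)
  let hess : Matrix (Fin m ⊕ Fin d) (Fin m ⊕ Fin d) ℝ := Matrix.of fun x y =>
    fderiv ℝ (fderiv ℝ f) 0 (bM.prod bG x) (bM.prod bG y)
  let jac : Matrix (Fin n) (Fin m ⊕ Fin d) ℝ := Matrix.of fun c x =>
    fderiv ℝ (fun v => Φ c (topShift e he a v)) 0 (bM.prod bG x)
  Matrix.fromBlocks hess jac.transpose jac 0

/-- The bordered matrix is nondegenerate along `W_c`. -/
def IsRegularAlong {m d : ℕ} (bM : Module.Basis (Fin m) ℝ E)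
    (bG : Module.Basis (Fin d) ℝ (LieAlg F G)) : Prop :=
  ∀ w ∈ compatSet L Φ, ∀ l, IsMultiplier L Φ w l → ∀ (e : OpenPartialHomeomorph M E)
    (he : e ∈ atlas E M), w.1.1.base ∈ e.source → (borderedMatrix L Φ bM bG l e he w.1).det ≠ 0

variable {L Φ} {r : ℕ} [ChartedSpace (EuclideanSpace ℝ (Fin r)) (compatSet L Φ)]

/-- The dynamical equation `i(X) Ω_{W_c} = d(H|_{W_c})` on `W_c`. -/
def SolvesDynamics (X : ∀ x : compatSet L Φ, TangentSpace (𝓡 r) x) : Prop :=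
  ∀ x, ∀ u : TangentSpace (𝓡 r) x,
    (presymplecticForm E M F G k).pullback (I := 𝓡 r) (Subtype.val : compatSet L Φ → _) x ![X x, u]
      = differential (𝓡 r) (fun y : compatSet L Φ => hamiltonian L y.1) x u

/-- The extrinsic dynamical equation along `W_c`, for a vector field `X` tangent to `W_c`:
`i(X) Ω - dH` annihilates the tangent spaces `⋂ ker dΦ^a` of the submanifold
`{Φ^a = 0}` of the Pontryagin bundle. -/
def SolvesExtrinsicDynamics (X : ∀ x : compatSet L Φ, TangentSpace (𝓡 r) x) : Prop :=
  ∀ x : compatSet L Φ, ∀ Z : TangentSpace (ponI E F G k) x.1,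
    (∀ a, differential (ponI E F G k) (fun w : Pontryagin E M F G k => Φ a w.1) x.1 Z = 0) →
    presymplecticForm E M F G k x.1
      ![mfderiv (𝓡 r) (ponI E F G k) (Subtype.val : compatSet L Φ → _) x (X x), Z]
      = differential (ponI E F G k) (hamiltonian L) x.1 Z

end Mechanics

end

/-!
The proof reduces the theorem to multivariable calculus in natural coordinates, where `W` is
`(B × B^*) × U`: here `b ∈ B` are the natural coordinates of `T^k (M × G)`, `p ∈ B^*` the
momenta, and `u ∈ U` the top-order coordinates `(q_{k+1}, ξ^k)` (`ponChart`). In these coordinates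
`Ω` is the pullback of the canonical symplectic form of `B × B^*` (`presymplecticForm_eq`), so that
its kernel consists of the directions of `U`, and `H = ⟨p, J⟩ - L`, where the coordinate expression
`J` of the canonical embedding is affine and injective as a function of `u`
(`isPairingSystem_ponChart`). Therefore `λ` is a multiplier exactly if the derivative of
`H + λ_a Φ^a` in the directions of `U` vanishes, and, as `J` is affine in `u`, the Hessian of this
function in these directions is that of `-(L - λ_a Φ^a)` (`IsPairingSystem.isLocallyRegular_iff`).
The bordered matrices in different natural coordinates are related by congruence, because the
transition maps of jets are affine in the top-order coordinate (`exists_topShift_eq`,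
`IsBorderedNondegenerate.of_chart`).

The bordered matrix is the derivative, with respect to `(u, λ)`, of the system of equations for
`W_c` and the multipliers (`systemMap`). If it is nondegenerate along `W_c`, the implicit function
theorem solves the system for `(u, λ)` as functions of `(b, p)`. Since the multipliers at points
close to a given one are close to the multipliers there (`eventually_isLocalMultiplier_close`), no
other branch of solutions interferes, and `W_c` is locally the graph of a smooth function `u = s(b, p)`
(`exists_graph_localCompatSet`). Hence `W_c` is an embedded submanifold on which `(b, p)` are local
coordinates, canonical for `ι^*Ω` (`isSymplecticSubmanifold_of_regular`).

Conversely, the system is always a submersion in all the variables `(b, p, u, λ)`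
(`IsLocalSystem.surjective_fderiv_systemMap`), so every vector in the kernel of its derivative is the
velocity of a curve of solutions (`exists_curve_mem_localCompatSet`), and its `(b, p, u)`-component is
tangent to `W_c` when `W_c` is an embedded submanifold (`Manifold.IsSmoothEmbedding.velocity_mem_range`).
A kernel vector `(u, μ)` of the bordered matrix thus gives a tangent vector in the kernel of `Ω`, and
nondegeneracy of `ι^*Ω` implies `u = 0`. Then `μ_a dΦ^a` vanishes on `U`, so it is the contraction of
`Ω` with a momentum direction; the symmetry of the bordered matrix allows one to correct this
direction by an element of `U` to a tangent vector of `W_c`, and since the `dΦ^a` vanish on `W_c`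
nondegeneracy implies that it is zero, so that `μ = 0` (`isLocallyRegular_of_nondegenerate`).

For the dynamics, the intrinsic equation is solved in the coordinates `(b, p)` by a Hamiltonian
vector field (`exists_smooth_solution`). It is equivalent to the extrinsic one: every vector
annihilated by the `dΦ^a` is the sum of a tangent vector of `W_c` and of an element of `ker Ω` which
the `dΦ^a` annihilate as well, and on the latter `dH` vanishes by the definition of multipliers
(`IsRegularChart.extrinsic_iff`).
-/

noncomputable section

/-! ### The equations of the compatibility submanifold -/

section Augmented

variable {V U : Type*} [NormedAddCommGroup V] [NormedSpace ℝ V]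
  [NormedAddCommGroup U] [NormedSpace ℝ U] {n : ℕ}

/-- The function `H + l_a Φ^a`. -/
def augmented {X : Type*} (H : X → ℝ) (Φ : Fin n → X → ℝ) (l : Fin n → ℝ) (x : X) : ℝ :=
  H x + ∑ a, l a * Φ a x

variable {H : V → ℝ} {Φ : Fin n → V → ℝ} {v : V}

theorem contDiffAt_augmented (hH : ContDiffAt ℝ ∞ H v) (hΦ : ∀ a, ContDiffAt ℝ ∞ (Φ a) v)
    (l : Fin n → ℝ) : ContDiffAt ℝ ∞ (augmented H Φ l) v :=
  hH.add (ContDiffAt.sum fun a _ => contDiffAt_const.mul (hΦ a))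

theorem fderiv_augmented (hH : DifferentiableAt ℝ H v) (hΦ : ∀ a, DifferentiableAt ℝ (Φ a) v)
    (l : Fin n → ℝ) :
    fderiv ℝ (augmented H Φ l) v = fderiv ℝ H v + ∑ a, l a • fderiv ℝ (Φ a) v :=
  (hH.hasFDerivAt.add (HasFDerivAt.fun_sum (u := Finset.univ) fun a _ =>
    (hΦ a).hasFDerivAt.const_mul (l a))).fderiv

theorem fderiv_fderiv_augmented (hH : ContDiffAt ℝ ∞ H v) (hΦ : ∀ a, ContDiffAt ℝ ∞ (Φ a) v)
    (l : Fin n → ℝ) :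
    fderiv ℝ (fderiv ℝ (augmented H Φ l)) v =
      fderiv ℝ (fderiv ℝ H) v + ∑ a, l a • fderiv ℝ (fderiv ℝ (Φ a)) v := by
  have h : fderiv ℝ (augmented H Φ l) =ᶠ[𝓝 v]
      fun v => fderiv ℝ H v + ∑ a, l a • fderiv ℝ (Φ a) v := by
    have h1 := (hH.of_le (m := 1) (by exact_mod_cast le_top)).eventually (by simp)
    have h2 := Filter.eventually_all.2 fun a =>
      ((hΦ a).of_le (m := 1) (by exact_mod_cast le_top)).eventually (by simp)
    filter_upwards [h1, h2] with v h1 h2 using fderiv_augmented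
      (h1.differentiableAt (by simp)) (fun a => (h2 a).differentiableAt (by simp)) l
  have h1 := (hH.fderiv_right (m := ∞) (by simp)).differentiableAt (by simp)
  have h2 := fun a => ((hΦ a).fderiv_right (m := ∞) (by simp)).differentiableAt (by simp)
  rw [h.fderiv_eq]
  exact (h1.hasFDerivAt.add (HasFDerivAt.fun_sum (u := Finset.univ) fun a _ =>
    (h2 a).hasFDerivAt.fun_const_smul (l a))).fderiv

/-- The equations of `W_c`, with the multipliers as additional unknowns: the constraints, and the
derivative of `H + l_a Φ^a` in the directions of `U`. -/
def systemMap (j : U →L[ℝ] V) (H : V → ℝ) (Φ : Fin n → V → ℝ) (x : V × (Fin n → ℝ)) :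
    (Fin n → ℝ) × (U →L[ℝ] ℝ) :=
  (fun a => Φ a x.1, (fderiv ℝ H x.1 + ∑ a, x.2 a • fderiv ℝ (Φ a) x.1).comp j)

theorem systemMap_eq_zero_iff (j : U →L[ℝ] V) (hH : ContDiffAt ℝ ∞ H v)
    (hΦ : ∀ a, ContDiffAt ℝ ∞ (Φ a) v) (l : Fin n → ℝ) :
    systemMap j H Φ (v, l) = 0 ↔
      (∀ a, Φ a v = 0) ∧ ∀ u, fderiv ℝ (augmented H Φ l) v (j u) = 0 := by
  rw [systemMap, Prod.ext_iff]
  refine and_congr (by simp [funext_iff]) ?_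
  simp only [fderiv_augmented (hH.differentiableAt (by simp))
    (fun a => (hΦ a).differentiableAt (by simp)), ContinuousLinearMap.ext_iff]
  simp

theorem contDiffAt_systemMap (j : U →L[ℝ] V) (hH : ContDiffAt ℝ ∞ H v)
    (hΦ : ∀ a, ContDiffAt ℝ ∞ (Φ a) v) (l : Fin n → ℝ) :
    ContDiffAt ℝ ∞ (systemMap j H Φ) (v, l) := by
  have hl : ∀ a, ContDiffAt ℝ ∞ (fun x : V × (Fin n → ℝ) => x.2 a) (v, l) := by
    intro a; fun_prop
  unfold systemMap
  refine ContDiffAt.prodMk (contDiffAt_pi.2 fun a => (hΦ a).comp _ contDiffAt_fst) ?_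
  refine ContDiffAt.clm_comp ?_ contDiffAt_const
  exact ((hH.fderiv_right (m := ∞) (by simp)).comp _ contDiffAt_fst).add
    (ContDiffAt.sum fun a _ =>
      (hl a).smul (((hΦ a).fderiv_right (m := ∞) (by simp)).comp _ contDiffAt_fst))

theorem fderiv_systemMap (j : U →L[ℝ] V) (hH : ContDiffAt ℝ ∞ H v)
    (hΦ : ∀ a, ContDiffAt ℝ ∞ (Φ a) v) (l : Fin n → ℝ) (X : V) (μ : Fin n → ℝ) :
    fderiv ℝ (systemMap j H Φ) (v, l) (X, μ) = (fun a => fderiv ℝ (Φ a) v X,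
      (fderiv ℝ (fderiv ℝ (augmented H Φ l)) v X + ∑ a, μ a • fderiv ℝ (Φ a) v).comp j) := by
  have h0 : ∀ a, HasFDerivAt (Φ a) (fderiv ℝ (Φ a) v) v := fun a =>
    ((hΦ a).differentiableAt (by simp)).hasFDerivAt
  have h1 := ((hH.fderiv_right (m := ∞) (by simp)).differentiableAt (by simp)).hasFDerivAt
  have h2 := fun a =>
    (((hΦ a).fderiv_right (m := ∞) (by simp)).differentiableAt (by simp)).hasFDerivAt
  have hf : HasFDerivAt (Prod.fst : V × (Fin n → ℝ) → _)
    (ContinuousLinearMap.fst ℝ _ _) (v, l) := hasFDerivAt_fst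
  have hl : ∀ a, HasFDerivAt (fun x : V × (Fin n → ℝ) => x.2 a)
      ((ContinuousLinearMap.proj a).comp (ContinuousLinearMap.snd ℝ _ _)) (v, l) := fun a =>
    ((ContinuousLinearMap.proj (R := ℝ) (φ := fun _ : Fin n => ℝ) a).comp
      (ContinuousLinearMap.snd ℝ V _)).hasFDerivAt
  have hA : HasFDerivAt (fun x : V × (Fin n → ℝ) => fun a => Φ a x.1)
      (ContinuousLinearMap.pi fun a => (fderiv ℝ (Φ a) v).comp (ContinuousLinearMap.fst ℝ _ _))
      (v, l) := hasFDerivAt_pi.2 fun a => HasFDerivAt.comp (v, l) (g := Φ a) (h0 a) hf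
  have hB := (HasFDerivAt.comp (v, l) (g := fderiv ℝ H) h1 hf).add (HasFDerivAt.fun_sum
    (u := Finset.univ) fun a _ => (hl a).fun_smul (HasFDerivAt.comp (v, l) (g := fderiv ℝ (Φ a)) (h2 a) hf))
  have hC := ((ContinuousLinearMap.compL ℝ U V ℝ).flip j).hasFDerivAt.comp (v, l) hB
  have := hA.prodMk hC
  rw [HasFDerivAt.fderiv (f := systemMap j H Φ) this]
  refine Prod.ext ?_ ?_
  · ext a; simp
  · ext u
    simp [fderiv_fderiv_augmented hH hΦ, Finset.sum_add_distrib, add_assoc]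

theorem fderiv_systemMap_eq_zero_iff (j : U →L[ℝ] V) (hH : ContDiffAt ℝ ∞ H v)
    (hΦ : ∀ a, ContDiffAt ℝ ∞ (Φ a) v) (l : Fin n → ℝ) (X : V) (μ : Fin n → ℝ) :
    fderiv ℝ (systemMap j H Φ) (v, l) (X, μ) = 0 ↔ (∀ a, fderiv ℝ (Φ a) v X = 0) ∧
      ∀ u, fderiv ℝ (fderiv ℝ (augmented H Φ l)) v X (j u)
        + ∑ a, μ a * fderiv ℝ (Φ a) v (j u) = 0 := by
  rw [fderiv_systemMap j hH hΦ, Prod.ext_iff]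
  refine and_congr (by simp [funext_iff]) ?_
  simp [ContinuousLinearMap.ext_iff]

end Augmented

/-! ### Local structure of the compatibility submanifold -/

section LocalStructure

variable {V Q U : Type*} [NormedAddCommGroup V] [NormedSpace ℝ V]
  [NormedAddCommGroup Q] [NormedSpace ℝ Q]
  [NormedAddCommGroup U] [NormedSpace ℝ U] {n : ℕ}

/-- `l` are multipliers at `v`: the derivative of `H + l_a Φ^a` at `v` vanishes in the directions
of `U`, which are included in `V` through `j`. -/
def IsLocalMultiplier (j : U →L[ℝ] V) (H : V → ℝ) (Φ : Fin n → V → ℝ) (v : V) (l : Fin n → ℝ) :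
    Prop :=
  ∀ u : U, fderiv ℝ (augmented H Φ l) v (j u) = 0

/-- The local model of `W_c`: the points where the constraints hold and which admit
multipliers. -/
def localCompatSet (j : U →L[ℝ] V) (H : V → ℝ) (Φ : Fin n → V → ℝ) : Set V :=
  {v | (∀ a, Φ a v = 0) ∧ ∃ l, IsLocalMultiplier j H Φ v l}

/-- The Hessian of `H + l_a Φ^a` in the directions of `U`, bordered by the derivatives of
the `Φ^a`, has trivial kernel. -/
def IsLocallyRegular (j : U →L[ℝ] V) (H : V → ℝ) (Φ : Fin n → V → ℝ) (v : V) (l : Fin n → ℝ) :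
    Prop :=
  ∀ (u : U) (μ : Fin n → ℝ),
    (∀ u' : U, fderiv ℝ (fderiv ℝ (augmented H Φ l)) v (j u) (j u')
      + ∑ a, μ a * fderiv ℝ (Φ a) v (j u') = 0) →
    (∀ a, fderiv ℝ (Φ a) v (j u) = 0) → u = 0 ∧ μ = 0

/-- If the system `systemMap = 0` is a submersion at `(v, l)`, every vector in the kernel of its
derivative yields a velocity of a curve in the local model of `W_c`. -/
theorem exists_curve_mem_localCompatSet [FiniteDimensional ℝ V] [FiniteDimensional ℝ U]
    {j : U →L[ℝ] V} {O : Set V} (hO : IsOpen O)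
    {H : V → ℝ} {Φ : Fin n → V → ℝ} (hH : ContDiffOn ℝ ∞ H O) (hΦ : ∀ a, ContDiffOn ℝ ∞ (Φ a) O)
    {v : V} (hv : v ∈ O) {l : Fin n → ℝ} (h0 : systemMap j H Φ (v, l) = 0)
    (hsurj : Function.Surjective (fderiv ℝ (systemMap j H Φ) (v, l)))
    {X : V} {μ : Fin n → ℝ} (hX : fderiv ℝ (systemMap j H Φ) (v, l) (X, μ) = 0) :
    ∃ γ : ℝ → V, γ 0 = v ∧ HasDerivAt γ X 0 ∧ ∀ᶠ t in 𝓝 0, γ t ∈ localCompatSet j H Φ := by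
  have hH' : ∀ w ∈ O, ContDiffAt ℝ ∞ H w := fun w hw => hH.contDiffAt (hO.mem_nhds hw)
  have hΦ' : ∀ w ∈ O, ∀ a, ContDiffAt ℝ ∞ (Φ a) w :=
    fun w hw a => (hΦ a).contDiffAt (hO.mem_nhds hw)
  have hs := (contDiffAt_systemMap j (hH' v hv) (hΦ' v hv) l).hasStrictFDerivAt (by simp)
  have hr : (fderiv ℝ (systemMap j H Φ) (v, l)).range = ⊤ := LinearMap.range_eq_top.2 hsurj
  set K := (fderiv ℝ (systemMap j H Φ) (v, l)).ker
  let x : K := ⟨(X, μ), hX⟩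
  let c : ℝ → V × (Fin n → ℝ) := fun t =>
    hs.implicitFunction _ _ hr (systemMap j H Φ (v, l)) (t • x)
  have hc0 : c 0 = (v, l) := by simp [c]
  have hlin : HasDerivAt (fun t : ℝ => t • x) x 0 := by
    simpa using (hasDerivAt_id (0 : ℝ)).smul_const x
  have hc : HasDerivAt c (X, μ) 0 := by
    have h1 := (hs.to_implicitFunction hr).hasFDerivAt
    rw [← zero_smul ℝ x] at h1
    exact h1.comp_hasDerivAt (0 : ℝ) hlin
  refine ⟨fun t => (c t).1, by simp [hc0], hc.fst, ?_⟩
  have h2 : ∀ᶠ t in 𝓝 (0 : ℝ), systemMap j H Φ (c t) = 0 := by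
    have h3 := hs.map_implicitFunction_eq hr
    have h4 : Filter.Tendsto (fun t : ℝ => (systemMap j H Φ (v, l), t • x)) (𝓝 0)
        (𝓝 (systemMap j H Φ (v, l), 0)) := by
      refine tendsto_const_nhds.prodMk_nhds ?_
      have := hlin.continuousAt.tendsto
      rwa [zero_smul] at this
    filter_upwards [h4.eventually h3] with t ht
    rw [← h0]
    exact ht
  have h5 : ∀ᶠ t in 𝓝 (0 : ℝ), (c t).1 ∈ O :=
    hc.continuousAt.fst.preimage_mem_nhds (hO.mem_nhds (by simpa [hc0] using hv))
  filter_upwards [h2, h5] with t ht ht'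
  have := (systemMap_eq_zero_iff j (hH' _ ht') (hΦ' _ ht') (c t).2).1 ht
  exact ⟨this.1, _, this.2⟩

/-- If the derivatives of the constraints in the directions of `U` are independent at `v`, the
multipliers at nearby points are close to those at `v`. -/
theorem eventually_isLocalMultiplier_close [FiniteDimensional ℝ V] [FiniteDimensional ℝ U]
    {j : U →L[ℝ] V} {O : Set V} (hO : IsOpen O)
    {H : V → ℝ} {Φ : Fin n → V → ℝ} (hH : ContDiffOn ℝ ∞ H O) (hΦ : ∀ a, ContDiffOn ℝ ∞ (Φ a) O)
    {v : V} (hv : v ∈ O) {l : Fin n → ℝ} (hl : IsLocalMultiplier j H Φ v l)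
    (hinj : ∀ μ : Fin n → ℝ, (∀ u, ∑ a, μ a * fderiv ℝ (Φ a) v (j u) = 0) → μ = 0)
    {ε : ℝ} (hε : 0 < ε) :
    ∀ᶠ w in 𝓝 v, ∀ l', IsLocalMultiplier j H Φ w l' → ‖l' - l‖ < ε := by
  have hH' : ∀ w ∈ O, ContDiffAt ℝ ∞ H w := fun w hw => hH.contDiffAt (hO.mem_nhds hw)
  have hΦ' : ∀ w ∈ O, ∀ a, ContDiffAt ℝ ∞ (Φ a) w :=
    fun w hw a => (hΦ a).contDiffAt (hO.mem_nhds hw)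
  -- `A w μ` is the derivative of `μ_a Φ^a` at `w` in the directions of `U`
  let D : Fin n → V → (U →L[ℝ] ℝ) := fun a w => (fderiv ℝ (Φ a) w).comp j
  let A : V → (Fin n → ℝ) → (U →L[ℝ] ℝ) := fun w μ => ∑ a, μ a • D a w
  let r : V → (U →L[ℝ] ℝ) := fun w => (fderiv ℝ (augmented H Φ l) w).comp j
  have hAap : ∀ w μ u, A w μ u = ∑ a, μ a * fderiv ℝ (Φ a) w (j u) := by
    intro w μ u; simp [A, D]
  have hδ : ContinuousAt (fun w => ∑ a, ‖D a w - D a v‖) v := by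
    refine tendsto_finsetSum _ fun a _ => ?_
    have h1 : ContinuousAt (D a) v :=
      (((hΦ' v hv a).fderiv_right (m := 0) (by simp)).continuousAt).clm_comp continuousAt_const
    exact (h1.sub continuousAt_const).norm
  have hAδ : ∀ w μ, ‖A w μ - A v μ‖ ≤ (∑ a, ‖D a w - D a v‖) * ‖μ‖ := by
    intro w μ
    simp only [A, ← Finset.sum_sub_distrib, Finset.sum_mul]
    refine norm_sum_le_of_le _ fun a _ => ?_
    rw [show μ a • D a w - μ a • D a v = μ a • (D a w - D a v) from (smul_sub _ _ _).symm,
      norm_smul, mul_comm]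
    gcongr
    exact norm_le_pi_norm μ a
  have hrc : ContinuousAt r v :=
    (((contDiffAt_augmented (hH' v hv) (hΦ' v hv) l).fderiv_right (m := 0)
      (by simp)).continuousAt).clm_comp continuousAt_const
  have hr0 : r v = 0 := by ext u; exact hl u
  -- `K` bounds `μ` in terms of the covector `A v μ`, which determines it by independence
  obtain ⟨K', hK, hA⟩ := (∑ a, (LinearMap.proj a : (Fin n → ℝ) →ₗ[ℝ] ℝ).smulRight
    (D a v)).exists_antilipschitzWith (LinearMap.ker_eq_bot'.2 (by
    intro μ hμ
    refine hinj μ fun u => ?_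
    rw [← hAap]
    simpa [A] using congrArg (fun f : U →L[ℝ] ℝ => f u) hμ))
  obtain ⟨K, hKK⟩ : ∃ K : ℝ, K = NNReal.toReal K' := ⟨_, rfl⟩
  have hK' : 0 < K := hKK ▸ hK
  have hA' : ∀ μ, ‖μ‖ ≤ K * ‖A v μ‖ := fun μ => by
    simpa [hKK, A] using hA.le_mul_dist μ 0
  have e1 : ∀ᶠ w in 𝓝 v, ∑ a, ‖D a w - D a v‖ < (2 * K)⁻¹ := by
    refine hδ.tendsto.eventually (gt_mem_nhds ?_)
    simpa using hK'
  have e2 : ∀ᶠ w in 𝓝 v, ‖r w‖ < ε / (2 * K) := by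
    have := hrc.tendsto.eventually (Metric.ball_mem_nhds (r v) (div_pos hε (mul_pos two_pos hK')))
    simpa only [Metric.mem_ball, dist_eq_norm, hr0, sub_zero] using this
  filter_upwards [e1, e2, hO.mem_nhds hv] with w h1 h2 hw l' hl'
  have key : A w (l' - l) = - r w := by
    ext u
    have h3 := hl' u
    rw [fderiv_augmented ((hH' w hw).differentiableAt (by simp))
      (fun a => (hΦ' w hw a).differentiableAt (by simp))] at h3
    have h4 : r w u = fderiv ℝ H w (j u) + ∑ a, l a * fderiv ℝ (Φ a) w (j u) := by
      change fderiv ℝ (augmented H Φ l) w (j u) = _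
      rw [fderiv_augmented ((hH' w hw).differentiableAt (by simp))
        (fun a => (hΦ' w hw a).differentiableAt (by simp))]
      simp
    simp only [add_apply, sum_apply,
      smul_apply, smul_eq_mul] at h3
    rw [hAap, neg_apply, h4]
    simp only [Pi.sub_apply, sub_mul, Finset.sum_sub_distrib]
    linarith
  have h5 : ‖A v (l' - l)‖ ≤ ‖r w‖ + (2 * K)⁻¹ * ‖l' - l‖ := by
    have : A v (l' - l) = - r w - (A w (l' - l) - A v (l' - l)) := by
      rw [key]; abel
    rw [this]
    refine (norm_sub_le _ _).trans ?_
    rw [norm_neg]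
    gcongr
    exact (hAδ w _).trans (by gcongr)
  have h6 := (hA' (l' - l)).trans (mul_le_mul_of_nonneg_left h5 hK'.le)
  have h7 : (K : ℝ) * (‖r w‖ + (2 * K)⁻¹ * ‖l' - l‖) = K * ‖r w‖ + ‖l' - l‖ / 2 := by
    field_simp
  have h8 : (K : ℝ) * ‖r w‖ < ε / 2 := by
    rw [lt_div_iff₀ (by positivity)] at h2
    linarith
  linarith

/-- Near a regular point, the local model of `W_c` is a graph over `Q`: the implicit function theorem
solves the system for the point of `U` and the multipliers. -/
theorem exists_graph_localCompatSet_aux [FiniteDimensional ℝ Q] [FiniteDimensional ℝ U]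
    {O : Set (Q × U)} (hO : IsOpen O) {H : Q × U → ℝ} {Φ : Fin n → Q × U → ℝ}
    (hH : ContDiffOn ℝ ∞ H O) (hΦ : ∀ a, ContDiffOn ℝ ∞ (Φ a) O)
    {v : Q × U} (hv : v ∈ O) {l : Fin n → ℝ} (hv0 : ∀ a, Φ a v = 0)
    (hl : IsLocalMultiplier (.inr ℝ Q U) H Φ v l)
    (hreg : IsLocallyRegular (.inr ℝ Q U) H Φ v l) :
    ∃ s : Q → U, ContDiffAt ℝ ∞ s v.1 ∧ s v.1 = v.2 ∧
      ∀ᶠ w in 𝓝 v, w ∈ localCompatSet (.inr ℝ Q U) H Φ ↔ s w.1 = w.2 := by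
  have hH' : ∀ w ∈ O, ContDiffAt ℝ ∞ H w := fun w hw => hH.contDiffAt (hO.mem_nhds hw)
  have hΦ' : ∀ w ∈ O, ∀ a, ContDiffAt ℝ ∞ (Φ a) w :=
    fun w hw a => (hΦ a).contDiffAt (hO.mem_nhds hw)
  set j := ContinuousLinearMap.inr ℝ Q U
  let A : (Q × U × (Fin n → ℝ)) ≃L[ℝ] ((Q × U) × (Fin n → ℝ)) :=
    (ContinuousLinearEquiv.prodAssoc ℝ Q U (Fin n → ℝ)).symm
  let x : Q × U × (Fin n → ℝ) := (v.1, v.2, l)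
  have hAx : A x = (v, l) := rfl
  have hcd := contDiffAt_systemMap j (hH' v hv) (hΦ' v hv) l
  have hcdA : ContDiffAt ℝ ∞ (systemMap j H Φ ∘ A) x :=
    ContDiffAt.comp x (by rw [hAx]; exact hcd) A.contDiff.contDiffAt
  have hder : fderiv ℝ (systemMap j H Φ ∘ A) x =
      (fderiv ℝ (systemMap j H Φ) (v, l)).comp (A : _ →L[ℝ] _) := by
    rw [← hAx, A.comp_right_fderiv]
  have hS0 : systemMap j H Φ (v, l) = 0 :=
    (systemMap_eq_zero_iff j (hH' v hv) (hΦ' v hv) l).2 ⟨hv0, hl⟩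
  have hap : ∀ (u : U) (μ : Fin n → ℝ), (fderiv ℝ (systemMap j H Φ ∘ A) x ∘L
      .inr ℝ Q (U × (Fin n → ℝ))) (u, μ) = fderiv ℝ (systemMap j H Φ) (v, l) (j u, μ) := by
    intro u μ
    rw [hder]
    rfl
  have hinv : (fderiv ℝ (systemMap j H Φ ∘ A) x ∘L .inr ℝ Q (U × (Fin n → ℝ))).IsInvertible := by
    have hinj : Function.Injective
        (fderiv ℝ (systemMap j H Φ ∘ A) x ∘L .inr ℝ Q (U × (Fin n → ℝ))) := by
      rw [injective_iff_map_eq_zero]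
      rintro ⟨u, μ⟩ h
      rw [hap, fderiv_systemMap j (hH' v hv) (hΦ' v hv)] at h
      have h1 := congrArg Prod.fst h
      have h2 := congrArg Prod.snd h
      obtain ⟨rfl, rfl⟩ := hreg u μ (fun u' => by
        simpa using congrArg (fun f : U →L[ℝ] ℝ => f u') h2) (fun a => congrFun h1 a)
      rfl
    have hfr : Module.finrank ℝ (U × (Fin n → ℝ)) =
        Module.finrank ℝ ((Fin n → ℝ) × (U →L[ℝ] ℝ)) := by
      have : Module.finrank ℝ (U →L[ℝ] ℝ) = Module.finrank ℝ U :=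
        (LinearMap.toContinuousLinearMap (𝕜 := ℝ) (E := U) (F' := ℝ)).finrank_eq.symm.trans
          Subspace.dual_finrank_eq
      rw [Module.finrank_prod, Module.finrank_prod, this, add_comm]
    exact ⟨(LinearEquiv.ofInjectiveOfFinrankEq _ hinj hfr).toContinuousLinearEquiv,
      ContinuousLinearMap.ext fun _ => rfl⟩
  have hn : (∞ : WithTop ℕ∞) ≠ 0 := by simp
  let ψ := hcdA.implicitFunction hn hinv
  have hψ0 : ψ v.1 = (v.2, l) := hcdA.implicitFunction_apply_self hn hinv
  have hψc : ContDiffAt ℝ ∞ ψ v.1 := hcdA.contDiffAt_implicitFunction hn hinv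
  refine ⟨fun z => (ψ z).1, hψc.fst, by simp [hψ0], ?_⟩
  have hiff : ∀ᶠ y in 𝓝 x, systemMap j H Φ (A y) = 0 ↔ ψ y.1 = y.2 := by
    have := hcdA.eventually_apply_eq_iff_implicitFunction hn hinv
    simpa only [Function.comp_apply, hAx, hS0] using this
  have hinjΦ : ∀ μ : Fin n → ℝ, (∀ u, ∑ a, μ a * fderiv ℝ (Φ a) v (j u) = 0) → μ = 0 :=
    fun μ hμ => (hreg 0 μ (by simpa using hμ) (by simp)).2
  -- nearby points of `W_c` lift to nearby solutions of the system
  obtain ⟨N, hN, ε, hε, hNε⟩ : ∃ N ∈ 𝓝 v, ∃ ε > 0, ∀ w ∈ N, ∀ l', ‖l' - l‖ < ε →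
      (systemMap j H Φ (w, l') = 0 ↔ ψ w.1 = (w.2, l')) := by
    have h1 : ∀ᶠ y in 𝓝 (v, l), systemMap j H Φ y = 0 ↔ ψ y.1.1 = (y.1.2, y.2) := by
      have hc : ContinuousAt A.symm (v, l) := A.symm.continuous.continuousAt
      exact (hc.tendsto.eventually hiff).mono fun y hy => by
        rw [A.apply_symm_apply] at hy; exact hy
    rw [nhds_prod_eq, Filter.eventually_prod_iff] at h1
    obtain ⟨p, hp, q, hq, hpq⟩ := h1
    obtain ⟨ε, hε, hεq⟩ := Metric.eventually_nhds_iff.1 hq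
    exact ⟨_, hp, ε, hε, fun w hw l' hl' => hpq hw (hεq (by rwa [dist_eq_norm]))⟩
  have hψl : ∀ᶠ w in 𝓝 v, ‖(ψ w.1).2 - l‖ < ε := by
    have hc : ContinuousAt (fun w : Q × U => (ψ w.1).2) v :=
      (ContinuousAt.comp (x := v) hψc.continuousAt continuousAt_fst).snd
    have := hc.tendsto.eventually (Metric.ball_mem_nhds _ hε)
    simpa only [Metric.mem_ball, dist_eq_norm, hψ0] using this
  filter_upwards [hN, hψl, hO.mem_nhds hv,
    eventually_isLocalMultiplier_close hO hH hΦ hv hl hinjΦ hε] with w hw1 hw2 hw3 hw4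
  constructor
  · rintro ⟨h1, l', hl'⟩
    have := (hNε w hw1 l' (hw4 l' hl')).1
      ((systemMap_eq_zero_iff j (hH' w hw3) (hΦ' w hw3) l').2 ⟨h1, hl'⟩)
    rw [this]
  · intro h
    have h1 := (hNε w hw1 (ψ w.1).2 hw2).2 (Prod.ext h rfl)
    obtain ⟨h2, h3⟩ := (systemMap_eq_zero_iff j (hH' w hw3) (hΦ' w hw3) _).1 h1
    exact ⟨h2, _, h3⟩

/-- If the local model of `W_c` is regular at all of its points, it is a graph over `Q` near
each of them, of a function which is smooth in a neighbourhood. -/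
theorem exists_graph_localCompatSet [FiniteDimensional ℝ Q] [FiniteDimensional ℝ U]
    {O : Set (Q × U)} (hO : IsOpen O) {H : Q × U → ℝ} {Φ : Fin n → Q × U → ℝ}
    (hH : ContDiffOn ℝ ∞ H O) (hΦ : ∀ a, ContDiffOn ℝ ∞ (Φ a) O)
    (hreg : ∀ v ∈ O, v ∈ localCompatSet (.inr ℝ Q U) H Φ → ∀ l,
      IsLocalMultiplier (.inr ℝ Q U) H Φ v l → IsLocallyRegular (.inr ℝ Q U) H Φ v l)
    {v : Q × U} (hv : v ∈ O) (hvc : v ∈ localCompatSet (.inr ℝ Q U) H Φ) :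
    ∃ s : Q → U, (∀ᶠ z in 𝓝 v.1, ContDiffAt ℝ ∞ s z) ∧ s v.1 = v.2 ∧
      ∀ᶠ w in 𝓝 v, w ∈ localCompatSet (.inr ℝ Q U) H Φ ↔ s w.1 = w.2 := by
  obtain ⟨h0, l, hl⟩ := hvc
  obtain ⟨s, hs, hsv, hsg⟩ := exists_graph_localCompatSet_aux hO hH hΦ hv h0 hl
    (hreg v hv ⟨h0, l, hl⟩ l hl)
  refine ⟨s, ?_, hsv, hsg⟩
  -- near each of its points the graph of `s` is also the graph of a function smooth at this point
  have hgr : ContinuousAt (fun z => (z, s z)) v.1 := continuousAt_id.prodMk hs.continuousAt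
  have hev : ∀ᶠ w in 𝓝 v, w ∈ O ∧ ∀ᶠ w' in 𝓝 w,
      w' ∈ localCompatSet (.inr ℝ Q U) H Φ ↔ s w'.1 = w'.2 :=
    Filter.Eventually.and (hO.mem_nhds hv) (eventually_eventually_nhds.2 hsg)
  have htend : Filter.Tendsto (fun z => (z, s z)) (𝓝 v.1) (𝓝 v) := by
    have := hgr.tendsto
    rwa [hsv] at this
  filter_upwards [htend.eventually hev] with z ⟨hz, hz'⟩
  have hzc : (z, s z) ∈ localCompatSet (.inr ℝ Q U) H Φ := hz'.self_of_nhds.2 rfl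
  obtain ⟨hz0, l', hl'⟩ := hzc
  obtain ⟨s', hs', hsv', hsg'⟩ := exists_graph_localCompatSet_aux hO hH hΦ hz hz0 hl'
    (hreg _ hz ⟨hz0, l', hl'⟩ l' hl')
  refine hs'.congr_of_eventuallyEq ?_
  have ht : Filter.Tendsto (fun z => (z, s' z)) (𝓝 z) (𝓝 (z, s z)) := by
    have : ContinuousAt (fun z => (z, s' z)) z := continuousAt_id.prodMk hs'.continuousAt
    have := this.tendsto
    rwa [hsv'] at this
  filter_upwards [ht.eventually hz', ht.eventually hsg'] with y h1 h2
  exact h1.1 (h2.2 rfl)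

end LocalStructure

/-! ### Phase space and degenerate directions -/

section PhaseSpace

set_option synthInstance.maxHeartbeats 200000

variable {B U : Type*} [NormedAddCommGroup B] [NormedSpace ℝ B]
  [NormedAddCommGroup U] [NormedSpace ℝ U] {n : ℕ}

/-- The space `(B × B^*) × U`: the base coordinates `b` and the momenta `p` are collected in
the first factor, and the top-order coordinates `u` form the second one. -/
abbrev PhaseSpace (B U : Type*) [NormedAddCommGroup B] [NormedSpace ℝ B]
    [NormedAddCommGroup U] [NormedSpace ℝ U] : Type _ := (B × (B →L[ℝ] ℝ)) × U

/-- The canonical symplectic pairing on `B × B^*`. -/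
def canPairing (x y : B × (B →L[ℝ] ℝ)) : ℝ := y.2 x.1 - x.2 y.1

theorem canPairing_nondegenerate [FiniteDimensional ℝ B] {x : B × (B →L[ℝ] ℝ)}
    (h : ∀ y, canPairing x y = 0) : x = 0 := by
  refine Prod.ext ?_ (ContinuousLinearMap.ext fun b => ?_)
  · refine (Module.forall_dual_apply_eq_zero_iff ℝ x.1).1 fun f => ?_
    simpa [canPairing] using h (0, LinearMap.toContinuousLinearMap f)
  · simpa [canPairing] using h (b, 0)

/-- Smooth functions `H` and `Φ^a` on an open set of phase space, such that the `Φ^a` do not depend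
on the momenta, every covector on `U` is the derivative of `∂H/∂u` in the direction of some
momentum, and the differentials of the `Φ^a` are independent at the common zeros of the `Φ^a`. -/
structure IsLocalSystem (O : Set (PhaseSpace B U)) (H : PhaseSpace B U → ℝ)
    (Φ : Fin n → PhaseSpace B U → ℝ) : Prop where
  isOpen : IsOpen O
  smooth : ContDiffOn ℝ ∞ H O
  smooth_constraint : ∀ a, ContDiffOn ℝ ∞ (Φ a) O
  indep_momentum : ∀ v ∈ O, ∀ a (p : B →L[ℝ] ℝ), fderiv ℝ (Φ a) v ((0, p), 0) = 0
  exists_momentum : ∀ v ∈ O, ∀ ν : U →L[ℝ] ℝ, ∃ p : B →L[ℝ] ℝ, ∀ u : U,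
    fderiv ℝ (fderiv ℝ H) v ((0, p), 0) (0, u) = ν u
  linearIndependent : ∀ v ∈ O, (∀ a, Φ a v = 0) → LinearIndependent ℝ fun a => fderiv ℝ (Φ a) v

variable {O : Set (PhaseSpace B U)} {H : PhaseSpace B U → ℝ} {Φ : Fin n → PhaseSpace B U → ℝ}

theorem IsLocalSystem.contDiffAt (hS : IsLocalSystem O H Φ) {v : PhaseSpace B U} (hv : v ∈ O) :
    ContDiffAt ℝ ∞ H v := hS.smooth.contDiffAt (hS.isOpen.mem_nhds hv)

theorem IsLocalSystem.contDiffAt_constraint (hS : IsLocalSystem O H Φ) {v : PhaseSpace B U}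
    (hv : v ∈ O) (a : Fin n) : ContDiffAt ℝ ∞ (Φ a) v :=
  (hS.smooth_constraint a).contDiffAt (hS.isOpen.mem_nhds hv)

theorem fderiv_fderiv_symm {V : Type*} [NormedAddCommGroup V] [NormedSpace ℝ V] {f : V → ℝ} {v : V}
    (hf : ContDiffAt ℝ ∞ f v) (X Y : V) :
    fderiv ℝ (fderiv ℝ f) v X Y = fderiv ℝ (fderiv ℝ f) v Y X :=
  (hf.isSymmSndFDerivAt (by rw [minSmoothness_of_isRCLikeNormedField]; exact WithTop.coe_le_coe.2 le_top)).eq X Y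

/-- The second derivatives of a function which does not depend on the variables in the direction
of `Y`. -/
theorem fderiv_fderiv_eq_zero {V : Type*} [NormedAddCommGroup V] [NormedSpace ℝ V] {f : V → ℝ}
    {v : V} (hf : ContDiffAt ℝ ∞ f v) {Y : V} (hY : ∀ᶠ w in 𝓝 v, fderiv ℝ f w Y = 0) (X : V) :
    fderiv ℝ (fderiv ℝ f) v Y X = 0 := by
  rw [fderiv_fderiv_symm hf]
  have h1 : HasFDerivAt (fderiv ℝ f) (fderiv ℝ (fderiv ℝ f) v) v :=
    ((hf.fderiv_right (m := ∞) (by simp)).differentiableAt (by simp)).hasFDerivAt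
  have h2 : HasFDerivAt (fun w => fderiv ℝ f w Y) ((fderiv ℝ (fderiv ℝ f) v).flip Y) v := by
    simpa using h1.clm_apply (hasFDerivAt_const Y v)
  have h3 : HasFDerivAt (fun w => fderiv ℝ f w Y) (0 : V →L[ℝ] ℝ) v :=
    (hasFDerivAt_const (0 : ℝ) v).congr_of_eventuallyEq hY
  simpa using congrArg (fun g : V →L[ℝ] ℝ => g X) (h2.unique h3)

theorem IsLocalSystem.fderiv_fderiv_augmented_momentum (hS : IsLocalSystem O H Φ)
    {v : PhaseSpace B U} (hv : v ∈ O) (l : Fin n → ℝ) (p : B →L[ℝ] ℝ) (X : PhaseSpace B U) :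
    fderiv ℝ (fderiv ℝ (augmented H Φ l)) v ((0, p), 0) X =
      fderiv ℝ (fderiv ℝ H) v ((0, p), 0) X := by
  rw [fderiv_fderiv_augmented (hS.contDiffAt hv) (hS.contDiffAt_constraint hv)]
  have h1 : ∀ a, fderiv ℝ (fderiv ℝ (Φ a)) v ((0, p), 0) X = 0 := fun a =>
    fderiv_fderiv_eq_zero (hS.contDiffAt_constraint hv a)
      ((hS.isOpen.eventually_mem hv).mono fun w hw => hS.indep_momentum w hw a p) X
  simp [h1]

/-- Linearly independent functionals take arbitrary values simultaneously. -/
theorem LinearIndependent.exists_forall_apply_eq {V : Type*} [NormedAddCommGroup V]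
    [NormedSpace ℝ V] {f : Fin n → V →L[ℝ] ℝ} (hf : LinearIndependent ℝ f) (α : Fin n → ℝ) :
    ∃ x, ∀ a, f a x = α a := by
  have hr : (LinearMap.pi fun a => (f a).toLinearMap).range = ⊤ := by
    by_contra h
    obtain ⟨g, hg0, hg⟩ := Submodule.exists_le_ker_of_lt_top _ (lt_top_iff_ne_top.2 h)
    refine hg0 (LinearMap.pi_ext' fun a => LinearMap.ext_ring ?_)
    have h1 : ∑ a, g (Pi.single a 1) • f a = 0 := by
      ext x
      have h2 : g (fun a => f a x) = 0 := hg ⟨x, rfl⟩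
      have h3 : ∀ i : Fin n, (fun j => if i = j then (1 : ℝ) else 0) = Pi.single i 1 := by
        intro i; ext j; simp [Pi.single_apply, eq_comm]
      rw [LinearMap.pi_apply_eq_sum_univ] at h2
      simpa [mul_comm, h3] using h2
    simpa using Fintype.linearIndependent_iff.1 hf _ h1 a
  obtain ⟨x, hx⟩ := LinearMap.range_eq_top.1 hr α
  exact ⟨x, fun a => congrFun hx a⟩

/-- The system which defines `W_c` together with the multipliers is a submersion: the momenta
account for the derivatives in the directions of `U`, and the constraints are independent. -/
theorem IsLocalSystem.surjective_fderiv_systemMap (hS : IsLocalSystem O H Φ)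
    {v : PhaseSpace B U} (hv : v ∈ O) (h0 : ∀ a, Φ a v = 0) (l : Fin n → ℝ) :
    Function.Surjective (fderiv ℝ (systemMap (.inr ℝ (B × (B →L[ℝ] ℝ)) U) H Φ) (v, l)) := by
  rintro ⟨α, ν⟩
  obtain ⟨Z, hZ⟩ := (hS.linearIndependent v hv h0).exists_forall_apply_eq α
  obtain ⟨p, hp⟩ := hS.exists_momentum v hv
    (ν - (fderiv ℝ (fderiv ℝ (augmented H Φ l)) v Z).comp (.inr ℝ (B × (B →L[ℝ] ℝ)) U))
  refine ⟨(Z + ((0, p), 0), 0), ?_⟩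
  rw [fderiv_systemMap _ (hS.contDiffAt hv) (hS.contDiffAt_constraint hv)]
  refine Prod.ext (funext fun a => ?_) (ContinuousLinearMap.ext fun u => ?_)
  · simp [hZ, hS.indep_momentum v hv]
  · simp [hS.fderiv_fderiv_augmented_momentum hv, hp]

/-- A symmetric operator from a finite-dimensional space to its dual reaches every functional which
vanishes on its kernel. -/
theorem exists_apply_eq_of_symmetric {X : Type*} [AddCommGroup X] [Module ℝ X]
    [FiniteDimensional ℝ X] (M : X →ₗ[ℝ] Module.Dual ℝ X) (hM : ∀ x y, M x y = M y x)
    (φ : Module.Dual ℝ X) (hφ : ∀ x, M x = 0 → φ x = 0) : ∃ x, M x = φ := by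
  have h1 : φ ∈ M.ker.dualAnnihilator :=
    (Submodule.mem_dualAnnihilator _).2 fun x hx => hφ x hx
  rw [← LinearMap.range_dualMap_eq_dualAnnihilator_ker] at h1
  obtain ⟨ξ, hξ⟩ := h1
  obtain ⟨x, rfl⟩ := (Module.evalEquiv ℝ X).surjective ξ
  refine ⟨x, ?_⟩
  rw [← hξ]
  ext y
  simpa using hM x y

/-- If `D` is symmetric and the kernel vectors `(u, μ)` of the form `D`, bordered by the functionals
`c_a`, have `u = 0`, the system with the right-hand side `(ν, 0)` is solvable. -/
theorem exists_bordered_eq [FiniteDimensional ℝ U] (D : U →ₗ[ℝ] U →ₗ[ℝ] ℝ)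
    (hD : ∀ u u', D u u' = D u' u) (c : Fin n → U →ₗ[ℝ] ℝ)
    (hu : ∀ (u : U) (μ : Fin n → ℝ), (∀ u', D u u' + ∑ a, μ a * c a u' = 0) →
      (∀ a, c a u = 0) → u = 0) (ν : U →ₗ[ℝ] ℝ) :
    ∃ (u : U) (μ : Fin n → ℝ), (∀ u', D u u' + ∑ a, μ a * c a u' = ν u') ∧ ∀ a, c a u = 0 := by
  let C : U →ₗ[ℝ] (Fin n → ℝ) →ₗ[ℝ] ℝ := LinearMap.mk₂ ℝ (fun u μ => ∑ a, μ a * c a u)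
    (by simp [mul_add, Finset.sum_add_distrib])
    (by intro c u μ; simp only [map_smul, smul_eq_mul, Finset.mul_sum]
        exact Finset.sum_congr rfl fun a _ => by ring)
    (by simp [add_mul, Finset.sum_add_distrib])
    (by intro c u μ; simp [Finset.mul_sum, mul_assoc])
  -- the bordered operator on `U × ℝⁿ`
  let M : (U × (Fin n → ℝ)) →ₗ[ℝ] Module.Dual ℝ (U × (Fin n → ℝ)) :=
    LinearMap.mk₂ ℝ (fun x y => D x.1 y.1 + C x.1 y.2 + C y.1 x.2)
      (by intro x x' y; simp; ring) (by intro c x y; simp; ring)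
      (by intro x y y'; simp; ring) (by intro c x y; simp; ring)
  have hM : ∀ x y, M x y = D x.1 y.1 + (∑ a, y.2 a * c a x.1) + ∑ a, x.2 a * c a y.1 :=
    fun _ _ => rfl
  have h1 : ∀ (x : U × (Fin n → ℝ)) (ν : U →ₗ[ℝ] ℝ), M x = ν ∘ₗ LinearMap.fst ℝ U (Fin n → ℝ) →
      (∀ u', D x.1 u' + ∑ a, x.2 a * c a u' = ν u') ∧ ∀ a, c a x.1 = 0 := by
    intro x ν h
    refine ⟨fun u' => ?_, fun a => ?_⟩
    · simpa [hM] using congrArg (fun g => g (u', 0)) h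
    · simpa [hM, Pi.single_apply] using congrArg (fun g => g (0, Pi.single a 1)) h
  obtain ⟨x, hx⟩ := exists_apply_eq_of_symmetric M (fun x y => by rw [hM, hM, hD]; ring)
    (ν ∘ₗ LinearMap.fst ℝ U (Fin n → ℝ)) (fun x hx => by
      obtain ⟨h2, h3⟩ := h1 x 0 (by simpa using hx)
      simp [hu x.1 x.2 (by simpa using h2) h3])
  obtain ⟨h2, h3⟩ := h1 x ν hx
  exact ⟨x.1, x.2, h2, h3⟩

/-- If a set `T` contains the velocities allowed by the system at `(v, l)`, is contained in
the kernel of the derivatives of the constraints, and inherits a nondegenerate form, then the bordered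
Hessian is nondegenerate. A kernel vector `(u, μ)` gives the vector `j u` of `T ∩ ker σ`, so
`u = 0`; if `μ ≠ 0`, the covector `μ_a dΦ^a`, which vanishes on `T`, is the contraction of the form
with a nonzero vector of `T`, which contradicts nondegeneracy. -/
theorem isLocallyRegular_of_nondegenerate {V : Type*} [NormedAddCommGroup V] [NormedSpace ℝ V]
    [FiniteDimensional ℝ U] {j : U →L[ℝ] V} (hj : Function.Injective j) {H : V → ℝ}
    {Φ : Fin n → V → ℝ} {v : V} (hH : ContDiffAt ℝ ∞ H v) (hΦ : ∀ a, ContDiffAt ℝ ∞ (Φ a) v)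
    (hlin : LinearIndependent ℝ fun a => fderiv ℝ (Φ a) v) {l : Fin n → ℝ} (σ : V →ₗ[ℝ] V → ℝ)
    (hσ : ∀ u, σ (j u) = 0)
    (hβ : ∀ μ : Fin n → ℝ, (∀ u, ∑ a, μ a * fderiv ℝ (Φ a) v (j u) = 0) →
      ∃ Y, (∀ a, fderiv ℝ (Φ a) v Y = 0) ∧ ∀ Z, σ Y Z = ∑ a, μ a * fderiv ℝ (Φ a) v Z)
    {T : Set V}
    (hT₁ : ∀ X μ, fderiv ℝ (systemMap j H Φ) (v, l) (X, μ) = 0 → X ∈ T)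
    (hT₂ : ∀ X ∈ T, ∀ a, fderiv ℝ (Φ a) v X = 0)
    (hT₃ : ∀ X ∈ T, (∀ Z ∈ T, σ X Z = 0) → X = 0) :
    IsLocallyRegular j H Φ v l := by
  have hF := fderiv_systemMap_eq_zero_iff j hH hΦ l
  have hf : ContDiffAt ℝ ∞ (augmented H Φ l) v := contDiffAt_augmented hH hΦ l
  unfold IsLocallyRegular
  generalize augmented H Φ l = f at *
  have hu : ∀ (u : U) (μ : Fin n → ℝ), (∀ u' : U, fderiv ℝ (fderiv ℝ f) v (j u) (j u')
      + ∑ a, μ a * fderiv ℝ (Φ a) v (j u') = 0) → (∀ a, fderiv ℝ (Φ a) v (j u) = 0) → u = 0 := by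
    intro u μ h1 h2
    have h3 : j u ∈ T := hT₁ (j u) μ ((hF _ _).2 ⟨h2, h1⟩)
    exact hj ((hT₃ _ h3 fun Z _ => by rw [hσ]; rfl).trans (map_zero j).symm)
  intro u μ h1 h2
  obtain rfl := hu u μ h1 h2
  refine ⟨rfl, ?_⟩
  -- `Y` is corrected by an element of `U` to a vector of `T`
  obtain ⟨Y, hY, hYσ⟩ := hβ μ (by simpa using h1)
  obtain ⟨u, μ', hx, hc⟩ := exists_bordered_eq
    (LinearMap.mk₂ ℝ (fun u u' => fderiv ℝ (fderiv ℝ f) v (j u) (j u'))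
      (fun u₁ u₂ u' => by rw [map_add, map_add, _root_.add_apply])
      (fun c u u' => by rw [map_smul, map_smul, _root_.smul_apply])
      (fun u u₁ u₂ => by rw [map_add, map_add]) (fun c u u' => by rw [map_smul, map_smul]))
    (fun u u' => fderiv_fderiv_symm hf _ _) (fun a => ((fderiv ℝ (Φ a) v).comp j).toLinearMap)
    (fun u μ => hu u μ) (-((fderiv ℝ (fderiv ℝ f) v Y).comp j).toLinearMap)
  have hZ : Y + j u ∈ T := by
    refine hT₁ _ μ' ((hF _ _).2 ⟨fun a => ?_, fun u' => ?_⟩)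
    · have := hc a
      change fderiv ℝ (Φ a) v (j u) = 0 at this
      rw [map_add, hY, this, add_zero]
    · have := hx u'
      change fderiv ℝ (fderiv ℝ f) v (j u) (j u') + ∑ a, μ' a * fderiv ℝ (Φ a) v (j u') =
        -fderiv ℝ (fderiv ℝ f) v Y (j u') at this
      rw [map_add, _root_.add_apply]
      linarith
  have hσ' : σ (Y + j u) = σ Y := by rw [map_add, hσ, add_zero]
  have hZ0 := hT₃ _ hZ (fun Z hZ => by simp [hσ', hYσ, hT₂ Z hZ])
  rw [hZ0, map_zero] at hσ'
  refine funext (Fintype.linearIndependent_iff.1 hlin μ (ContinuousLinearMap.ext fun Z => ?_))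
  have := (hYσ Z).symm
  rw [← hσ'] at this
  simpa using this

/-- A combination of functionals which do not depend on the momenta and vanishes on `U` is the
contraction of the canonical pairing with a momentum. -/
theorem exists_canPairing_eq (c : Fin n → PhaseSpace B U →L[ℝ] ℝ)
    (hc : ∀ a p, c a ((0, p), 0) = 0) (μ : Fin n → ℝ) (hμ : ∀ u, ∑ a, μ a * c a (0, u) = 0) :
    ∃ Y : PhaseSpace B U, (∀ a, c a Y = 0) ∧ ∀ Z, canPairing Y.1 Z.1 = ∑ a, μ a * c a Z := by
  let β : B →L[ℝ] ℝ := ∑ a, μ a • (c a).comp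
    ((ContinuousLinearMap.inl ℝ (B × (B →L[ℝ] ℝ)) U).comp
      (ContinuousLinearMap.inl ℝ B (B →L[ℝ] ℝ)))
  have hβ : ∀ b, β b = ∑ a, μ a * c a ((b, 0), 0) := by
    intro b; simp [β]
  refine ⟨((0, -β), 0), fun a => hc a _, fun Z => ?_⟩
  have h1 : ∀ a, c a Z = c a ((Z.1.1, 0), 0) + c a (0, Z.2) := by
    intro a
    have hZ : Z = ((Z.1.1, 0), 0) + ((0, Z.1.2), 0) + (0, Z.2) := by simp
    conv_lhs => rw [hZ, map_add, map_add, hc, add_zero]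
  simp only [h1, mul_add, Finset.sum_add_distrib, hμ, ← hβ]
  simp [canPairing]

/-- The local form of the necessity of the regularity condition, where `T` stands for the tangent
space of `W_c`. -/
theorem IsLocalSystem.isLocallyRegular [FiniteDimensional ℝ U]
    (hS : IsLocalSystem O H Φ) {v : PhaseSpace B U}
    (hv : v ∈ O) (h0 : ∀ a, Φ a v = 0) {l : Fin n → ℝ} {T : Set (PhaseSpace B U)}
    (hT₁ : ∀ X μ, fderiv ℝ (systemMap (.inr ℝ (B × (B →L[ℝ] ℝ)) U) H Φ) (v, l) (X, μ) = 0 →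
      X ∈ T)
    (hT₂ : ∀ X ∈ T, ∀ a, fderiv ℝ (Φ a) v X = 0)
    (hT₃ : ∀ X ∈ T, (∀ Z ∈ T, canPairing X.1 Z.1 = 0) → X = 0) :
    IsLocallyRegular (.inr ℝ (B × (B →L[ℝ] ℝ)) U) H Φ v l := by
  have hm := hS.indep_momentum v hv
  have hlin := hS.linearIndependent v hv h0
  refine isLocallyRegular_of_nondegenerate (fun u u' h => congrArg Prod.snd h)
    (hS.contDiffAt hv) (hS.contDiffAt_constraint hv) hlin
    { toFun := fun X Z => canPairing X.1 Z.1
      map_add' := fun X Y => by ext Z; simp [canPairing]; ring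
      map_smul' := fun c X => by ext Z; simp [canPairing]; ring }
    (fun u => by ext Z; simp [canPairing])
    (fun μ hμ => exists_canPairing_eq _ hm μ hμ) hT₁ hT₂ hT₃

end PhaseSpace

/-! ### Transition maps of jets -/

section JetTransitions

variable {E : Type*} [NormedAddCommGroup E] [NormedSpace ℝ E]

/-- The map induced by `φ` on the coordinates `(q_0, …, q_k)` of `k`-jets. -/
def jetMap (k : ℕ) (φ : E → E) (q : Fin (k + 1) → E) : Fin (k + 1) → E :=
  fun i => iteratedDeriv (i : ℕ) (φ ∘ taylorCurve q) 0

theorem differentiableAt_iteratedDeriv {c : ℝ → E} {t : ℝ} (hc : ContDiffAt ℝ ∞ c t) (i : ℕ) :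
    DifferentiableAt ℝ (iteratedDeriv i c) t := by
  rw [iteratedDeriv_eq_equiv_comp]
  have h : ContDiffAt ℝ ∞ (iteratedFDeriv ℝ i c) t :=
    hc.iteratedFDeriv_right (by exact_mod_cast le_top)
  exact (LinearIsometryEquiv.differentiableAt _).comp t (h.differentiableAt (by simp))

theorem hasDerivAt_iteratedDeriv {c : ℝ → E} {t : ℝ} (hc : ContDiffAt ℝ ∞ c t) (i : ℕ) :
    HasDerivAt (iteratedDeriv i c) (iteratedDeriv (i + 1) c t) t := by
  rw [iteratedDeriv_succ]
  exact (differentiableAt_iteratedDeriv hc i).hasDerivAt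

theorem jetMap_init {k : ℕ} {φ : E → E} (q : Fin (k + 1 + 1) → E)
    (hφ : ContDiffAt ℝ ∞ φ (q 0)) (i : Fin (k + 1)) :
    jetMap k φ (fun i => q i.castSucc) i = jetMap (k + 1) φ q i.castSucc := by
  have h := iteratedDeriv_comp_taylorCurve (k := k) (φ := φ) (c := taylorCurve q)
    (by rwa [taylorCurve_zero]) (contDiff_taylorCurve q).contDiffAt (i := i)
    (Nat.lt_succ_iff.1 i.2)
  simp only [jetMap, Fin.val_castSucc]
  rw [h]
  congr 3
  funext i
  exact (iteratedDeriv_taylorCurve q i.castSucc).symm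

theorem contDiffOn_jetMap {k : ℕ} {φ : E → E} {s : Set E} (hs : IsOpen s)
    (hφ : ContDiffOn ℝ ∞ φ s) : ContDiffOn ℝ ∞ (jetMap k φ) {q | q 0 ∈ s} :=
  contDiffOn_pi.2 fun i => contDiffOn_iteratedDeriv_comp_taylorCurve hs hφ i

/-- The maps induced by `φ` are compatible with the embedding `T^{k+1} → T (T^k)`: the
tangent map of `T^k φ` sends the vector `(q_1, …, q_{k+1})` at `(q_0, …, q_k)` to the vector with
components `1, …, k + 1` of the image of `(q_0, …, q_{k+1})`. -/
theorem fderiv_jetMap {k : ℕ} {φ : E → E} {s : Set E} (hs : IsOpen s)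
    (hφ : ContDiffOn ℝ ∞ φ s) {q : Fin (k + 1 + 1) → E} (hq : q 0 ∈ s) (i : Fin (k + 1)) :
    fderiv ℝ (jetMap k φ) (fun i => q i.castSucc) (fun i => q i.succ) i =
      jetMap (k + 1) φ q i.succ := by
  set c := taylorCurve q
  have hc : ∀ t, ContDiffAt ℝ ∞ c t := fun t => (contDiff_taylorCurve q).contDiffAt
  have hcs : c 0 ∈ s := by simpa [c, taylorCurve_zero] using hq
  let Q : ℝ → Fin (k + 1) → E := fun t i => iteratedDeriv (i : ℕ) c t
  have hQ0 : Q 0 = fun i => q i.castSucc :=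
    funext fun i => iteratedDeriv_taylorCurve q i.castSucc
  have hQ : HasDerivAt Q (fun i => q i.succ) 0 := by
    refine hasDerivAt_pi.2 fun i => ?_
    have h1 := hasDerivAt_iteratedDeriv (hc 0) i
    have h2 : iteratedDeriv ((i : ℕ) + 1) c 0 = q i.succ := iteratedDeriv_taylorCurve q i.succ
    rwa [h2] at h1
  have hd : DifferentiableAt ℝ (jetMap k φ) (fun i => q i.castSucc) :=
    (((contDiffOn_jetMap (k := k) hs hφ).contDiffAt
      ((hs.preimage (continuous_apply 0)).mem_nhds hq)).differentiableAt (by simp))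
  have h1 : HasDerivAt (fun t => jetMap k φ (Q t) i)
      (fderiv ℝ (jetMap k φ) (fun i => q i.castSucc) (fun i => q i.succ) i) 0 := by
    have h := hd.hasFDerivAt
    rw [← hQ0] at h
    have := h.comp_hasDerivAt (0 : ℝ) hQ
    rw [hQ0] at this
    exact hasDerivAt_pi.1 this i
  have h2 : HasDerivAt (fun t => jetMap k φ (Q t) i) (jetMap (k + 1) φ q i.succ) 0 := by
    have hφc : ContDiffAt ℝ ∞ (φ ∘ c) 0 :=
      (hφ.contDiffAt (hs.mem_nhds hcs)).comp (0 : ℝ) (hc 0)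
    refine (hasDerivAt_iteratedDeriv hφc i).congr_of_eventuallyEq ?_
    filter_upwards [(hc 0).continuousAt.preimage_mem_nhds (hs.mem_nhds hcs)] with t ht
    have h3 := iteratedDeriv_comp_taylorCurve (k := k) (φ := φ) (c := fun x => c (t + x))
      (by simpa using hφ.contDiffAt (hs.mem_nhds ht))
      ((contDiff_taylorCurve q).comp (contDiff_const.add contDiff_id)).contDiffAt
      (i := i) (Nat.lt_succ_iff.1 i.2)
    have h4 : (fun j : Fin (k + 1) => iteratedDeriv (j : ℕ) (fun x => c (t + x)) 0) = Q t := by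
      funext j
      simp [iteratedDeriv_comp_const_add, Q]
    rw [h4] at h3
    have h5 := congrFun (iteratedDeriv_comp_const_add i (φ ∘ c) t) 0
    rw [add_zero] at h5
    rw [jetMap, ← h3]
    exact h5
  exact h1.unique h2

/-- The dependence of the top-order coordinate of the image on the top-order coordinate:
the derivative of `T^k φ` in its top-order coordinate. -/
def topLinear (k : ℕ) (φ : E → E) (q : Fin (k + 1) → E) : E →L[ℝ] E :=
  (ContinuousLinearMap.proj (Fin.last k)).comp
    ((fderiv ℝ (jetMap k φ) q).comp (ContinuousLinearMap.single ℝ (fun _ : Fin (k + 1) => E)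
      (Fin.last k)))

/-- A jet transition map is affine in the top-order coordinate. -/
theorem jetMap_add_single_last {k : ℕ} {φ : E → E} {s : Set E} (hs : IsOpen s)
    (hφ : ContDiffOn ℝ ∞ φ s) {q : Fin (k + 1 + 1) → E} (hq : q 0 ∈ s) (v : E) :
    jetMap (k + 1) φ (q + Pi.single (Fin.last (k + 1)) v) = jetMap (k + 1) φ q +
      Pi.single (Fin.last (k + 1)) (topLinear k φ (fun i => q i.castSucc) v) := by
  set q' := q + Pi.single (Fin.last (k + 1)) v
  have hi : ∀ i : Fin (k + 1), q' i.castSucc = q i.castSucc := by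
    intro i
    simp [q', Fin.castSucc_ne_last]
  have hq0 : q' 0 = q 0 := hi 0
  have hi' : (fun i : Fin (k + 1) => q' i.castSucc) = fun i => q i.castSucc := funext hi
  have htail : (fun i : Fin (k + 1) => q' i.succ) =
      (fun i => q i.succ) + Pi.single (Fin.last k) v := by
    funext i
    simp [q', Pi.single_apply, ← Fin.succ_last]
  have hq' : q' 0 ∈ s := by rwa [hq0]
  funext i
  induction i using Fin.lastCases with
  | last =>
    rw [← Fin.succ_last, ← fderiv_jetMap hs hφ hq', htail, hi', map_add, Pi.add_apply,
      fderiv_jetMap hs hφ hq]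
    simp [topLinear]
  | cast i =>
    rw [← jetMap_init q' (by rw [hq0]; exact hφ.contDiffAt (hs.mem_nhds hq)), hi', jetMap_init q
      (hφ.contDiffAt (hs.mem_nhds hq))]
    simp [Fin.castSucc_ne_last]

variable {M : Type*} [TopologicalSpace M] [ChartedSpace E M]

theorem Jet.coord_zero {k : ℕ} {e : OpenPartialHomeomorph M E} (he : e ∈ atlas E M)
    {j : Jet E M k} (hj : j.base ∈ e.source) : Jet.coord e j 0 = e j.base := by
  obtain ⟨γ⟩ := j
  change Jet.coord e (Jet.mk k γ) 0 = _
  rw [Jet.coord_mk he γ hj]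
  simp [Jet.base]

theorem Jet.base_proj {k : ℕ} (j : Jet E M (k + 1)) : (Jet.proj k j).base = j.base := by
  obtain ⟨γ⟩ := j
  rfl

theorem coord_add_single_last_zero {k : ℕ} {e : OpenPartialHomeomorph M E} (he : e ∈ atlas E M)
    {j : Jet E M (k + 1)} (hj : j.base ∈ e.source) (v : E) :
    (Jet.coord e j + Pi.single (Fin.last (k + 1)) v : Fin (k + 1 + 1) → E) 0 = e j.base := by
  rw [Pi.add_apply, Jet.coord_zero he hj]
  simp

variable [IsManifold 𝓘(ℝ, E) ∞ M]

theorem jetChart_symm_base {k : ℕ} {e : OpenPartialHomeomorph M E} (he : e ∈ atlas E M)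
    {q : Fin (k + 1) → E} (hq : q 0 ∈ e.target) :
    ((jetChart k e he).symm q).base = e.symm (q 0) := by
  change (chartCurve e he q).1 0 = _
  rw [chartCurve_of_mem he hq, Function.comp_apply, taylorCurve_zero]

/-- In natural coordinates, the transition maps of `T^k M` are induced by those of `M`. -/
theorem coord_jetChart_symm {k : ℕ} {e e' : OpenPartialHomeomorph M E} (he : e ∈ atlas E M)
    (he' : e' ∈ atlas E M) {q : Fin (k + 1) → E} (hq : q 0 ∈ (e.symm.trans e').source) :
    Jet.coord e' ((jetChart k e he).symm q) = jetMap k (e' ∘ e.symm) q := by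
  have hq1 : q 0 ∈ e.target := hq.1
  have hs : (chartCurve e he q).1 0 ∈ e'.source := by
    rw [chartCurve_of_mem he hq1, Function.comp_apply, taylorCurve_zero]
    exact hq.2
  change Jet.coord e' (Jet.mk k (chartCurve e he q)) = _
  rw [Jet.coord_mk he' _ hs, chartCurve_of_mem he hq1]
  rfl

/-- The coordinates of a jet in two charts. -/
theorem Jet.coord_eq_jetMap {k : ℕ} {e e' : OpenPartialHomeomorph M E} (he : e ∈ atlas E M)
    (he' : e' ∈ atlas E M) {j : Jet E M k} (hj : j.base ∈ e.source) (hj' : j.base ∈ e'.source) :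
    Jet.coord e' j = jetMap k (e' ∘ e.symm) (Jet.coord e j) := by
  have h0 := Jet.coord_zero he hj
  have h1 : (jetChart k e he).symm (Jet.coord e j) = j := (jetChart k e he).left_inv hj
  rw [← coord_jetChart_symm he he' ⟨by rw [h0]; exact e.map_source hj, by
    simpa [h0, e.left_inv hj] using hj'⟩, h1]

section TopShift

variable {F : Type*} [NormedAddCommGroup F] [NormedSpace ℝ F]
  {G : Type*} [TopologicalSpace G] [ChartedSpace F G] [Group G] {k : ℕ}

theorem base_topShift {e : OpenPartialHomeomorph M E} (he : e ∈ atlas E M)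
    {a : HigherTangent E M F G (k + 1)} (ha : a.1.base ∈ e.source) (v : E × LieAlg F G) :
    (topShift e he a v).1.base = a.1.base := by
  have h0 := coord_add_single_last_zero he ha v.1
  have h := jetChart_symm_base he (q := Jet.coord e a.1 + Pi.single (Fin.last (k + 1)) v.1)
    (by rw [h0]; exact e.map_source ha)
  rw [h0, e.left_inv ha] at h
  exact h

theorem coord_topShift_self {e : OpenPartialHomeomorph M E} (he : e ∈ atlas E M)
    {a : HigherTangent E M F G (k + 1)} (ha : a.1.base ∈ e.source) (v : E × LieAlg F G) :
    Jet.coord e (topShift e he a v).1 = Jet.coord e a.1 + Pi.single (Fin.last (k + 1)) v.1 :=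
  (jetChart (k + 1) e he).right_inv (by
    change (Jet.coord e a.1 + Pi.single (Fin.last (k + 1)) v.1 : Fin (k + 1 + 1) → E) 0 ∈ e.target
    rw [coord_add_single_last_zero he ha]; exact e.map_source ha)

theorem Jet.coord_injective {e : OpenPartialHomeomorph M E} (he : e ∈ atlas E M)
    {j j' : Jet E M k} (hj : j.base ∈ e.source) (hj' : j'.base ∈ e.source)
    (h : Jet.coord e j = Jet.coord e j') : j = j' :=
  (jetChart k e he).injOn hj hj' h

theorem topShift_injective {e : OpenPartialHomeomorph M E} (he : e ∈ atlas E M)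
    {a : HigherTangent E M F G (k + 1)} (ha : a.1.base ∈ e.source) :
    Function.Injective (topShift e he a) := by
  intro v w h
  have h1 := congrArg (fun b => Jet.coord e b.1 (Fin.last (k + 1))) h
  have h2 := congrArg (fun b : HigherTangent E M F G (k + 1) => b.2.2 (Fin.last k)) h
  simp only [coord_topShift_self he ha] at h1
  exact Prod.ext (by simpa using h1) (by simpa [topShift] using h2)

/-- The shifts of the top-order coordinates in two charts differ by a linear map. -/
theorem topShift_eq_topShift {e e' : OpenPartialHomeomorph M E} (he : e ∈ atlas E M)
    (he' : e' ∈ atlas E M) {a : HigherTangent E M F G (k + 1)} (ha : a.1.base ∈ e.source)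
    (ha' : a.1.base ∈ e'.source) (v : E × LieAlg F G) :
    topShift e he a v = topShift e' he' a
      (topLinear k (e' ∘ e.symm) (fun i => Jet.coord e a.1 i.castSucc) v.1, v.2) := by
  have hb := base_topShift he ha v
  have hq : Jet.coord e a.1 0 ∈ (e.symm.trans e').source := by
    rw [Jet.coord_zero he ha]
    exact ⟨e.map_source ha, by simpa [e.left_inv ha] using ha'⟩
  refine Prod.ext (Jet.coord_injective he' (by rwa [hb]) (by rwa [base_topShift he' ha']) ?_) rfl
  rw [coord_topShift_self he' ha', Jet.coord_eq_jetMap he he' (by rwa [hb]) (by rwa [hb]),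
    coord_topShift_self he ha, jetMap_add_single_last (e.symm.trans e').open_source
      (contDiffOn_chart_transition he he') hq, ← Jet.coord_eq_jetMap he he' ha ha']

/-- The linear relation between the shifts of the top-order coordinates in two charts. -/
theorem exists_topShift_eq {e e' : OpenPartialHomeomorph M E} (he : e ∈ atlas E M)
    (he' : e' ∈ atlas E M) {a : HigherTangent E M F G (k + 1)} (ha : a.1.base ∈ e.source)
    (ha' : a.1.base ∈ e'.source) :
    ∃ T : (E × LieAlg F G) ≃L[ℝ] E × LieAlg F G,
      ∀ v, topShift e he a v = topShift e' he' a (T v) := by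
  let S := (topLinear k (e' ∘ e.symm) (fun i => Jet.coord e a.1 i.castSucc)).prodMap
    (ContinuousLinearMap.id ℝ (LieAlg F G))
  let S' := (topLinear k (e ∘ e'.symm) (fun i => Jet.coord e' a.1 i.castSucc)).prodMap
    (ContinuousLinearMap.id ℝ (LieAlg F G))
  have h : ∀ v, topShift e he a v = topShift e' he' a (S v) := topShift_eq_topShift he he' ha ha'
  have h' : ∀ v, topShift e' he' a v = topShift e he a (S' v) :=
    topShift_eq_topShift he' he ha' ha
  exact ⟨ContinuousLinearEquiv.equivOfInverse S S'
    (fun v => topShift_injective he ha (by rw [← h', ← h]))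
    (fun v => topShift_injective he' ha' (by rw [← h, ← h'])), h⟩

end TopShift

end JetTransitions

/-! ### Immersions and embedded submanifolds -/

section Embeddings

variable {E₁ : Type*} [NormedAddCommGroup E₁] [NormedSpace ℝ E₁]
  {H₁ : Type*} [TopologicalSpace H₁] {I : ModelWithCorners ℝ E₁ H₁} [I.Boundaryless]
  {S : Type*} [TopologicalSpace S] [ChartedSpace H₁ S]
  {E₂ : Type*} [NormedAddCommGroup E₂] [NormedSpace ℝ E₂]
  {H₂ : Type*} [TopologicalSpace H₂] {I' : ModelWithCorners ℝ E₂ H₂}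
  {Y : Type*} [TopologicalSpace Y] [ChartedSpace H₂ Y]

/-- An immersion has a smooth local left inverse. -/
theorem Manifold.IsImmersionAt.exists_leftInverse {f : S → Y} {x : S}
    (hf : Manifold.IsImmersionAt I I' ∞ f x) :
    ∃ g : Y → S, ContMDiffAt I' I ∞ g (f x) ∧ ∀ᶠ y in 𝓝 x, g (f y) = y := by
  set φ := hf.domChart
  set ψ := hf.codChart
  have hφx : x ∈ φ.source := hf.mem_domChart_source
  have key : ∀ y ∈ φ.source, (φ.extend I).symm (hf.equiv.symm (ψ.extend I' (f y))).1 = y := by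
    intro y hy
    have h1 := hf.writtenInCharts ((φ.extend I).map_source (by simpa using hy))
    have h2 : (φ.extend I).symm (φ.extend I y) = y := (φ.extend I).left_inv (by simpa using hy)
    simp only [Function.comp_apply] at h1
    rw [h2] at h1
    rw [h1]
    simpa using h2
  refine ⟨fun z => (φ.extend I).symm (hf.equiv.symm (ψ.extend I' z)).1, ?_, ?_⟩
  · have hpt : (hf.equiv.symm (ψ.extend I' (f x))).1 = φ.extend I x := by
      have h1 := hf.writtenInCharts ((φ.extend I).map_source (by simpa using hφx))
      have h2 : (φ.extend I).symm (φ.extend I x) = x :=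
        (φ.extend I).left_inv (by simpa using hφx)
      simp only [Function.comp_apply] at h1
      rw [h2] at h1
      rw [h1]
      simp
    have h1 : ContMDiffAt I' 𝓘(ℝ, E₂) ∞ (ψ.extend I') (f x) :=
      (ψ.contMDiffOn_extend hf.codChart_mem_maximalAtlas).contMDiffAt
        (ψ.open_source.mem_nhds hf.mem_codChart_source)
    have h2 : ContDiff ℝ ∞ fun z => (hf.equiv.symm z).1 := by fun_prop
    have h3 : ContMDiffAt 𝓘(ℝ, E₁) I ∞ (φ.extend I).symm
        (hf.equiv.symm (ψ.extend I' (f x))).1 := by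
      rw [hpt]
      refine (contMDiffOn_extend_symm hf.domChart_mem_maximalAtlas).contMDiffAt ?_
      exact (I.toHomeomorph.isOpenMap _ φ.open_target).mem_nhds ⟨φ x, φ.map_source hφx, rfl⟩
    exact h3.comp (f x) (h2.contMDiff.contMDiffAt.comp (f x) h1)
  · filter_upwards [φ.open_source.mem_nhds hφx] with y hy using key y hy

theorem Manifold.IsImmersionAt.mfderiv_injective {f : S → Y} {x : S}
    (hf : Manifold.IsImmersionAt I I' ∞ f x) : Function.Injective (mfderiv I I' f x) := by
  obtain ⟨g, hg, hgf⟩ := hf.exists_leftInverse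
  have h1 : HasMFDerivAt I I (g ∘ f) x ((mfderiv I' I g (f x)).comp (mfderiv I I' f x)) :=
    (hg.mdifferentiableAt (by simp)).hasMFDerivAt.comp x
      (hf.contMDiffAt.mdifferentiableAt (by simp)).hasMFDerivAt
  have h2 : HasMFDerivAt I I (g ∘ f) x (ContinuousLinearMap.id ℝ (TangentSpace I x)) :=
    (hasMFDerivAt_id x).congr_of_eventuallyEq hgf
  have h3 := hasMFDerivAt_unique h1 h2
  intro u v huv
  have h4 : ∀ u, mfderiv I' I g (f x) (mfderiv I I' f x u) = u := fun u =>
    congrArg (fun L : TangentSpace I x →L[ℝ] TangentSpace I x => L u) h3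
  rw [← h4 u, huv, h4]

/-- The velocity of a curve in an embedded submanifold is tangent to it. -/
theorem Manifold.IsSmoothEmbedding.velocity_mem_range {f : S → Y}
    (hf : Manifold.IsSmoothEmbedding I I' ∞ f) {x : S} {γ : ℝ → Y} (h0 : γ 0 = f x)
    (hγ : MDifferentiableAt 𝓘(ℝ, ℝ) I' γ 0) (hmem : ∀ᶠ t in 𝓝 (0 : ℝ), γ t ∈ range f) :
    ∃ u : TangentSpace I x, mfderiv I I' f x u = mfderiv 𝓘(ℝ, ℝ) I' γ 0 (1 : ℝ) := by
  obtain ⟨g, hg, hgf⟩ := (hf.isImmersion.isImmersionAt x).exists_leftInverse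
  -- `f ∘ g` fixes the curve near `0`
  have h1 : ∀ᶠ t in 𝓝 (0 : ℝ), f (g (γ t)) = γ t := by
    have hgf' : ∀ᶠ z in 𝓝 (f x), ∀ y, f y = z → g (f y) = y := by
      have := hgf
      rw [hf.isEmbedding.nhds_eq_comap, Filter.eventually_comap] at this
      exact this
    have hc : Filter.Tendsto γ (𝓝 0) (𝓝 (f x)) := h0 ▸ hγ.continuousAt
    filter_upwards [hc.eventually hgf', hmem] with t ht ⟨y, hy⟩
    rw [← hy, ht y hy]
  have hgx : g (f x) = x := hgf.self_of_nhds
  have hg' : MDifferentiableAt I' I g (γ 0) := h0 ▸ hg.mdifferentiableAt (by simp)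
  have hf' : MDifferentiableAt I I' f (g (γ 0)) := hf.contMDiff.mdifferentiableAt (by simp)
  have h2 : HasMFDerivAt 𝓘(ℝ, ℝ) I' γ 0
      ((mfderiv I I' f (g (γ 0))).comp ((mfderiv I' I g (γ 0)).comp (mfderiv 𝓘(ℝ, ℝ) I' γ 0))) :=
    (HasMFDerivAt.comp (0 : ℝ) hf'.hasMFDerivAt
      (hg'.hasMFDerivAt.comp (0 : ℝ) hγ.hasMFDerivAt)).congr_of_eventuallyEq
      (h1.mono fun t ht => ht.symm)
  have h3 := hasMFDerivAt_unique hγ.hasMFDerivAt h2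
  have h4 : g (γ 0) = x := by rw [h0, hgx]
  rw [h3]
  revert h2 h3
  generalize mfderiv I' I g (γ 0) = A
  revert A
  rw [h0, hgx]
  intro A _ _
  exact ⟨A (mfderiv 𝓘(ℝ, ℝ) I' γ 0 (1 : ℝ)), rfl⟩

end Embeddings

/-! ### Exterior derivatives of pullbacks and canonical forms -/

section LocalForms

variable {E : Type*} [NormedAddCommGroup E] [NormedSpace ℝ E]
  {H : Type*} [TopologicalSpace H] {I : ModelWithCorners ℝ E H} [I.Boundaryless]
  {X : Type*} [TopologicalSpace X] [ChartedSpace H X]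
  {V : Type*} [NormedAddCommGroup V] [NormedSpace ℝ V] {n : ℕ}

theorem two_le_infty : minSmoothness ℝ 2 ≤ (∞ : WithTop ℕ∞) := by
  rw [minSmoothness_of_isRCLikeNormedField]
  exact WithTop.coe_le_coe.2 le_top

theorem contDiffAt_comp_extChartAt_symm {f : X → V} {x : X} (hf : ContMDiffAt I 𝓘(ℝ, V) ∞ f x) :
    ContDiffAt ℝ ∞ (f ∘ (extChartAt I x).symm) (extChartAt I x x) := by
  have h := (contMDiffAt_iff.1 hf).2
  rw [I.range_eq_univ, contDiffWithinAt_univ] at h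
  simpa using! h

theorem fderiv_comp_extChartAt_symm {f : X → V} {x : X} (hf : MDifferentiableAt I 𝓘(ℝ, V) f x) :
    fderiv ℝ (f ∘ (extChartAt I x).symm) (extChartAt I x x) = mfderiv I 𝓘(ℝ, V) f x := by
  rw [hf.mfderiv, I.range_eq_univ, fderivWithin_univ]
  rfl

theorem extDeriv_const (η : V [⋀^Fin n]→L[ℝ] ℝ) (x : V) : extDeriv (fun _ => η) x = 0 := by
  rw [extDeriv, fderiv_const_apply, ← ContinuousAlternatingMap.alternatizeUncurryFinCLM_apply,
    map_zero]

/-- The local expression of a form which is a pullback from a normed space. -/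
theorem DiffForm.inChart_eventuallyEq [IsManifold I ∞ X] {σ : DiffForm I X n} {η : V → V [⋀^Fin n]→L[ℝ] ℝ}
    {f : X → V} {x : X} (hf : ContMDiffAt I 𝓘(ℝ, V) ∞ f x)
    (hσ : ∀ᶠ y in 𝓝 x, σ y = (η (f y)).compContinuousLinearMap (mfderiv I 𝓘(ℝ, V) f y)) :
    σ.inChart x =ᶠ[𝓝 (extChartAt I x x)] fun y =>
      (η ((f ∘ (extChartAt I x).symm) y)).compContinuousLinearMap
        (fderiv ℝ (f ∘ (extChartAt I x).symm) y) := by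
  have h1 : ∀ᶠ y in 𝓝 x, MDifferentiableAt I 𝓘(ℝ, V) f y :=
    ((contMDiffAt_iff_contMDiffAt_nhds (n := 1) (by simp)).1 (hf.of_le (by simp))).mono
      fun y hy => hy.mdifferentiableAt (by simp)
  have hc : Filter.Tendsto (extChartAt I x).symm (𝓝 (extChartAt I x x)) (𝓝 x) := by
    have := continuousAt_extChartAt_symm (I := I) x
    rwa [ContinuousAt, extChartAt_to_inv] at this
  have h2 : ∀ᶠ y in 𝓝 (extChartAt I x x), y ∈ (extChartAt I x).target :=
    extChartAt_target_mem_nhds x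
  filter_upwards [hc.eventually hσ, hc.eventually h1, h2] with y hy1 hy2 hy3
  have h3 : MDifferentiableAt 𝓘(ℝ, E) I (extChartAt I x).symm y := by
    have := mdifferentiableWithinAt_extChartAt_symm (I := I) hy3
    rwa [I.range_eq_univ, mdifferentiableWithinAt_univ] at this
  have h4 : fderiv ℝ (f ∘ (extChartAt I x).symm) y = (mfderiv I 𝓘(ℝ, V) f ((extChartAt I x).symm y)).comp
      (mfderivWithin 𝓘(ℝ, E) I (extChartAt I x).symm (range I) y) := by
    rw [I.range_eq_univ, mfderivWithin_univ, ← mfderiv_eq_fderiv]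
    exact mfderiv_comp y hy2 h3
  rw [h4, DiffForm.inChart, hy1]
  rfl

/-- The exterior derivative commutes with pullbacks from a normed space. -/
theorem DiffForm.d_eq_of_eventuallyEq [IsManifold I ∞ X] {σ : DiffForm I X n} {η : V → V [⋀^Fin n]→L[ℝ] ℝ}
    {f : X → V} {x : X} (hf : ContMDiffAt I 𝓘(ℝ, V) ∞ f x) (hη : DifferentiableAt ℝ η (f x))
    (hσ : ∀ᶠ y in 𝓝 x, σ y = (η (f y)).compContinuousLinearMap (mfderiv I 𝓘(ℝ, V) f y)) :
    σ.d x = (extDeriv η (f x)).compContinuousLinearMap (mfderiv I 𝓘(ℝ, V) f x) := by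
  have h1 := (DiffForm.inChart_eventuallyEq hf hσ).extDeriv_eq
  have h2 : (f ∘ (extChartAt I x).symm) (extChartAt I x x) = f x := by simp
  rw [extDeriv_pullback (by rwa [h2]) (contDiffAt_comp_extChartAt_symm hf) two_le_infty, h2,
    fderiv_comp_extChartAt_symm (hf.mdifferentiableAt (by simp))] at h1
  rw [DiffForm.d, I.range_eq_univ, extDerivWithin_univ, h1]
  rfl

end LocalForms

section CanonicalForms

variable (B : Type*) [NormedAddCommGroup B] [NormedSpace ℝ B]

/-- The Liouville form `p db` of `B × B^*`, which depends linearly on the point. -/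
def canLiouville : (B × (B →L[ℝ] ℝ)) →L[ℝ] (B × (B →L[ℝ] ℝ)) [⋀^Fin 1]→L[ℝ] ℝ :=
  (ContinuousAlternatingMap.ofSubsingletonLIE (𝕜 := ℝ) (E := B × (B →L[ℝ] ℝ)) (F := ℝ)
    (i := (0 : Fin 1))).toContinuousLinearEquiv.toContinuousLinearMap.comp
    (((ContinuousLinearMap.compL ℝ (B × (B →L[ℝ] ℝ)) B ℝ).flip
      (ContinuousLinearMap.fst ℝ B (B →L[ℝ] ℝ))).comp (ContinuousLinearMap.snd ℝ B (B →L[ℝ] ℝ)))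

/-- The canonical symplectic form of `B × B^*`. -/
def canForm : (B × (B →L[ℝ] ℝ)) [⋀^Fin 2]→L[ℝ] ℝ :=
  -ContinuousAlternatingMap.alternatizeUncurryFin (canLiouville B)

variable {B}

theorem canLiouville_apply (y : B × (B →L[ℝ] ℝ)) (v : Fin 1 → B × (B →L[ℝ] ℝ)) :
    canLiouville B y v = y.2 (v 0).1 := rfl

theorem canForm_apply (v : Fin 2 → B × (B →L[ℝ] ℝ)) : canForm B v = canPairing (v 0) (v 1) := by
  rw [canForm, ContinuousAlternatingMap.neg_apply,
    ContinuousAlternatingMap.alternatizeUncurryFin_apply]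
  simp [Fin.sum_univ_two, canLiouville_apply, canPairing, Fin.removeNth, sub_eq_add_neg]

theorem extDeriv_canLiouville (y : B × (B →L[ℝ] ℝ)) :
    extDeriv (canLiouville B) y = -canForm B := by
  rw [extDeriv, ContinuousLinearMap.fderiv, canForm]
  exact (neg_neg _).symm

variable {E : Type*} [NormedAddCommGroup E] [NormedSpace ℝ E]
  {H : Type*} [TopologicalSpace H] {I : ModelWithCorners ℝ E H} [I.Boundaryless]
  {X : Type*} [TopologicalSpace X] [ChartedSpace H X] [IsManifold I ∞ X]

theorem contDiffAt_canForm_comp {f : E → B × (B →L[ℝ] ℝ)} {x : E} (hf : ContDiffAt ℝ ∞ f x) :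
    ContDiffAt ℝ ∞ (fun y => (canForm B).compContinuousLinearMap (fderiv ℝ f y)) x := by
  -- the form is the exterior derivative of the pullback of the Liouville form
  let θ : E → E [⋀^Fin 1]→L[ℝ] ℝ :=
    fun y => (canLiouville B (f y)).compContinuousLinearMap (fderiv ℝ f y)
  have hθ : ContDiffAt ℝ ∞ θ x := by
    have h1 : θ = fun y => ContinuousAlternatingMap.ofSubsingletonLIE (𝕜 := ℝ) (E := E) (F := ℝ) (i := (0 : Fin 1))
        ((f y).2.comp ((ContinuousLinearMap.fst ℝ B (B →L[ℝ] ℝ)).comp (fderiv ℝ f y))) := by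
      funext y
      ext v
      rfl
    rw [h1]
    refine (LinearIsometryEquiv.contDiff _).contDiffAt.comp x ?_
    exact hf.snd.clm_comp (contDiffAt_const.clm_comp (hf.fderiv_right (by simp)))
  have h2 : ContDiffAt ℝ ∞ (fun y => -extDeriv θ y) x := by
    refine ContDiffAt.neg ?_
    exact (ContinuousLinearMap.contDiff
      (ContinuousAlternatingMap.alternatizeUncurryFinCLM ℝ E ℝ)).contDiffAt.comp x
      (hθ.fderiv_right (m := ∞) (by simp))
  refine h2.congr_of_eventuallyEq ?_
  have h3 : ∀ᶠ y in 𝓝 x, ContDiffAt ℝ 2 f y :=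
    (hf.of_le (m := 2) (by exact WithTop.coe_le_coe.2 le_top)).eventually (by simp)
  filter_upwards [h3] with y hy
  rw [extDeriv_pullback (ContinuousLinearMap.differentiableAt _) hy
    (by rw [minSmoothness_of_isRCLikeNormedField]), extDeriv_canLiouville]
  ext v
  simp

theorem DiffForm.isSmooth_of_eventuallyEq_canForm {σ : DiffForm I X 2}
    (h : ∀ x, ∃ f : X → B × (B →L[ℝ] ℝ), ContMDiffAt I 𝓘(ℝ, B × (B →L[ℝ] ℝ)) ∞ f x ∧
      ∀ᶠ y in 𝓝 x, σ y =
        (canForm B).compContinuousLinearMap (mfderiv I 𝓘(ℝ, B × (B →L[ℝ] ℝ)) f y)) :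
    σ.IsSmooth := by
  intro x
  obtain ⟨f, hf, hσ⟩ := h x
  rw [I.range_eq_univ, contDiffWithinAt_univ]
  exact (contDiffAt_canForm_comp (contDiffAt_comp_extChartAt_symm hf)).congr_of_eventuallyEq
    (DiffForm.inChart_eventuallyEq (η := fun _ => canForm B) hf hσ)

theorem DiffForm.d_eq_zero_of_eventuallyEq_canForm {σ : DiffForm I X 2}
    (h : ∀ x, ∃ f : X → B × (B →L[ℝ] ℝ), ContMDiffAt I 𝓘(ℝ, B × (B →L[ℝ] ℝ)) ∞ f x ∧
      ∀ᶠ y in 𝓝 x, σ y =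
        (canForm B).compContinuousLinearMap (mfderiv I 𝓘(ℝ, B × (B →L[ℝ] ℝ)) f y)) :
    σ.d = 0 := by
  funext x
  obtain ⟨f, hf, hσ⟩ := h x
  rw [DiffForm.d_eq_of_eventuallyEq (η := fun _ => canForm B) hf (differentiableAt_const _) hσ]
  ext v
  rw [extDeriv_const]
  rfl

end CanonicalForms

/-! ### Charts adapted to a presymplectic form -/

section AdaptedCharts

set_option synthInstance.maxHeartbeats 200000

variable {E' : Type*} [NormedAddCommGroup E'] [NormedSpace ℝ E']
  {H' : Type*} [TopologicalSpace H'] {I' : ModelWithCorners ℝ E' H'}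
  {Y : Type*} [TopologicalSpace Y] [ChartedSpace H' Y]
  {B U : Type*} [NormedAddCommGroup B] [NormedSpace ℝ B]
  [NormedAddCommGroup U] [NormedSpace ℝ U] {n : ℕ}

/-- `l` are multipliers at `y`: `dH + l_a dΦ^a` vanishes on the kernel of the form `σ` at `y`. -/
def IsFormMultiplier (σ : DiffForm I' Y 2) (H : Y → ℝ) (Φ : Fin n → Y → ℝ) (y : Y)
    (l : Fin n → ℝ) : Prop :=
  ∀ X : TangentSpace I' y, (∀ Z : TangentSpace I' y, σ y ![X, Z] = 0) →
    differential I' H y X + ∑ a, l a * differential I' (Φ a) y X = 0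

/-- The points where the constraints hold and which admit multipliers. -/
def formCompatSet (σ : DiffForm I' Y 2) (H : Y → ℝ) (Φ : Fin n → Y → ℝ) : Set Y :=
  {y | (∀ a, Φ a y = 0) ∧ ∃ l, IsFormMultiplier σ H Φ y l}

/-- The derivative of a map to phase space. -/
def phaseDeriv (I' : ModelWithCorners ℝ E' H') (κ : Y → PhaseSpace B U) (y : Y) :
    TangentSpace I' y →L[ℝ] PhaseSpace B U :=
  mfderiv I' 𝓘(ℝ, PhaseSpace B U) κ y

/-- A chart with values in `(B × B^*) × U` in which `σ` is the canonical symplectic form of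
`B × B^*`, and `H` and the `Φ^a` have the properties of a local system. -/
structure IsAdaptedChart (σ : DiffForm I' Y 2) (H : Y → ℝ) (Φ : Fin n → Y → ℝ)
    (κ : OpenPartialHomeomorph Y (PhaseSpace B U)) : Prop where
  contMDiffOn : ContMDiffOn I' 𝓘(ℝ, PhaseSpace B U) ∞ κ κ.source
  contMDiffOn_symm : ContMDiffOn 𝓘(ℝ, PhaseSpace B U) I' ∞ κ.symm κ.target
  form : ∀ y ∈ κ.source, ∀ X Z : TangentSpace I' y,
    σ y ![X, Z] = canPairing (phaseDeriv I' κ y X).1 (phaseDeriv I' κ y Z).1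
  isLocalSystem : IsLocalSystem κ.target (H ∘ κ.symm) fun a => Φ a ∘ κ.symm

variable {σ : DiffForm I' Y 2} {H : Y → ℝ} {Φ : Fin n → Y → ℝ}
  {κ : OpenPartialHomeomorph Y (PhaseSpace B U)}

namespace IsAdaptedChart

theorem mdifferentiable (hκ : IsAdaptedChart σ H Φ κ) :
    κ.MDifferentiable I' 𝓘(ℝ, PhaseSpace B U) :=
  ⟨hκ.contMDiffOn.mdifferentiableOn (by simp), hκ.contMDiffOn_symm.mdifferentiableOn (by simp)⟩

theorem bijective_phaseDeriv (hκ : IsAdaptedChart σ H Φ κ) {y : Y} (hy : y ∈ κ.source) :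
    Function.Bijective (phaseDeriv I' κ y) :=
  hκ.mdifferentiable.mfderiv_bijective hy

theorem contMDiffAt (hκ : IsAdaptedChart σ H Φ κ) {y : Y} (hy : y ∈ κ.source) :
    ContMDiffAt I' 𝓘(ℝ, PhaseSpace B U) ∞ κ y :=
  hκ.contMDiffOn.contMDiffAt (κ.open_source.mem_nhds hy)

theorem differential_eq (hκ : IsAdaptedChart σ H Φ κ) {y : Y} (hy : y ∈ κ.source) {f : Y → ℝ}
    (hf : DifferentiableAt ℝ (f ∘ κ.symm) (κ y)) (X : TangentSpace I' y) :
    differential I' f y X = fderiv ℝ (f ∘ κ.symm) (κ y) (phaseDeriv I' κ y X) := by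
  have h1 : HasMFDerivAt I' 𝓘(ℝ, ℝ) ((f ∘ κ.symm) ∘ κ) y
      ((fderiv ℝ (f ∘ κ.symm) (κ y)).comp (phaseDeriv I' κ y)) :=
    hf.hasFDerivAt.hasMFDerivAt.comp y (hκ.mdifferentiable.mdifferentiableAt hy).hasMFDerivAt
  have h2 : f =ᶠ[𝓝 y] (f ∘ κ.symm) ∘ κ := by
    filter_upwards [κ.open_source.mem_nhds hy] with z hz
    simp [κ.left_inv hz]
  rw [differential, (h1.congr_of_eventuallyEq h2).mfderiv]
  rfl

theorem differential_hamiltonian (hκ : IsAdaptedChart σ H Φ κ) {y : Y} (hy : y ∈ κ.source)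
    (X : TangentSpace I' y) :
    differential I' H y X = fderiv ℝ (H ∘ κ.symm) (κ y) (phaseDeriv I' κ y X) :=
  hκ.differential_eq hy
    ((hκ.isLocalSystem.contDiffAt (κ.map_source hy)).differentiableAt (by simp)) X

theorem differential_constraint (hκ : IsAdaptedChart σ H Φ κ) {y : Y} (hy : y ∈ κ.source)
    (a : Fin n) (X : TangentSpace I' y) :
    differential I' (Φ a) y X = fderiv ℝ (Φ a ∘ κ.symm) (κ y) (phaseDeriv I' κ y X) :=
  hκ.differential_eq hy
    ((hκ.isLocalSystem.contDiffAt_constraint (κ.map_source hy) a).differentiableAt (by simp)) X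

theorem contMDiffAt_hamiltonian (hκ : IsAdaptedChart σ H Φ κ) {y : Y} (hy : y ∈ κ.source) :
    ContMDiffAt I' 𝓘(ℝ, ℝ) ∞ H y := by
  refine ContMDiffAt.congr_of_eventuallyEq (f := (H ∘ κ.symm) ∘ κ)
    ((hκ.isLocalSystem.contDiffAt (κ.map_source hy)).contMDiffAt.comp y (hκ.contMDiffAt hy)) ?_
  filter_upwards [κ.open_source.mem_nhds hy] with z hz
  simp [κ.left_inv hz]

theorem contMDiffAt_constraint (hκ : IsAdaptedChart σ H Φ κ) {y : Y} (hy : y ∈ κ.source)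
    (a : Fin n) : ContMDiffAt I' 𝓘(ℝ, ℝ) ∞ (Φ a) y := by
  refine ContMDiffAt.congr_of_eventuallyEq (f := (Φ a ∘ κ.symm) ∘ κ)
    ((hκ.isLocalSystem.contDiffAt_constraint (κ.map_source hy) a).contMDiffAt.comp y
      (hκ.contMDiffAt hy)) ?_
  filter_upwards [κ.open_source.mem_nhds hy] with z hz
  simp [κ.left_inv hz]

/-- The kernel of `σ` consists of the vectors in the directions of `U`. -/
theorem form_eq_zero_iff [FiniteDimensional ℝ B] (hκ : IsAdaptedChart σ H Φ κ) {y : Y}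
    (hy : y ∈ κ.source) (X : TangentSpace I' y) :
    (∀ Z : TangentSpace I' y, σ y ![X, Z] = 0) ↔ (phaseDeriv I' κ y X).1 = 0 := by
  refine ⟨fun h => canPairing_nondegenerate fun q => ?_, fun h Z => ?_⟩
  · obtain ⟨Z, hZ⟩ := (hκ.bijective_phaseDeriv hy).2 (q, 0)
    have := h Z
    rwa [hκ.form y hy, hZ] at this
  · rw [hκ.form y hy, h]
    simp [canPairing]

theorem isFormMultiplier_iff [FiniteDimensional ℝ B] (hκ : IsAdaptedChart σ H Φ κ) {y : Y}
    (hy : y ∈ κ.source) (l : Fin n → ℝ) : IsFormMultiplier σ H Φ y l ↔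
      IsLocalMultiplier (.inr ℝ (B × (B →L[ℝ] ℝ)) U) (H ∘ κ.symm) (fun a => Φ a ∘ κ.symm)
        (κ y) l := by
  have hS := hκ.isLocalSystem
  have hv := κ.map_source hy
  have h1 : ∀ X : TangentSpace I' y, differential I' H y X +
      ∑ a, l a * differential I' (Φ a) y X =
      fderiv ℝ (augmented (H ∘ κ.symm) (fun a => Φ a ∘ κ.symm) l) (κ y) (phaseDeriv I' κ y X) := by
    intro X
    rw [fderiv_augmented ((hS.contDiffAt hv).differentiableAt (by simp))
      (fun a => (hS.contDiffAt_constraint hv a).differentiableAt (by simp)),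
      hκ.differential_hamiltonian hy]
    simp [hκ.differential_constraint hy]
  refine ⟨fun h u => ?_, fun h X hX => ?_⟩
  · obtain ⟨X, hX⟩ := (hκ.bijective_phaseDeriv hy).2 (0, u)
    have h2 := h X ((hκ.form_eq_zero_iff hy X).2 (by rw [hX]))
    rwa [h1, hX] at h2
  · rw [hκ.form_eq_zero_iff hy] at hX
    rw [h1]
    have h2 : phaseDeriv I' κ y X = (0, (phaseDeriv I' κ y X).2) := Prod.ext hX rfl
    rw [h2]
    exact h _

theorem mem_formCompatSet_iff [FiniteDimensional ℝ B] (hκ : IsAdaptedChart σ H Φ κ) {y : Y}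
    (hy : y ∈ κ.source) : y ∈ formCompatSet σ H Φ ↔
      κ y ∈ localCompatSet (.inr ℝ (B × (B →L[ℝ] ℝ)) U) (H ∘ κ.symm) fun a => Φ a ∘ κ.symm := by
  simp only [formCompatSet, localCompatSet, mem_ofPred_eq, hκ.isFormMultiplier_iff hy,
    Function.comp_apply, κ.left_inv hy]

theorem systemMap_eq_zero [FiniteDimensional ℝ B] (hκ : IsAdaptedChart σ H Φ κ) {y : Y}
    (hy : y ∈ κ.source) (h0 : ∀ a, Φ a y = 0) {l : Fin n → ℝ} (hl : IsFormMultiplier σ H Φ y l) :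
    systemMap (.inr ℝ (B × (B →L[ℝ] ℝ)) U) (H ∘ κ.symm) (fun a => Φ a ∘ κ.symm) (κ y, l) = 0 :=
  (systemMap_eq_zero_iff _ (hκ.isLocalSystem.contDiffAt (κ.map_source hy))
    (hκ.isLocalSystem.contDiffAt_constraint (κ.map_source hy)) l).2
    ⟨by simpa [κ.left_inv hy] using h0, (hκ.isFormMultiplier_iff hy l).1 hl⟩

end IsAdaptedChart

section Submanifold

variable {E₁ : Type*} [NormedAddCommGroup E₁] [NormedSpace ℝ E₁]
  {H₁ : Type*} [TopologicalSpace H₁] {I : ModelWithCorners ℝ E₁ H₁}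
  [ChartedSpace H₁ (formCompatSet σ H Φ)]

/-- The derivative of the coordinate expression of the inclusion of `W_c`. -/
def inclDeriv (I : ModelWithCorners ℝ E₁ H₁) (I' : ModelWithCorners ℝ E' H')
    {σ : DiffForm I' Y 2} {H : Y → ℝ} {Φ : Fin n → Y → ℝ} [ChartedSpace H₁ (formCompatSet σ H Φ)]
    (κ : OpenPartialHomeomorph Y (PhaseSpace B U)) (x : formCompatSet σ H Φ) :
    TangentSpace I x →L[ℝ] PhaseSpace B U :=
  (phaseDeriv I' κ x.1).comp (mfderiv I I' (Subtype.val : formCompatSet σ H Φ → Y) x)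

namespace IsAdaptedChart

/-- The velocities of the curves in the coordinate expression of `W_c` are tangent to `W_c`. -/
theorem velocity_mem_range [I.Boundaryless] (hκ : IsAdaptedChart σ H Φ κ)
    (hS : Manifold.IsSmoothEmbedding I I' ∞ (Subtype.val : formCompatSet σ H Φ → Y))
    (x : formCompatSet σ H Φ) (hx : x.1 ∈ κ.source) {γ : ℝ → PhaseSpace B U} (h0 : γ 0 = κ x.1)
    {X : PhaseSpace B U} (hγ : HasDerivAt γ X 0)
    (hmem : ∀ᶠ t in 𝓝 (0 : ℝ), κ.symm (γ t) ∈ formCompatSet σ H Φ) :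
    ∃ u, inclDeriv I I' κ x u = X := by
  have h1 : HasMFDerivAt 𝓘(ℝ, ℝ) 𝓘(ℝ, PhaseSpace B U) γ 0
      (ContinuousLinearMap.toSpanSingleton ℝ X) := hγ.hasFDerivAt.hasMFDerivAt
  have h2 : HasMFDerivAt 𝓘(ℝ, PhaseSpace B U) I' κ.symm (γ 0)
      (mfderiv 𝓘(ℝ, PhaseSpace B U) I' κ.symm (γ 0)) := by
    rw [h0]
    exact (hκ.mdifferentiable.mdifferentiableAt_symm (κ.map_source hx)).hasMFDerivAt
  have h3 := h2.comp (0 : ℝ) h1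
  have h4 : (κ.symm ∘ γ) 0 = x.1 := by simp [h0, κ.left_inv hx]
  obtain ⟨u, hu⟩ := hS.velocity_mem_range (γ := κ.symm ∘ γ) (x := x) h4
    h3.mdifferentiableAt (hmem.mono fun t ht => ⟨⟨_, ht⟩, rfl⟩)
  refine ⟨u, ?_⟩
  rw [inclDeriv, ContinuousLinearMap.comp_apply, hu, h3.mfderiv]
  have h5 := hκ.mdifferentiable.comp_symm_deriv (κ.map_source hx)
  have h6 := congrArg (fun A : PhaseSpace B U →L[ℝ] PhaseSpace B U => A X) h5
  have h7 : (κ.symm (κ x.1)) = x.1 := κ.left_inv hx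
  have h8 : ContinuousLinearMap.toSpanSingleton ℝ X (1 : ℝ) = X := by simp
  rw [phaseDeriv, ← h7, h0]
  change mfderiv I' 𝓘(ℝ, PhaseSpace B U) κ (κ.symm (κ x.1)) (mfderiv 𝓘(ℝ, PhaseSpace B U) I' κ.symm
    (κ x.1) (ContinuousLinearMap.toSpanSingleton ℝ X (1 : ℝ))) = X
  rw [h8]
  exact h6

theorem injective_inclDeriv [I.Boundaryless] (hκ : IsAdaptedChart σ H Φ κ)
    (hS : Manifold.IsSmoothEmbedding I I' ∞ (Subtype.val : formCompatSet σ H Φ → Y))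
    (x : formCompatSet σ H Φ) (hx : x.1 ∈ κ.source) : Function.Injective (inclDeriv I I' κ x) :=
  (hκ.bijective_phaseDeriv hx).1.comp (hS.isImmersion.isImmersionAt x).mfderiv_injective

theorem pullback_eq (hκ : IsAdaptedChart σ H Φ κ) (x : formCompatSet σ H Φ)
    (hx : x.1 ∈ κ.source) (u u' : TangentSpace I x) :
    σ.pullback (I := I) (Subtype.val : formCompatSet σ H Φ → Y) x ![u, u'] =
      canPairing (inclDeriv I I' κ x u).1 (inclDeriv I I' κ x u').1 := by
  have h := hκ.form x.1 hx (mfderiv I I' (Subtype.val : formCompatSet σ H Φ → Y) x u)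
    (mfderiv I I' (Subtype.val : formCompatSet σ H Φ → Y) x u')
  rw [inclDeriv, ContinuousLinearMap.comp_apply, ContinuousLinearMap.comp_apply, ← h,
    DiffForm.pullback, ContinuousAlternatingMap.compContinuousLinearMap_apply]
  congr 1
  funext i
  fin_cases i <;> rfl

/-- The tangent vectors of `W_c` annihilate the differentials of the constraints. -/
theorem differential_constraint_mfderiv
    (hS : Manifold.IsSmoothEmbedding I I' ∞ (Subtype.val : formCompatSet σ H Φ → Y))
    (hκ : IsAdaptedChart σ H Φ κ) (x : formCompatSet σ H Φ) (hx : x.1 ∈ κ.source) (a : Fin n)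
    (u : TangentSpace I x) : differential I' (Φ a) x.1
      (mfderiv I I' (Subtype.val : formCompatSet σ H Φ → Y) x u) = 0 := by
  have h1 := mfderiv_comp x ((hκ.contMDiffAt_constraint hx a).mdifferentiableAt (by simp))
    (hS.contMDiff.mdifferentiableAt (x := x) (by simp))
  have h2 : (Φ a) ∘ (Subtype.val : formCompatSet σ H Φ → Y) = fun _ => 0 :=
    funext fun y => y.2.1 a
  rw [h2, mfderiv_const] at h1
  exact (congrArg (fun A : TangentSpace I x →L[ℝ] ℝ => A u) h1).symm

/-- If the form is nondegenerate on the embedded submanifold `W_c`, the bordered Hessian is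
nondegenerate. -/
theorem isLocallyRegular [I.Boundaryless] [FiniteDimensional ℝ B] [FiniteDimensional ℝ U]
    (hκ : IsAdaptedChart σ H Φ κ)
    (hS : Manifold.IsSmoothEmbedding I I' ∞ (Subtype.val : formCompatSet σ H Φ → Y))
    (hnd : ∀ x, ∀ u : TangentSpace I x, (∀ u' : TangentSpace I x,
      σ.pullback (I := I) (Subtype.val : formCompatSet σ H Φ → Y) x ![u, u'] = 0) → u = 0)
    (x : formCompatSet σ H Φ) (hx : x.1 ∈ κ.source) {l : Fin n → ℝ}
    (hl : IsFormMultiplier σ H Φ x.1 l) :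
    IsLocallyRegular (.inr ℝ (B × (B →L[ℝ] ℝ)) U) (H ∘ κ.symm) (fun a => Φ a ∘ κ.symm)
      (κ x.1) l := by
  have hL := hκ.isLocalSystem
  have hv := κ.map_source hx
  have h0 : ∀ a, (Φ a ∘ κ.symm) (κ x.1) = 0 := by simpa [κ.left_inv hx] using x.2.1
  refine hL.isLocallyRegular hv h0 (T := range (inclDeriv I I' κ x)) ?_ ?_ ?_
  · intro X μ hX
    obtain ⟨γ, hγ0, hγ, hmem⟩ := exists_curve_mem_localCompatSet κ.open_target hL.smooth
      hL.smooth_constraint hv (hκ.systemMap_eq_zero hx x.2.1 hl)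
      (hL.surjective_fderiv_systemMap hv h0 l) hX
    refine hκ.velocity_mem_range hS x hx hγ0 hγ ?_
    have h2 : ∀ᶠ t in 𝓝 (0 : ℝ), γ t ∈ κ.target :=
      hγ.continuousAt.eventually_mem (κ.open_target.mem_nhds (by rwa [hγ0]))
    filter_upwards [hmem, h2] with t ht1 ht2
    rw [hκ.mem_formCompatSet_iff (κ.map_target ht2), κ.right_inv ht2]
    exact ht1
  · rintro _ ⟨u, rfl⟩ a
    rw [inclDeriv, ContinuousLinearMap.comp_apply, ← hκ.differential_constraint hx]
    exact differential_constraint_mfderiv hS hκ x hx a u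
  · rintro _ ⟨u, rfl⟩ hu
    rw [hnd x u fun u' => ?_, map_zero]
    rw [hκ.pullback_eq x hx]
    exact hu _ ⟨u', rfl⟩

end IsAdaptedChart

end Submanifold

end AdaptedCharts

/-! ### Charts with nondegenerate bordered Hessian -/

section RegularCharts

set_option synthInstance.maxHeartbeats 200000

variable {E' : Type*} [NormedAddCommGroup E'] [NormedSpace ℝ E']
  {H' : Type*} [TopologicalSpace H'] {I' : ModelWithCorners ℝ E' H'}
  {Y : Type*} [TopologicalSpace Y] [ChartedSpace H' Y]
  {B U : Type*} [NormedAddCommGroup B] [NormedSpace ℝ B]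
  [NormedAddCommGroup U] [NormedSpace ℝ U] {n : ℕ}

/-- An adapted chart in which the bordered Hessian is nondegenerate along `W_c`. -/
structure IsRegularChart (σ : DiffForm I' Y 2) (H : Y → ℝ) (Φ : Fin n → Y → ℝ)
    (κ : OpenPartialHomeomorph Y (PhaseSpace B U)) : Prop extends IsAdaptedChart σ H Φ κ where
  regular : ∀ y ∈ κ.source, y ∈ formCompatSet σ H Φ → ∀ l, IsFormMultiplier σ H Φ y l →
    IsLocallyRegular (.inr ℝ (B × (B →L[ℝ] ℝ)) U) (H ∘ κ.symm) (fun a => Φ a ∘ κ.symm) (κ y) l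

variable {σ : DiffForm I' Y 2} {H : Y → ℝ} {Φ : Fin n → Y → ℝ}
  {κ : OpenPartialHomeomorph Y (PhaseSpace B U)}

/-- In a regular chart, `W_c` is the graph of a smooth function of the base coordinates and
the momenta. -/
theorem IsRegularChart.exists_graph [FiniteDimensional ℝ B] [FiniteDimensional ℝ U]
    (hκ : IsRegularChart σ H Φ κ) {y : Y} (hy : y ∈ κ.source) (hyc : y ∈ formCompatSet σ H Φ) :
    ∃ s : B × (B →L[ℝ] ℝ) → U, (∀ᶠ z in 𝓝 (κ y).1, ContDiffAt ℝ ∞ s z) ∧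
      s (κ y).1 = (κ y).2 ∧ ∀ᶠ w in 𝓝 (κ y), w ∈ κ.target ∧
        (κ.symm w ∈ formCompatSet σ H Φ ↔ s w.1 = w.2) := by
  have hL := hκ.isLocalSystem
  obtain ⟨s, h1, h2, h3⟩ := exists_graph_localCompatSet hL.isOpen hL.smooth hL.smooth_constraint
    (fun v hv hvc l hl => by
      have h := hκ.regular (κ.symm v) (κ.map_target hv)
        ((hκ.mem_formCompatSet_iff (κ.map_target hv)).2 (by rwa [κ.right_inv hv])) l
        ((hκ.isFormMultiplier_iff (κ.map_target hv) l).2 (by rwa [κ.right_inv hv]))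
      rwa [κ.right_inv hv] at h) (κ.map_source hy) ((hκ.mem_formCompatSet_iff hy).1 hyc)
  refine ⟨s, h1, h2, ?_⟩
  filter_upwards [h3, hL.isOpen.mem_nhds (κ.map_source hy)] with w hw hwt
  refine ⟨hwt, ?_⟩
  rw [hκ.mem_formCompatSet_iff (κ.map_target hwt), κ.right_inv hwt, hw]

variable {E₁ : Type*} [NormedAddCommGroup E₁] [NormedSpace ℝ E₁]
  {H₁ : Type*} [TopologicalSpace H₁] {I : ModelWithCorners ℝ E₁ H₁}
  [ChartedSpace H₁ (formCompatSet σ H Φ)]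

/-- The base coordinates and the momenta of the points of `W_c`. -/
def baseMap (σ : DiffForm I' Y 2) (H : Y → ℝ) (Φ : Fin n → Y → ℝ)
    (κ : OpenPartialHomeomorph Y (PhaseSpace B U)) (x : formCompatSet σ H Φ) :
    B × (B →L[ℝ] ℝ) := (κ x.1).1

theorem IsAdaptedChart.contMDiffAt_incl (hκ : IsAdaptedChart σ H Φ κ)
    (hS : Manifold.IsSmoothEmbedding I I' ∞ (Subtype.val : formCompatSet σ H Φ → Y))
    {x : formCompatSet σ H Φ} (hx : x.1 ∈ κ.source) :
    ContMDiffAt I 𝓘(ℝ, PhaseSpace B U) ∞ (fun x : formCompatSet σ H Φ => κ x.1) x :=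
  (hκ.contMDiffAt hx).comp x hS.contMDiff.contMDiffAt

theorem IsAdaptedChart.hasMFDerivAt_incl (hκ : IsAdaptedChart σ H Φ κ)
    (hS : Manifold.IsSmoothEmbedding I I' ∞ (Subtype.val : formCompatSet σ H Φ → Y))
    {x : formCompatSet σ H Φ} (hx : x.1 ∈ κ.source) :
    HasMFDerivAt I 𝓘(ℝ, PhaseSpace B U) (fun x : formCompatSet σ H Φ => κ x.1) x
      (inclDeriv I I' κ x) :=
  (hκ.mdifferentiable.mdifferentiableAt hx).hasMFDerivAt.comp x
    (hS.contMDiff.mdifferentiableAt (x := x) (by simp)).hasMFDerivAt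

theorem IsAdaptedChart.contMDiffAt_baseMap (hκ : IsAdaptedChart σ H Φ κ)
    (hS : Manifold.IsSmoothEmbedding I I' ∞ (Subtype.val : formCompatSet σ H Φ → Y))
    {x : formCompatSet σ H Φ} (hx : x.1 ∈ κ.source) :
    ContMDiffAt I 𝓘(ℝ, B × (B →L[ℝ] ℝ)) ∞ (baseMap σ H Φ κ) x :=
  (contDiff_fst (𝕜 := ℝ) (E := B × (B →L[ℝ] ℝ)) (F := U)).contMDiff.contMDiffAt.comp x
    (hκ.contMDiffAt_incl hS hx)

theorem IsAdaptedChart.hasMFDerivAt_baseMap (hκ : IsAdaptedChart σ H Φ κ)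
    (hS : Manifold.IsSmoothEmbedding I I' ∞ (Subtype.val : formCompatSet σ H Φ → Y))
    {x : formCompatSet σ H Φ} (hx : x.1 ∈ κ.source) :
    HasMFDerivAt I 𝓘(ℝ, B × (B →L[ℝ] ℝ)) (baseMap σ H Φ κ) x
      ((ContinuousLinearMap.fst ℝ (B × (B →L[ℝ] ℝ)) U).comp (inclDeriv I I' κ x)) :=
  HasMFDerivAt.comp x
    (hasFDerivAt_fst (𝕜 := ℝ) (E := B × (B →L[ℝ] ℝ)) (F := U) (p := κ x.1)).hasMFDerivAt
    (hκ.hasMFDerivAt_incl hS hx)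

namespace IsRegularChart

/-- On `W_c` the top-order coordinates are functions of the other ones. -/
theorem eventually_graph {s : B × (B →L[ℝ] ℝ) → U}
    {x : formCompatSet σ H Φ} (hx : x.1 ∈ κ.source)
    (hs : ∀ᶠ w in 𝓝 (κ x.1), w ∈ κ.target ∧ (κ.symm w ∈ formCompatSet σ H Φ ↔ s w.1 = w.2)) :
    ∀ᶠ y : formCompatSet σ H Φ in 𝓝 x, s (baseMap σ H Φ κ y) = (κ y.1).2 := by
  have h1 : Filter.Tendsto (fun y : formCompatSet σ H Φ => κ y.1) (𝓝 x) (𝓝 (κ x.1)) :=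
    (κ.continuousAt hx).comp continuous_subtype_val.continuousAt
  have h2 : ∀ᶠ y : formCompatSet σ H Φ in 𝓝 x, y.1 ∈ κ.source :=
    continuous_subtype_val.continuousAt.eventually_mem (κ.open_source.mem_nhds hx)
  filter_upwards [h1.eventually hs, h2] with y hy1 hy2
  exact hy1.2.1 (by rw [κ.left_inv hy2]; exact y.2)

/-- The base coordinates and the momenta are local coordinates of the embedded submanifold `W_c`. -/
theorem bijective_baseDeriv [I.Boundaryless] [FiniteDimensional ℝ B] [FiniteDimensional ℝ U]
    (hκ : IsRegularChart σ H Φ κ)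
    (hS : Manifold.IsSmoothEmbedding I I' ∞ (Subtype.val : formCompatSet σ H Φ → Y))
    (x : formCompatSet σ H Φ) (hx : x.1 ∈ κ.source) :
    Function.Bijective fun u : TangentSpace I x => (inclDeriv I I' κ x u).1 := by
  obtain ⟨s, hs, hsx, hg⟩ := hκ.exists_graph hx x.2
  have hs' : HasFDerivAt s (fderiv ℝ s (κ x.1).1) (κ x.1).1 :=
    (hs.self_of_nhds.differentiableAt (by simp)).hasFDerivAt
  constructor
  · have h1 : HasMFDerivAt I 𝓘(ℝ, U) (fun y : formCompatSet σ H Φ => (κ y.1).2) x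
        ((ContinuousLinearMap.snd ℝ (B × (B →L[ℝ] ℝ)) U).comp (inclDeriv I I' κ x)) :=
      HasMFDerivAt.comp x
        (hasFDerivAt_snd (𝕜 := ℝ) (E := B × (B →L[ℝ] ℝ)) (F := U) (p := κ x.1)).hasMFDerivAt
        (hκ.hasMFDerivAt_incl hS hx)
    have h2 : HasMFDerivAt I 𝓘(ℝ, U) (s ∘ baseMap σ H Φ κ) x ((fderiv ℝ s (κ x.1).1).comp
        ((ContinuousLinearMap.fst ℝ (B × (B →L[ℝ] ℝ)) U).comp (inclDeriv I I' κ x))) :=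
      HasMFDerivAt.comp x hs'.hasMFDerivAt (hκ.hasMFDerivAt_baseMap hS hx)
    have h3 := hasMFDerivAt_unique h1 (h2.congr_of_eventuallyEq
      ((eventually_graph hx hg).mono fun y hy => hy.symm))
    have h4 : ∀ u : TangentSpace I x, (inclDeriv I I' κ x u).2 =
        fderiv ℝ s (κ x.1).1 (inclDeriv I I' κ x u).1 := fun u =>
      congrArg (fun A : TangentSpace I x →L[ℝ] U => A u) h3
    intro u u' huu'
    refine hκ.injective_inclDeriv hS x hx (Prod.ext huu' ?_)
    simp only at huu'
    rw [h4, h4, huu']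
  -- surjectivity: every `q` is the velocity of the base of a curve in the graph
  · intro q
    let γ : ℝ → PhaseSpace B U := fun t => ((κ x.1).1 + t • q, s ((κ x.1).1 + t • q))
    have hc : HasDerivAt (fun t : ℝ => (κ x.1).1 + t • q) q 0 := by
      simpa using ((hasDerivAt_id (0 : ℝ)).smul_const q).const_add (κ x.1).1
    have h0 : (κ x.1).1 + (0 : ℝ) • q = (κ x.1).1 := by simp
    have hγ0 : γ 0 = κ x.1 := Prod.ext h0 (by simp only [γ, h0, hsx])
    have hγ : HasDerivAt γ (q, fderiv ℝ s (κ x.1).1 q) 0 :=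
      hc.prodMk (HasFDerivAt.comp_hasDerivAt (0 : ℝ) (by rwa [h0]) hc)
    have hmem : ∀ᶠ t in 𝓝 (0 : ℝ), κ.symm (γ t) ∈ formCompatSet σ H Φ := by
      have hcont : Filter.Tendsto γ (𝓝 0) (𝓝 (κ x.1)) := hγ0 ▸ hγ.continuousAt
      filter_upwards [hcont.eventually hg] with t ht
      exact ht.2.2 rfl
    obtain ⟨u, hu⟩ := hκ.velocity_mem_range hS x hx hγ0 hγ hmem
    exact ⟨u, by simp only [hu]⟩

theorem pullback_nondegenerate [I.Boundaryless] [FiniteDimensional ℝ B] [FiniteDimensional ℝ U]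
    (hκ : IsRegularChart σ H Φ κ)
    (hS : Manifold.IsSmoothEmbedding I I' ∞ (Subtype.val : formCompatSet σ H Φ → Y))
    (x : formCompatSet σ H Φ) (hx : x.1 ∈ κ.source) (u : TangentSpace I x)
    (hu : ∀ u' : TangentSpace I x,
      σ.pullback (I := I) (Subtype.val : formCompatSet σ H Φ → Y) x ![u, u'] = 0) : u = 0 := by
  have hb := hκ.bijective_baseDeriv hS x hx
  refine hb.1 ?_
  simp only [map_zero, Prod.fst_zero]
  refine canPairing_nondegenerate fun q => ?_
  obtain ⟨u', hu'⟩ := hb.2 q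
  rw [← hu', ← hκ.pullback_eq x hx]
  exact hu u'

end IsRegularChart

/-- The pullback of the form to `W_c` is locally the pullback of the canonical form by the base
coordinates and the momenta. -/
theorem IsAdaptedChart.pullback_eventuallyEq (hκ : IsAdaptedChart σ H Φ κ)
    (hS : Manifold.IsSmoothEmbedding I I' ∞ (Subtype.val : formCompatSet σ H Φ → Y))
    {x : formCompatSet σ H Φ} (hx : x.1 ∈ κ.source) :
    ∀ᶠ y in 𝓝 x, σ.pullback (I := I) (Subtype.val : formCompatSet σ H Φ → Y) y =
      (canForm B).compContinuousLinearMap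
        (mfderiv I 𝓘(ℝ, B × (B →L[ℝ] ℝ)) (baseMap σ H Φ κ) y) := by
  have h2 : ∀ᶠ y : formCompatSet σ H Φ in 𝓝 x, y.1 ∈ κ.source :=
    continuous_subtype_val.continuousAt.eventually_mem (κ.open_source.mem_nhds hx)
  filter_upwards [h2] with y hy
  ext v
  have hv : v = ![v 0, v 1] := by ext i; fin_cases i <;> rfl
  rw [hv, hκ.pullback_eq y hy, (hκ.hasMFDerivAt_baseMap hS hy).mfderiv,
    ContinuousAlternatingMap.compContinuousLinearMap_apply]
  refine Eq.trans ?_ (canForm_apply _).symm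
  rfl

section Dynamics

/-- On `W_c`, the extrinsic and the intrinsic equations at a point are equivalent: modulo
the tangent space of `W_c`, every vector annihilated by the `dΦ^a` is in the kernel of `σ`, where
`dH` vanishes because of the multipliers. -/
theorem IsRegularChart.extrinsic_iff [I.Boundaryless]
    [FiniteDimensional ℝ B] [FiniteDimensional ℝ U] (hκ : IsRegularChart σ H Φ κ)
    (hS : Manifold.IsSmoothEmbedding I I' ∞ (Subtype.val : formCompatSet σ H Φ → Y))
    (x : formCompatSet σ H Φ) (hx : x.1 ∈ κ.source) (u : TangentSpace I x) :
    (∀ Z : TangentSpace I' x.1, (∀ a, differential I' (Φ a) x.1 Z = 0) →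
      σ x.1 ![mfderiv I I' (Subtype.val : formCompatSet σ H Φ → Y) x u, Z] =
        differential I' H x.1 Z) ↔
    ∀ u' : TangentSpace I x,
      σ.pullback (I := I) (Subtype.val : formCompatSet σ H Φ → Y) x ![u, u'] =
        differential I (fun y : formCompatSet σ H Φ => H y.1) x u' := by
  have hd : ∀ u' : TangentSpace I x, differential I (fun y : formCompatSet σ H Φ => H y.1) x u' =
      differential I' H x.1 (mfderiv I I' (Subtype.val : formCompatSet σ H Φ → Y) x u') := by
    intro u'
    have h1 := mfderiv_comp x ((hκ.contMDiffAt_hamiltonian hx).mdifferentiableAt (by simp))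
      (hS.contMDiff.mdifferentiableAt (x := x) (by simp))
    exact congrArg (fun A : TangentSpace I x →L[ℝ] ℝ => A u') h1
  have hp : ∀ u' : TangentSpace I x,
      σ.pullback (I := I) (Subtype.val : formCompatSet σ H Φ → Y) x ![u, u'] =
      σ x.1 ![mfderiv I I' (Subtype.val : formCompatSet σ H Φ → Y) x u,
        mfderiv I I' (Subtype.val : formCompatSet σ H Φ → Y) x u'] := by
    intro u'
    rw [hκ.pullback_eq x hx, hκ.form x.1 hx]
    rfl
  refine ⟨fun h u' => ?_, fun h Z hZ => ?_⟩
  · rw [hp, hd]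
    exact h _ fun a => IsAdaptedChart.differential_constraint_mfderiv hS hκ.toIsAdaptedChart x hx a u'
  · obtain ⟨u', hu'⟩ := (hκ.bijective_baseDeriv hS x hx).2 (phaseDeriv I' κ x.1 Z).1
    obtain ⟨l, hl⟩ := x.2.2
    set Z₁ := mfderiv I I' (Subtype.val : formCompatSet σ H Φ → Y) x u' with hZ₁
    have h1 : (phaseDeriv I' κ x.1 (Z - Z₁)).1 = 0 := by
      rw [map_sub, Prod.fst_sub, ← hu']
      exact sub_self _
    have h2 := hl (Z - Z₁) ((hκ.form_eq_zero_iff hx _).2 h1)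
    have h3 : ∀ a, differential I' (Φ a) x.1 (Z - Z₁) = 0 := fun a => by
      rw [map_sub, hZ, hZ₁,
        IsAdaptedChart.differential_constraint_mfderiv hS hκ.toIsAdaptedChart x hx a u', sub_zero]
    simp only [h3, mul_zero, Finset.sum_const_zero, add_zero] at h2
    rw [map_sub, sub_eq_zero] at h2
    rw [h2, hZ₁, ← hd, ← h u', hκ.pullback_eq x hx, hκ.form x.1 hx, ← hu']
    rfl

end Dynamics

end RegularCharts

/-! ### The vector field of the dynamics -/

section VectorField

set_option synthInstance.maxHeartbeats 200000

/-- An injective linear map from a finite-dimensional space to its dual is an isomorphism. -/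
theorem exists_continuousLinearEquiv_dual {V : Type*} [NormedAddCommGroup V] [NormedSpace ℝ V]
    [FiniteDimensional ℝ V] (f : V →ₗ[ℝ] V →L[ℝ] ℝ) (hf : Function.Injective f) :
    ∃ e : V ≃L[ℝ] (V →L[ℝ] ℝ), ∀ x, e x = f x := by
  have h : Module.finrank ℝ V = Module.finrank ℝ (V →L[ℝ] ℝ) := by
    rw [← (LinearMap.toContinuousLinearMap (𝕜 := ℝ) (E := V) (F' := ℝ)).finrank_eq]
    exact (Subspace.dual_finrank_eq (K := ℝ) (V := V)).symm
  exact ⟨(LinearEquiv.ofInjectiveOfFinrankEq f hf h).toContinuousLinearEquiv, fun _ => rfl⟩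

/-- The isomorphism of `B × B^*` with its dual given by the canonical pairing. -/
theorem exists_canFlat (B : Type*) [NormedAddCommGroup B] [NormedSpace ℝ B]
    [FiniteDimensional ℝ B] :
    ∃ e : (B × (B →L[ℝ] ℝ)) ≃L[ℝ] ((B × (B →L[ℝ] ℝ)) →L[ℝ] ℝ), ∀ x y, e x y = canPairing x y := by
  let f : (B × (B →L[ℝ] ℝ)) →ₗ[ℝ] ((B × (B →L[ℝ] ℝ)) →L[ℝ] ℝ) :=
    { toFun := fun x => LinearMap.toContinuousLinearMap
        { toFun := fun y => canPairing x y
          map_add' := fun y y' => by simp [canPairing]; ring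
          map_smul' := fun c y => by simp [canPairing]; ring }
      map_add' := fun x x' => by ext y <;> simp [canPairing] ; ring
      map_smul' := fun c x => by ext y <;> simp [canPairing] }
  obtain ⟨e, he⟩ := exists_continuousLinearEquiv_dual f
    ((injective_iff_map_eq_zero f).2 fun x hx => canPairing_nondegenerate fun y =>
      congrArg (fun g : (B × (B →L[ℝ] ℝ)) →L[ℝ] ℝ => g y) hx)
  exact ⟨e, fun x y => by rw [he]; rfl⟩

theorem isInvertible_of_bijective {V W : Type*} [NormedAddCommGroup V] [NormedSpace ℝ V]
    [CompleteSpace V] [NormedAddCommGroup W] [NormedSpace ℝ W] [CompleteSpace W] {A : V →L[ℝ] W}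
    (hA : Function.Bijective A) : A.IsInvertible :=
  ⟨ContinuousLinearEquiv.ofBijective A (LinearMap.ker_eq_bot.2 hA.1)
    (LinearMap.range_eq_top.2 hA.2), rfl⟩

variable {E' : Type*} [NormedAddCommGroup E'] [NormedSpace ℝ E']
  {H' : Type*} [TopologicalSpace H'] {I' : ModelWithCorners ℝ E' H'}
  {Y : Type*} [TopologicalSpace Y] [ChartedSpace H' Y]
  {B U : Type*} [NormedAddCommGroup B] [NormedSpace ℝ B]
  [NormedAddCommGroup U] [NormedSpace ℝ U] {n : ℕ}
  {σ : DiffForm I' Y 2} {H : Y → ℝ} {Φ : Fin n → Y → ℝ}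
  {κ : OpenPartialHomeomorph Y (PhaseSpace B U)}
  {E₁ : Type*} [NormedAddCommGroup E₁] [NormedSpace ℝ E₁]
  {H₁ : Type*} [TopologicalSpace H₁] {I : ModelWithCorners ℝ E₁ H₁} [I.Boundaryless]
  [ChartedSpace H₁ (formCompatSet σ H Φ)]
  [FiniteDimensional ℝ B] [FiniteDimensional ℝ U]

/-- Local existence of a smooth solution of the dynamical equation: it is the pullback by the base
coordinates and the momenta of a Hamiltonian vector field of `B × B^*`. -/
theorem IsRegularChart.exists_local_solution [CompleteSpace E₁] [IsManifold I ∞ (formCompatSet σ H Φ)]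
    (hκ : IsRegularChart σ H Φ κ)
    (hS : Manifold.IsSmoothEmbedding I I' ∞ (Subtype.val : formCompatSet σ H Φ → Y))
    (x : formCompatSet σ H Φ) (hx : x.1 ∈ κ.source) :
    ∃ X : ∀ y : formCompatSet σ H Φ, TangentSpace I y,
      ContMDiffAt I I.tangent ∞
        (fun y => (⟨y, X y⟩ : TangentBundle I (formCompatSet σ H Φ))) x ∧
      ∀ᶠ y in 𝓝 x, ∀ u : TangentSpace I y,
        σ.pullback (I := I) (Subtype.val : formCompatSet σ H Φ → Y) y ![X y, u] =
          differential I (fun y : formCompatSet σ H Φ => H y.1) y u := by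
  obtain ⟨s, hs, hsx, hg⟩ := hκ.exists_graph hx x.2
  obtain ⟨flat, hflat⟩ := exists_canFlat B
  -- the Hamiltonian in the coordinates of the graph
  let h : B × (B →L[ℝ] ℝ) → ℝ := fun z => (H ∘ κ.symm) (z, s z)
  have hxs : ((κ x.1).1, s (κ x.1).1) = κ x.1 := Prod.ext rfl hsx
  have hh : ContDiffAt ℝ ∞ h (κ x.1).1 := by
    have h1 := hκ.isLocalSystem.contDiffAt (κ.map_source hx)
    rw [← hxs] at h1
    exact ContDiffAt.comp (g := H ∘ κ.symm) (κ x.1).1 h1 (contDiffAt_id.prodMk hs.self_of_nhds)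
  let V : ∀ z : B × (B →L[ℝ] ℝ), TangentSpace 𝓘(ℝ, B × (B →L[ℝ] ℝ)) z :=
    fun z => flat.symm (fderiv ℝ h z)
  have hV : ContMDiffAt 𝓘(ℝ, B × (B →L[ℝ] ℝ)) 𝓘(ℝ, B × (B →L[ℝ] ℝ)).tangent ∞
      (fun z => (⟨z, V z⟩ : TangentBundle 𝓘(ℝ, B × (B →L[ℝ] ℝ)) (B × (B →L[ℝ] ℝ))))
      (baseMap σ H Φ κ x) := by
    rw [contMDiffAt_vectorSpace_iff_contDiffAt]
    exact flat.symm.contDiff.contDiffAt.comp _ (hh.fderiv_right (m := ∞) (by simp))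
  have hinv : ∀ y : formCompatSet σ H Φ, y.1 ∈ κ.source →
      (mfderiv I 𝓘(ℝ, B × (B →L[ℝ] ℝ)) (baseMap σ H Φ κ) y).IsInvertible := by
    intro y hy
    have hb := hκ.bijective_baseDeriv hS y hy
    rw [(hκ.hasMFDerivAt_baseMap hS hy).mfderiv]
    have : CompleteSpace (B × (B →L[ℝ] ℝ)) := FiniteDimensional.complete ℝ _
    exact isInvertible_of_bijective (V := E₁) (W := B × (B →L[ℝ] ℝ)) hb
  refine ⟨VectorField.mpullback I 𝓘(ℝ, B × (B →L[ℝ] ℝ)) (baseMap σ H Φ κ) V,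
    hV.mpullback_vectorField_preimage (hκ.contMDiffAt_baseMap hS hx) (hinv x hx) (n := ∞) le_rfl, ?_⟩
  have h2 : ∀ᶠ y : formCompatSet σ H Φ in 𝓝 x, y.1 ∈ κ.source :=
    continuous_subtype_val.continuousAt.eventually_mem (κ.open_source.mem_nhds hx)
  have h3 : ∀ᶠ y : formCompatSet σ H Φ in 𝓝 x, H y.1 = h (baseMap σ H Φ κ y) := by
    filter_upwards [h2, eventually_graph hx hg] with y hy1 hy2
    have : (baseMap σ H Φ κ y, s (baseMap σ H Φ κ y)) = κ y.1 := Prod.ext rfl hy2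
    simp only [h, this, Function.comp_apply, κ.left_inv hy1]
  have h4 : ∀ᶠ y : formCompatSet σ H Φ in 𝓝 x, ContDiffAt ℝ 1 h (baseMap σ H Φ κ y) :=
    (hκ.contMDiffAt_baseMap hS hx).continuousAt.eventually
      ((hh.of_le (m := 1) (by exact_mod_cast le_top)).eventually (by simp))
  filter_upwards [h2, h3.eventually_nhds, h4] with y hy1 hy3 hy4 u
  have h5 := hκ.hasMFDerivAt_baseMap hS hy1
  have h6 : HasMFDerivAt I 𝓘(ℝ, ℝ) (fun y : formCompatSet σ H Φ => H y.1) y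
      ((fderiv ℝ h (baseMap σ H Φ κ y)).comp
        ((ContinuousLinearMap.fst ℝ (B × (B →L[ℝ] ℝ)) U).comp (inclDeriv I I' κ y))) :=
    (HasMFDerivAt.comp y (hy4.differentiableAt (by simp)).hasFDerivAt.hasMFDerivAt
      h5).congr_of_eventuallyEq hy3
  have h7 : (inclDeriv I I' κ y (VectorField.mpullback I 𝓘(ℝ, B × (B →L[ℝ] ℝ))
      (baseMap σ H Φ κ) V y)).1 = flat.symm (fderiv ℝ h (baseMap σ H Φ κ y)) := by
    have h8 := (hinv y hy1).self_apply_inverse (V (baseMap σ H Φ κ y))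
    rw [h5.mfderiv] at h8
    rw [VectorField.mpullback_apply, h5.mfderiv]
    exact h8
  rw [hκ.pullback_eq y hy1, h7, ← hflat, ContinuousLinearEquiv.apply_symm_apply,
    differential, h6.mfderiv]
  rfl

/-- The vector field of the dynamics on `W_c`. The local solutions agree on overlaps because the form
is nondegenerate on `W_c`. -/
theorem exists_smooth_solution [CompleteSpace E₁] [IsManifold I ∞ (formCompatSet σ H Φ)]
    (hreg : ∀ y ∈ formCompatSet σ H Φ, ∃ κ : OpenPartialHomeomorph Y (PhaseSpace B U),
      y ∈ κ.source ∧ IsRegularChart σ H Φ κ)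
    (hS : Manifold.IsSmoothEmbedding I I' ∞ (Subtype.val : formCompatSet σ H Φ → Y)) :
    ∃ X : ∀ y : formCompatSet σ H Φ, TangentSpace I y,
      ContMDiff I I.tangent ∞ (fun y => (⟨y, X y⟩ : TangentBundle I (formCompatSet σ H Φ))) ∧
      ∀ (y : formCompatSet σ H Φ) (v : TangentSpace I y), (∀ u : TangentSpace I y,
        σ.pullback (I := I) (Subtype.val : formCompatSet σ H Φ → Y) y ![v, u] =
          differential I (fun y : formCompatSet σ H Φ => H y.1) y u) ↔ v = X y := by
  have huniq : ∀ (y : formCompatSet σ H Φ) (v v' : TangentSpace I y),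
      (∀ u : TangentSpace I y, σ.pullback (I := I) (Subtype.val : formCompatSet σ H Φ → Y) y ![v, u]
        = σ.pullback (I := I) (Subtype.val : formCompatSet σ H Φ → Y) y ![v', u]) → v = v' := by
    intro y v v' h
    obtain ⟨κ, hy, hκ⟩ := hreg y.1 y.2
    rw [← sub_eq_zero]
    refine hκ.pullback_nondegenerate hS y hy _ fun u => ?_
    have := h u
    rw [hκ.pullback_eq y hy, hκ.pullback_eq y hy, ← sub_eq_zero] at this
    rw [hκ.pullback_eq y hy, map_sub, ← this]
    simp [canPairing]
    ring
  have hex : ∀ y : formCompatSet σ H Φ, ∃ v : TangentSpace I y, ∀ u : TangentSpace I y,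
      σ.pullback (I := I) (Subtype.val : formCompatSet σ H Φ → Y) y ![v, u] =
        differential I (fun y : formCompatSet σ H Φ => H y.1) y u := by
    intro y
    obtain ⟨κ, hy, hκ⟩ := hreg y.1 y.2
    obtain ⟨X, -, hX⟩ := hκ.exists_local_solution hS y hy
    exact ⟨X y, hX.self_of_nhds⟩
  choose X hX using hex
  refine ⟨X, fun y => ?_, fun y v => ⟨fun h => huniq y v (X y) fun u => by rw [h, hX], ?_⟩⟩
  · obtain ⟨κ, hy, hκ⟩ := hreg y.1 y.2
    obtain ⟨X', hX's, hX'⟩ := hκ.exists_local_solution hS y hy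
    refine hX's.congr_of_eventuallyEq ?_
    filter_upwards [hX'] with z hz
    rw [huniq z (X z) (X' z) fun u => by rw [hX, hz]]
  · rintro rfl
    exact hX y

end VectorField

/-! ### Slice charts of embedded submanifolds -/

section SliceCharts

variable {E' : Type*} [NormedAddCommGroup E'] [NormedSpace ℝ E']
  {H' : Type*} [TopologicalSpace H'] (I' : ModelWithCorners ℝ E' H')
  {Y : Type*} [TopologicalSpace Y] [ChartedSpace H' Y]
  {Q U : Type*} [NormedAddCommGroup Q] [NormedSpace ℝ Q]
  [NormedAddCommGroup U] [NormedSpace ℝ U] {r : ℕ}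

/-- A smooth chart of `Y` with values in `Q × U`, in which the set `S` is given by `u = 0`. -/
structure IsSliceChart (S : Set Y) (ψ : OpenPartialHomeomorph Y (Q × U)) : Prop where
  contMDiffOn : ContMDiffOn I' 𝓘(ℝ, Q × U) ∞ ψ ψ.source
  contMDiffOn_symm : ContMDiffOn 𝓘(ℝ, Q × U) I' ∞ ψ.symm ψ.target
  mem_iff : ∀ y ∈ ψ.source, y ∈ S ↔ (ψ y).2 = 0

variable {I'} {S : Set Y} {ψ ψ' : OpenPartialHomeomorph Y (Q × U)}

open scoped Classical in
/-- The chart of `S` induced by a slice chart. The point `x` only serves as a junk value. -/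
def IsSliceChart.chart (hψ : IsSliceChart I' S ψ) (e₀ : Q ≃L[ℝ] EuclideanSpace ℝ (Fin r)) (x : S) :
    OpenPartialHomeomorph S (EuclideanSpace ℝ (Fin r)) where
  toFun y := e₀ (ψ y.1).1
  invFun z := if h : ψ.symm (e₀.symm z, 0) ∈ S then ⟨_, h⟩ else x
  source := {y | y.1 ∈ ψ.source}
  target := {z | (e₀.symm z, 0) ∈ ψ.target}
  map_source' := by
    intro y hy
    have h : (ψ y.1).2 = 0 := (hψ.mem_iff y.1 hy).1 y.2
    have h1 : ((ψ y.1).1, (0 : U)) = ψ y.1 := Prod.ext rfl h.symm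
    simp only [mem_ofPred_eq, ContinuousLinearEquiv.symm_apply_apply, h1]
    exact ψ.map_source hy
  map_target' := by
    intro z (hz : (e₀.symm z, 0) ∈ ψ.target)
    have h : ψ.symm (e₀.symm z, 0) ∈ S :=
      (hψ.mem_iff _ (ψ.map_target hz)).2 (by rw [ψ.right_inv hz])
    simp only [h, dif_pos]
    exact ψ.map_target hz
  left_inv' := by
    intro y hy
    have h : (ψ y.1).2 = 0 := (hψ.mem_iff y.1 hy).1 y.2
    have h1 : ((ψ y.1).1, (0 : U)) = ψ y.1 := Prod.ext rfl h.symm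
    simp only [ContinuousLinearEquiv.symm_apply_apply, h1, ψ.left_inv hy, Subtype.coe_prop, dif_pos]
  right_inv' := by
    intro z (hz : (e₀.symm z, 0) ∈ ψ.target)
    have h : ψ.symm (e₀.symm z, 0) ∈ S :=
      (hψ.mem_iff _ (ψ.map_target hz)).2 (by rw [ψ.right_inv hz])
    simp only [h, dif_pos, ψ.right_inv hz, ContinuousLinearEquiv.apply_symm_apply]
  open_source := ψ.open_source.preimage continuous_subtype_val
  open_target := ψ.open_target.preimage (by fun_prop)
  continuousOn_toFun := by
    have h : ContinuousOn (fun y : S => ψ y.1) {y | y.1 ∈ ψ.source} :=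
      ψ.continuousOn.comp continuous_subtype_val.continuousOn fun y hy => hy
    exact e₀.continuous.comp_continuousOn (continuous_fst.comp_continuousOn h)
  continuousOn_invFun := by
    rw [Topology.IsInducing.subtypeVal.continuousOn_iff]
    have h : ContinuousOn (fun z => ψ.symm (e₀.symm z, (0 : U))) {z | (e₀.symm z, 0) ∈ ψ.target} :=
      ψ.symm.continuousOn.comp (by fun_prop) fun z hz => hz
    refine h.congr fun z (hz : (e₀.symm z, 0) ∈ ψ.target) => ?_
    have h : ψ.symm (e₀.symm z, 0) ∈ S :=
      (hψ.mem_iff _ (ψ.map_target hz)).2 (by rw [ψ.right_inv hz])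
    simp only [Function.comp_apply, h, dif_pos]

theorem IsSliceChart.coe_chart_symm (hψ : IsSliceChart I' S ψ)
    (e₀ : Q ≃L[ℝ] EuclideanSpace ℝ (Fin r)) (x : S) {z : EuclideanSpace ℝ (Fin r)}
    (hz : (e₀.symm z, 0) ∈ ψ.target) :
    ((hψ.chart e₀ x).symm z : Y) = ψ.symm (e₀.symm z, 0) := by
  have h : ψ.symm (e₀.symm z, 0) ∈ S :=
    (hψ.mem_iff _ (ψ.map_target hz)).2 (by rw [ψ.right_inv hz])
  simp [IsSliceChart.chart, h]

theorem IsSliceChart.contDiffOn_transition (hψ : IsSliceChart I' S ψ) (hψ' : IsSliceChart I' S ψ')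
    (e₀ : Q ≃L[ℝ] EuclideanSpace ℝ (Fin r)) (x x' : S) :
    ContDiffOn ℝ ∞ ((hψ.chart e₀ x).symm.trans (hψ'.chart e₀ x'))
      ((hψ.chart e₀ x).symm.trans (hψ'.chart e₀ x')).source := by
  have h1 : ∀ z ∈ ((hψ.chart e₀ x).symm.trans (hψ'.chart e₀ x')).source,
      (e₀.symm z, 0) ∈ ψ.target ∧ ψ.symm (e₀.symm z, 0) ∈ ψ'.source := by
    rintro z ⟨hz1, hz2⟩
    refine ⟨hz1, ?_⟩
    have h2 : ((hψ.chart e₀ x).symm z : Y) ∈ ψ'.source := hz2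
    rwa [hψ.coe_chart_symm e₀ x hz1] at h2
  intro z hz
  have h2 : ContMDiffAt 𝓘(ℝ, Q × U) I' ∞ ψ.symm (e₀.symm z, 0) :=
    hψ.contMDiffOn_symm.contMDiffAt (ψ.open_target.mem_nhds (h1 z hz).1)
  have h3 : ContMDiffAt I' 𝓘(ℝ, Q × U) ∞ ψ' (ψ.symm (e₀.symm z, 0)) :=
    hψ'.contMDiffOn.contMDiffAt (ψ'.open_source.mem_nhds (h1 z hz).2)
  have h4 : ContDiffAt ℝ ∞ (ψ' ∘ ψ.symm) (e₀.symm z, 0) :=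
    contMDiffAt_iff_contDiffAt.1 (h3.comp _ h2)
  have h5 : ContDiffAt ℝ ∞ (fun z => e₀ ((ψ' ∘ ψ.symm) (e₀.symm z, 0)).1) z :=
    e₀.contDiff.contDiffAt.comp z (contDiffAt_fst.comp z
      (ContDiffAt.comp (g := ψ' ∘ ψ.symm) z h4 (e₀.symm.contDiff.contDiffAt.prodMk contDiffAt_const)))
  refine h5.contDiffWithinAt.congr (fun z hz => ?_) ?_
  all_goals
    change e₀ (ψ' ((hψ.chart e₀ x).symm _ : Y)).1 = _
    rw [hψ.coe_chart_symm e₀ x (h1 _ hz).1]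
    rfl

/-- A set with slice charts at all its points is an embedded submanifold. -/
theorem exists_isSmoothEmbedding_of_isSliceChart [I'.Boundaryless] [IsManifold I' ∞ Y]
    (e₀ : Q ≃L[ℝ] EuclideanSpace ℝ (Fin r))
    (hS : ∀ x ∈ S, ∃ ψ : OpenPartialHomeomorph Y (Q × U), x ∈ ψ.source ∧ IsSliceChart I' S ψ) :
    ∃ _ : ChartedSpace (EuclideanSpace ℝ (Fin r)) S, IsManifold (𝓡 r) ∞ S ∧
      Manifold.IsSmoothEmbedding (𝓡 r) I' ∞ (Subtype.val : S → Y) := by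
  choose ψ hx hψ using fun x : S => hS x.1 x.2
  let c : ChartedSpace (EuclideanSpace ℝ (Fin r)) S :=
    { atlas := range fun x => (hψ x).chart e₀ x
      chartAt := fun x => (hψ x).chart e₀ x
      mem_chart_source := hx
      chart_mem_atlas := fun x => ⟨x, rfl⟩ }
  have hM : IsManifold (𝓡 r) ∞ S := by
    refine isManifold_of_contDiffOn _ _ _ ?_
    rintro _ _ ⟨x, rfl⟩ ⟨x', rfl⟩
    simpa using! (hψ x).contDiffOn_transition (hψ x') e₀ x x'
  refine ⟨c, hM, ⟨?_, Topology.IsEmbedding.subtypeVal⟩⟩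
  have key : Manifold.IsImmersionOfComplement U (𝓡 r) I' ∞ (Subtype.val : S → Y) := by
    intro x
    have hd : (ψ x).MDifferentiable I' 𝓘(ℝ, Q × U) :=
      ⟨(hψ x).contMDiffOn.mdifferentiableOn (by simp),
        (hψ x).contMDiffOn_symm.mdifferentiableOn (by simp)⟩
    -- `A` only serves to give the slice chart values in the model space of `Y`
    let A : (Q × U) ≃L[ℝ] E' := (hd.mfderiv (hx x)).symm
    let φ : OpenPartialHomeomorph Y H' := (ψ x).trans
      (A.toHomeomorph.trans I'.toHomeomorph.symm).toOpenPartialHomeomorph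
    have hφs : φ.source = (ψ x).source := by simp [φ]
    have hφ : ∀ y, I' (φ y) = A (ψ x y) := fun y => I'.toHomeomorph.apply_symm_apply _
    have hφt : φ.target = {h | A.symm (I' h) ∈ (ψ x).target} := by
      ext h
      simp [φ]
    have hmax : φ ∈ IsManifold.maximalAtlas I' ∞ Y := by
      refine φ.mem_maximalAtlas_of_contMDiffOn ?_ ?_
      · rw [hφs]
        have h1 : ContMDiffOn I' 𝓘(ℝ, E') ∞ (fun y => A (ψ x y)) (ψ x).source :=
          A.contDiff.contMDiff.comp_contMDiffOn (hψ x).contMDiffOn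
        exact I'.contMDiffOn_symm.comp h1 fun y _ => by rw [I'.range_eq_univ]; trivial
      · rw [hφt]
        have h1 : ContMDiff I' 𝓘(ℝ, Q × U) ∞ (fun h => A.symm (I' h)) :=
          A.symm.contDiff.contMDiff.comp I'.contMDiff
        exact (hψ x).contMDiffOn_symm.comp h1.contMDiffOn fun h hh => hh
    refine Manifold.IsImmersionAtOfComplement.mk_of_continuousAt continuous_subtype_val.continuousAt
      ((e₀.symm.prodCongr (ContinuousLinearEquiv.refl ℝ U)).trans A) ((hψ x).chart e₀ x) φ (hx x)
      (by rw [hφs]; exact hx x) (IsManifold.chart_mem_maximalAtlas x) hmax ?_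
    intro z hz
    have hz' : (e₀.symm z, 0) ∈ (ψ x).target := by
      have h2 : z ∈ ((hψ x).chart e₀ x).target := by simpa using hz
      exact h2
    change I' (φ (((hψ x).chart e₀ x).symm z : Y)) = A (e₀.symm z, 0)
    rw [hφ, (hψ x).coe_chart_symm e₀ x hz', (ψ x).right_inv hz']
  exact key.isImmersion

/-- A chart in which `S` is locally the graph of a smooth function gives a slice chart. -/
theorem exists_isSliceChart_of_graph {κ : OpenPartialHomeomorph Y (Q × U)}
    (hκ : ContMDiffOn I' 𝓘(ℝ, Q × U) ∞ κ κ.source)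
    (hκ' : ContMDiffOn 𝓘(ℝ, Q × U) I' ∞ κ.symm κ.target) {x : Y} (hx : x ∈ κ.source) {s : Q → U}
    (hs : ∀ᶠ z in 𝓝 (κ x).1, ContDiffAt ℝ ∞ s z)
    (hg : ∀ᶠ w in 𝓝 (κ x), w ∈ κ.target ∧ (κ.symm w ∈ S ↔ s w.1 = w.2)) :
    ∃ ψ : OpenPartialHomeomorph Y (Q × U), x ∈ ψ.source ∧ IsSliceChart I' S ψ := by
  obtain ⟨D, hD, hDo, hxD⟩ := eventually_nhds_iff.1 hs
  have hDx : ∀ᶠ w : Q × U in 𝓝 (κ x), w.1 ∈ D :=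
    continuous_fst.continuousAt.eventually_mem (hDo.mem_nhds hxD)
  obtain ⟨N, hN, hNo, hxN⟩ := eventually_nhds_iff.1 (hg.and hDx)
  have hsD : ContDiffOn ℝ ∞ s D := fun z hz => (hD z hz).contDiffWithinAt
  have hDU : IsOpen {w : Q × U | w.1 ∈ D} := hDo.preimage continuous_fst
  have hsD' : ContDiffOn ℝ ∞ (fun w : Q × U => s w.1) {w | w.1 ∈ D} :=
    hsD.comp contDiffOn_fst fun w hw => hw
  have h1 : ContDiffOn ℝ ∞ (fun w : Q × U => (w.1, w.2 - s w.1)) {w | w.1 ∈ D} :=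
    contDiffOn_fst.prodMk (contDiffOn_snd.sub hsD')
  have h2 : ContDiffOn ℝ ∞ (fun w : Q × U => (w.1, w.2 + s w.1)) {w | w.1 ∈ D} :=
    contDiffOn_fst.prodMk (contDiffOn_snd.add hsD')
  have hND : N ⊆ {w | w.1 ∈ D} := fun w hw => (hN w hw).2
  let shear : OpenPartialHomeomorph (Q × U) (Q × U) :=
    { toFun := fun w => (w.1, w.2 - s w.1)
      invFun := fun w => (w.1, w.2 + s w.1)
      source := N
      target := {w | w.1 ∈ D} ∩ (fun w : Q × U => (w.1, w.2 + s w.1)) ⁻¹' N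
      map_source' := fun w hw => ⟨show w.1 ∈ D from hND hw, by simpa using hw⟩
      map_target' := fun w hw => hw.2
      left_inv' := fun w _ => by simp
      right_inv' := fun w _ => by simp
      open_source := hNo
      open_target := h2.continuousOn.isOpen_inter_preimage hDU hNo
      continuousOn_toFun := h1.continuousOn.mono hND
      continuousOn_invFun := h2.continuousOn.mono inter_subset_left }
  refine ⟨κ.trans shear, ⟨hx, hxN⟩, ?_, ?_, ?_⟩
  · have h3 : ContMDiffOn 𝓘(ℝ, Q × U) 𝓘(ℝ, Q × U) ∞ shear N := (h1.mono hND).contMDiffOn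
    exact h3.comp (hκ.mono inter_subset_left) fun y hy => hy.2
  · have h3 : ContMDiffOn 𝓘(ℝ, Q × U) 𝓘(ℝ, Q × U) ∞ shear.symm shear.target :=
      (h2.mono inter_subset_left).contMDiffOn
    exact hκ'.comp (h3.mono inter_subset_left) fun y hy => hy.2
  · rintro y ⟨hy1, hy2⟩
    have h4 := (hN (κ y) hy2).1.2
    rw [κ.left_inv hy1] at h4
    rw [h4]
    change _ ↔ (κ y).2 - s (κ y).1 = 0
    rw [sub_eq_zero, eq_comm]

end SliceCharts

section Characterization

set_option synthInstance.maxHeartbeats 200000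

variable {E' : Type*} [NormedAddCommGroup E'] [NormedSpace ℝ E']
  {H' : Type*} [TopologicalSpace H'] {I' : ModelWithCorners ℝ E' H'} [I'.Boundaryless]
  {Y : Type*} [TopologicalSpace Y] [ChartedSpace H' Y] [IsManifold I' ∞ Y]
  (B U : Type*) [NormedAddCommGroup B] [NormedSpace ℝ B] [FiniteDimensional ℝ B]
  [NormedAddCommGroup U] [NormedSpace ℝ U] [FiniteDimensional ℝ U] {n : ℕ}
  {σ : DiffForm I' Y 2} {H : Y → ℝ} {Φ : Fin n → Y → ℝ}

/-- If the bordered Hessians are nondegenerate, `W_c` is a symplectic submanifold: it is locally a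
graph over `B × B^*`, and the form is the pullback of the canonical one. -/
theorem isSymplecticSubmanifold_of_regular
    (hreg : ∀ y ∈ formCompatSet σ H Φ, ∃ κ : OpenPartialHomeomorph Y (PhaseSpace B U),
      y ∈ κ.source ∧ IsRegularChart σ H Φ κ) :
    IsSymplecticSubmanifold σ (formCompatSet σ H Φ) := by
  obtain ⟨r, ⟨e₀⟩⟩ : ∃ r : ℕ, Nonempty ((B × (B →L[ℝ] ℝ)) ≃L[ℝ] EuclideanSpace ℝ (Fin r)) :=
    ⟨Module.finrank ℝ (B × (B →L[ℝ] ℝ)), ⟨ContinuousLinearEquiv.ofFinrankEq (by simp)⟩⟩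
  obtain ⟨c, hM, hS⟩ := exists_isSmoothEmbedding_of_isSliceChart (I' := I')
    (S := formCompatSet σ H Φ) (U := U) e₀ fun x hx => by
      obtain ⟨κ, hxκ, hκ⟩ := hreg x hx
      obtain ⟨s, hs, -, hg⟩ := hκ.exists_graph hxκ hx
      exact exists_isSliceChart_of_graph hκ.contMDiffOn hκ.contMDiffOn_symm hxκ hs hg
  have hloc : ∀ x : formCompatSet σ H Φ, ∃ f : formCompatSet σ H Φ → B × (B →L[ℝ] ℝ),
      ContMDiffAt (𝓡 r) 𝓘(ℝ, B × (B →L[ℝ] ℝ)) ∞ f x ∧ ∀ᶠ y in 𝓝 x,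
        σ.pullback (I := 𝓡 r) (Subtype.val : formCompatSet σ H Φ → Y) y =
        (canForm B).compContinuousLinearMap (mfderiv (𝓡 r) 𝓘(ℝ, B × (B →L[ℝ] ℝ)) f y) := by
    intro x
    obtain ⟨κ, hxκ, hκ⟩ := hreg x.1 x.2
    exact ⟨baseMap σ H Φ κ, hκ.contMDiffAt_baseMap hS hxκ, hκ.pullback_eventuallyEq hS hxκ⟩
  refine ⟨_, c, hM, hS, DiffForm.isSmooth_of_eventuallyEq_canForm hloc,
    DiffForm.d_eq_zero_of_eventuallyEq_canForm hloc, fun x u hu => ?_⟩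
  obtain ⟨κ, hxκ, hκ⟩ := hreg x.1 x.2
  exact hκ.pullback_nondegenerate hS x hxκ u hu

end Characterization

/-! ### Natural coordinates of higher tangent bundles -/

section ProductDerivative

variable {E : Type*} [NormedAddCommGroup E] [NormedSpace ℝ E]
  {H : Type*} [TopologicalSpace H] {I : ModelWithCorners ℝ E H}
  {X : Type*} [TopologicalSpace X] [ChartedSpace H X]
  {V W : Type*} [NormedAddCommGroup V] [NormedSpace ℝ V] [NormedAddCommGroup W] [NormedSpace ℝ W]
  {f : X → V × W} {x : X}

theorem fst_mfderiv (hf : MDifferentiableAt I 𝓘(ℝ, V × W) f x) (Y : TangentSpace I x) :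
    (mfderiv I 𝓘(ℝ, V × W) f x Y : V × W).1 = mfderiv I 𝓘(ℝ, V) (fun y => (f y).1) x Y :=
  (congrArg (fun A : E →L[ℝ] V => A Y) (HasMFDerivAt.comp x (hasFDerivAt_fst (𝕜 := ℝ) (E := V)
    (F := W) (p := f x)).hasMFDerivAt hf.hasMFDerivAt).mfderiv).symm

theorem snd_mfderiv (hf : MDifferentiableAt I 𝓘(ℝ, V × W) f x) (Y : TangentSpace I x) :
    (mfderiv I 𝓘(ℝ, V × W) f x Y : V × W).2 = mfderiv I 𝓘(ℝ, W) (fun y => (f y).2) x Y :=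
  (congrArg (fun A : E →L[ℝ] W => A Y) (HasMFDerivAt.comp x (hasFDerivAt_snd (𝕜 := ℝ) (E := V)
    (F := W) (p := f x)).hasMFDerivAt hf.hasMFDerivAt).mfderiv).symm

theorem mdifferentiableAt_snd_comp (hf : MDifferentiableAt I 𝓘(ℝ, V × W) f x) :
    MDifferentiableAt I 𝓘(ℝ, W) (fun y => (f y).2) x :=
  (HasMFDerivAt.comp x (hasFDerivAt_snd (𝕜 := ℝ) (E := V)
    (F := W) (p := f x)).hasMFDerivAt hf.hasMFDerivAt).mdifferentiableAt

end ProductDerivative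

section NaturalCoordinates

variable {E : Type*} [NormedAddCommGroup E] [NormedSpace ℝ E]
  {M : Type*} [TopologicalSpace M] [ChartedSpace E M] [IsManifold 𝓘(ℝ, E) ∞ M]
  {F : Type*} [NormedAddCommGroup F] [NormedSpace ℝ F]
  {G : Type*} [TopologicalSpace G] [ChartedSpace F G] [Group G] {k : ℕ}

theorem extChartAt_ht_apply (a₀ a : HigherTangent E M F G k) :
    extChartAt (htI E F G k) a₀ a =
      (Jet.coord (chartAt E a₀.1.base) a.1, chartAt F a₀.2.1 a.2.1, a.2.2) := rfl

theorem extChartAt_ht_symm (a₀ : HigherTangent E M F G k) (x : HigherTangentModel E F G k) :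
    (extChartAt (htI E F G k) a₀).symm x =
      ((jetChart k (chartAt E a₀.1.base) (chart_mem_atlas E a₀.1.base)).symm x.1,
        (chartAt F a₀.2.1).symm x.2.1, x.2.2) := rfl

theorem mem_extChartAt_ht_source {a₀ a : HigherTangent E M F G k} :
    a ∈ (extChartAt (htI E F G k) a₀).source ↔
      a.1.base ∈ (chartAt E a₀.1.base).source ∧ a.2.1 ∈ (chartAt F a₀.2.1).source := by
  rw [extChartAt_prod, PartialEquiv.prod_source, extChartAt_prod, PartialEquiv.prod_source,
    extChartAt_source, extChartAt_source, extChartAt_source, chartAt_self_eq]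
  simp only [mem_prod, OpenPartialHomeomorph.refl_source, mem_univ, and_true]
  rfl

/-- The derivative of a jet chart maps the tail of the coordinates of a jet in the preferred chart to
the tail of the coordinates of the jet. -/
theorem mfderiv_extChartAt_jet (j₀ : Jet E M k) (j : Jet E M (k + 1))
    (hj : j.base ∈ (chartAt E j₀.base).source) :
    (mfderiv 𝓘(ℝ, Fin (k + 1) → E) 𝓘(ℝ, Fin (k + 1) → E)
      (extChartAt 𝓘(ℝ, Fin (k + 1) → E) j₀) (Jet.proj k j)
      (fun i : Fin (k + 1) => Jet.coord (chartAt E (Jet.proj k j).base) j i.succ :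
        Fin (k + 1) → E) : Fin (k + 1) → E) =
      fun i => Jet.coord (chartAt E j₀.base) j i.succ := by
  set e := chartAt E (Jet.proj k j).base
  set e' := chartAt E j₀.base
  have hb := Jet.base_proj j
  have he : e ∈ atlas E M := chart_mem_atlas E _
  have he' : e' ∈ atlas E M := chart_mem_atlas E _
  have hj1 : j.base ∈ e.source := by rw [← hb]; exact mem_chart_source E _
  have hjp : Jet.proj k j ∈ (chartAt (Fin (k + 1) → E) j₀).source := by
    change (Jet.proj k j).base ∈ e'.source
    rwa [hb]
  have h0 : Jet.coord e j 0 = e j.base := Jet.coord_zero he hj1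
  have hq : Jet.coord e j 0 ∈ (e.symm.trans e').source := by
    rw [h0]
    exact ⟨e.map_source hj1, by simpa [e.left_inv hj1] using hj⟩
  have hc : (fun i : Fin (k + 1) => Jet.coord e j i.castSucc) = Jet.coord e (Jet.proj k j) :=
    funext fun i => (Jet.coord_proj he j hj1 i).symm
  have h1 : extChartAt 𝓘(ℝ, Fin (k + 1) → E) j₀ ∘
      (extChartAt 𝓘(ℝ, Fin (k + 1) → E) (Jet.proj k j)).symm
        =ᶠ[𝓝 (Jet.coord e (Jet.proj k j))] jetMap k (e' ∘ e.symm) := by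
    have ho : IsOpen {q : Fin (k + 1) → E | q 0 ∈ (e.symm.trans e').source} :=
      (e.symm.trans e').open_source.preimage (continuous_apply 0)
    have hm : Jet.coord e (Jet.proj k j) ∈
        {q : Fin (k + 1) → E | q 0 ∈ (e.symm.trans e').source} := by
      rw [← hc]; exact hq
    filter_upwards [ho.mem_nhds hm] with q hq
    exact coord_jetChart_symm he he' hq
  have h2 := fderiv_comp_extChartAt_symm
    (mdifferentiableAt_extChartAt (I := 𝓘(ℝ, Fin (k + 1) → E)) hjp)
  rw [← h2]
  have h3 : fderiv ℝ (extChartAt 𝓘(ℝ, Fin (k + 1) → E) j₀ ∘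
      (extChartAt 𝓘(ℝ, Fin (k + 1) → E) (Jet.proj k j)).symm)
      (extChartAt 𝓘(ℝ, Fin (k + 1) → E) (Jet.proj k j) (Jet.proj k j)) =
      fderiv ℝ (jetMap k (e' ∘ e.symm)) (fun i => Jet.coord e j i.castSucc) := by
    rw [hc]
    exact h1.fderiv_eq
  rw [h3]
  funext i
  refine (fderiv_jetMap (e.symm.trans e').open_source (contDiffOn_chart_transition he he')
    hq i).trans ?_
  rw [← Jet.coord_eq_jetMap he he' hj1 hj]

theorem mfderiv_extChartAt_ht (a₀ a : HigherTangent E M F G k) [IsManifold 𝓘(ℝ, F) ∞ G]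
    (ha : a ∈ (extChartAt (htI E F G k) a₀).source) (Y : TangentSpace (htI E F G k) a) :
    (mfderiv (htI E F G k) 𝓘(ℝ, HigherTangentModel E F G k) (extChartAt (htI E F G k) a₀) a Y :
      HigherTangentModel E F G k) =
      (mfderiv 𝓘(ℝ, Fin (k + 1) → E) 𝓘(ℝ, Fin (k + 1) → E)
        (extChartAt 𝓘(ℝ, Fin (k + 1) → E) a₀.1) a.1 (Y : HigherTangentModel E F G k).1,
        mfderiv 𝓘(ℝ, F) 𝓘(ℝ, F) (extChartAt 𝓘(ℝ, F) a₀.2.1) a.2.1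
          (Y : HigherTangentModel E F G k).2.1, (Y : HigherTangentModel E F G k).2.2) := by
  have ha' := mem_extChartAt_ht_source.1 ha
  have h0 : MDifferentiableAt (htI E F G k) 𝓘(ℝ, HigherTangentModel E F G k)
      (extChartAt (htI E F G k) a₀) a :=
    mdifferentiableAt_extChartAt (by rwa [extChartAt_source] at ha)
  have h1 : MDifferentiableAt 𝓘(ℝ, Fin (k + 1) → E) 𝓘(ℝ, Fin (k + 1) → E)
      (extChartAt 𝓘(ℝ, Fin (k + 1) → E) a₀.1) a.1 := mdifferentiableAt_extChartAt ha'.1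
  have h2 : MDifferentiableAt 𝓘(ℝ, F) 𝓘(ℝ, F) (extChartAt 𝓘(ℝ, F) a₀.2.1) a.2.1 :=
    mdifferentiableAt_extChartAt ha'.2
  have h3 : MDifferentiableAt (htI E F G k) 𝓘(ℝ, F × (Fin k → LieAlg F G))
      (fun b => (extChartAt (htI E F G k) a₀ b).2) a :=
    mdifferentiableAt_snd_comp h0
  refine Prod.ext ?_ (Prod.ext ?_ ?_)
  · rw [fst_mfderiv h0]
    exact congrArg (fun A : HigherTangentModel E F G k →L[ℝ] (Fin (k + 1) → E) => A Y)
      (HasMFDerivAt.comp a h1.hasMFDerivAt (hasMFDerivAt_fst a)).mfderiv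
  · rw [snd_mfderiv h0, fst_mfderiv h3]
    exact congrArg (fun A : HigherTangentModel E F G k →L[ℝ] F => A Y)
      (HasMFDerivAt.comp a h2.hasMFDerivAt
        (HasMFDerivAt.comp a (hasMFDerivAt_fst a.2) (hasMFDerivAt_snd a))).mfderiv
  · rw [snd_mfderiv h0, snd_mfderiv h3]
    exact congrArg (fun A : HigherTangentModel E F G k →L[ℝ] (Fin k → LieAlg F G) => A Y)
      (HasMFDerivAt.comp a (hasMFDerivAt_snd a.2) (hasMFDerivAt_snd a)).mfderiv

theorem htProj_mem_source {a₀ a : HigherTangent E M F G (k + 1)}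
    (ha : a ∈ (extChartAt (htI E F G (k + 1)) a₀).source) :
    htProj E M F G k a ∈ (extChartAt (htI E F G k) (htProj E M F G k a₀)).source := by
  rw [mem_extChartAt_ht_source] at ha ⊢
  refine ⟨?_, ha.2⟩
  change (Jet.proj k a.1).base ∈ (chartAt E (Jet.proj k a₀.1).base).source
  rw [Jet.base_proj, Jet.base_proj]
  exact ha.1

/-- In natural coordinates, the projection forgets the top-order coordinates. -/
theorem extChartAt_htProj {a₀ a : HigherTangent E M F G (k + 1)}
    (ha : a ∈ (extChartAt (htI E F G (k + 1)) a₀).source) :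
    extChartAt (htI E F G k) (htProj E M F G k a₀) (htProj E M F G k a) =
      (fun i => (extChartAt (htI E F G (k + 1)) a₀ a).1 i.castSucc,
        (extChartAt (htI E F G (k + 1)) a₀ a).2.1,
        fun i => (extChartAt (htI E F G (k + 1)) a₀ a).2.2 i.castSucc) := by
  have ha' := mem_extChartAt_ht_source.1 ha
  refine Prod.ext ?_ rfl
  change Jet.coord (chartAt E (Jet.proj k a₀.1).base) (Jet.proj k a.1) =
    fun i : Fin (k + 1) => Jet.coord (chartAt E a₀.1.base) a.1 i.castSucc
  rw [Jet.base_proj]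
  exact funext fun i => Jet.coord_proj (chart_mem_atlas E _) a.1 ha'.1 i

variable [LieGroup 𝓘(ℝ, F) ∞ G]

/-- Left translation of the Lie algebra to the point `g`, expressed in the preferred chart at
`g₀`. -/
def leftTriv (g₀ g : G) (ξ : LieAlg F G) : F :=
  mfderiv 𝓘(ℝ, F) 𝓘(ℝ, F) (extChartAt 𝓘(ℝ, F) g₀) g
    (mulInvariantVectorField (I := 𝓘(ℝ, F)) (ξ : GroupLieAlgebra 𝓘(ℝ, F) G) g)

/-- The coordinate expression of the embedding `T^{k+1} (M × G) → T (T^k (M × G))` in natural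
coordinates. -/
def embedCoord (g₀ : G) (x : HigherTangentModel E F G (k + 1)) : HigherTangentModel E F G k :=
  (fun i => x.1 i.succ, leftTriv g₀ ((chartAt F g₀).symm x.2.1) (x.2.2 0), fun i => x.2.2 i.succ)

theorem mfderiv_extChartAt_htEmbed {a₀ a : HigherTangent E M F G (k + 1)}
    (ha : a ∈ (extChartAt (htI E F G (k + 1)) a₀).source) :
    (mfderiv (htI E F G k) 𝓘(ℝ, HigherTangentModel E F G k)
      (extChartAt (htI E F G k) (htProj E M F G k a₀)) (htProj E M F G k a) (htEmbed a) :
        HigherTangentModel E F G k) =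
      embedCoord a₀.2.1 (extChartAt (htI E F G (k + 1)) a₀ a) := by
  have ha' := mem_extChartAt_ht_source.1 ha
  rw [mfderiv_extChartAt_ht _ _ (htProj_mem_source ha)]
  refine Prod.ext ?_ (Prod.ext ?_ rfl)
  · refine (mfderiv_extChartAt_jet (Jet.proj k a₀.1) a.1 ?_).trans ?_
    · rw [Jet.base_proj]
      exact ha'.1
    · rw [Jet.base_proj]
      rfl
  · change _ = leftTriv a₀.2.1 ((chartAt F a₀.2.1).symm (chartAt F a₀.2.1 a.2.1)) (a.2.2 0)
    rw [(chartAt F a₀.2.1).left_inv ha'.2]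
    rfl

end NaturalCoordinates

/-! ### The left trivialization in coordinates -/

section LeftTrivialization

variable {F : Type*} [NormedAddCommGroup F] [NormedSpace ℝ F]
  {G : Type*} [TopologicalSpace G] [ChartedSpace F G] [Group G] [LieGroup 𝓘(ℝ, F) ∞ G]

/-- The group multiplication in the preferred charts at `g₀` and at the unit. -/
def mulCoord (g₀ : G) (y z : F) : F :=
  extChartAt 𝓘(ℝ, F) g₀ ((chartAt F g₀).symm y * (extChartAt 𝓘(ℝ, F) (1 : G)).symm z)

/-- The left trivialization in coordinates is a partial derivative of the multiplication. -/
theorem leftTriv_eq_fderiv {g₀ g : G} (hg : g ∈ (chartAt F g₀).source) (ξ : LieAlg F G) :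
    leftTriv g₀ g ξ =
      fderiv ℝ (mulCoord g₀ (chartAt F g₀ g)) (extChartAt 𝓘(ℝ, F) (1 : G) 1) (ξ : F) := by
  have h1 : MDifferentiableAt 𝓘(ℝ, F) 𝓘(ℝ, F) (g * ·) (1 : G) :=
    (contMDiff_mul_left (I := 𝓘(ℝ, F)) (n := ∞)).mdifferentiableAt (by simp)
  have h2 : MDifferentiableAt 𝓘(ℝ, F) 𝓘(ℝ, F) (extChartAt 𝓘(ℝ, F) g₀) (g * 1) :=
    mdifferentiableAt_extChartAt (by rwa [mul_one])
  have h3 := mfderiv_comp (1 : G) h2 h1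
  have h4 := fderiv_comp_extChartAt_symm (h2.comp (1 : G) h1)
  rw [h3] at h4
  have h5 : (extChartAt 𝓘(ℝ, F) g₀ ∘ (g * ·)) ∘ (extChartAt 𝓘(ℝ, F) (1 : G)).symm =
      mulCoord g₀ (chartAt F g₀ g) := by
    funext z
    simp [mulCoord, (chartAt F g₀).left_inv hg]
  rw [h5] at h4
  rw [h4, leftTriv]
  change mfderiv 𝓘(ℝ, F) 𝓘(ℝ, F) (extChartAt 𝓘(ℝ, F) g₀) g _ =
    mfderiv 𝓘(ℝ, F) 𝓘(ℝ, F) (extChartAt 𝓘(ℝ, F) g₀) (g * 1) _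
  rw [mul_one]
  rfl

theorem leftTriv_chartAt_symm {g₀ : G} {y : F} (hy : y ∈ (chartAt F g₀).target) (ξ : LieAlg F G) :
    leftTriv g₀ ((chartAt F g₀).symm y) ξ =
      fderiv ℝ (mulCoord g₀ y) (extChartAt 𝓘(ℝ, F) (1 : G) 1) (ξ : F) := by
  rw [leftTriv_eq_fderiv ((chartAt F g₀).map_target hy), (chartAt F g₀).right_inv hy]

theorem contDiffOn_fderiv_mulCoord (g₀ : G) :
    ContDiffOn ℝ ∞ (fun y => fderiv ℝ (mulCoord g₀ y) (extChartAt 𝓘(ℝ, F) (1 : G) 1))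
      (chartAt F g₀).target := by
  intro y hy
  refine ContDiffAt.contDiffWithinAt ?_
  refine ContDiffAt.fderiv (n := ∞) (m := ∞) ?_ contDiffAt_const le_rfl
  rw [← contMDiffAt_iff_contDiffAt]
  have h1 : ContMDiffAt 𝓘(ℝ, F) 𝓘(ℝ, F) ∞ (chartAt F g₀).symm y :=
    (contMDiffOn_chart_symm (I := 𝓘(ℝ, F)) (n := ∞)).contMDiffAt
      ((chartAt F g₀).open_target.mem_nhds hy)
  have h2 : ContMDiffAt 𝓘(ℝ, F) 𝓘(ℝ, F) ∞ (extChartAt 𝓘(ℝ, F) (1 : G)).symm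
      (extChartAt 𝓘(ℝ, F) (1 : G) 1) :=
    (contMDiffOn_extChartAt_symm (I := 𝓘(ℝ, F)) (n := ∞) (1 : G)).contMDiffAt
      (extChartAt_target_mem_nhds (1 : G))
  have hp : (chartAt F g₀).symm y * (extChartAt 𝓘(ℝ, F) (1 : G)).symm
      (extChartAt 𝓘(ℝ, F) (1 : G) 1) = (chartAt F g₀).symm y := by simp
  have h3 : ContMDiffAt 𝓘(ℝ, F) 𝓘(ℝ, F) ∞ (extChartAt 𝓘(ℝ, F) g₀)
      ((chartAt F g₀).symm y * (extChartAt 𝓘(ℝ, F) (1 : G)).symm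
        (extChartAt 𝓘(ℝ, F) (1 : G) 1)) := by
    rw [hp]
    exact contMDiffAt_extChartAt' ((chartAt F g₀).map_target hy)
  have h4 : ContMDiffAt 𝓘(ℝ, F × F) 𝓘(ℝ, F) ∞ (fun p : F × F => (chartAt F g₀).symm p.1)
      (y, extChartAt 𝓘(ℝ, F) (1 : G) 1) :=
    ContMDiffAt.comp (y, extChartAt 𝓘(ℝ, F) (1 : G) 1) h1 contDiffAt_fst.contMDiffAt
  have h5 : ContMDiffAt 𝓘(ℝ, F × F) 𝓘(ℝ, F) ∞
      (fun p : F × F => (extChartAt 𝓘(ℝ, F) (1 : G)).symm p.2)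
      (y, extChartAt 𝓘(ℝ, F) (1 : G) 1) :=
    ContMDiffAt.comp (y, extChartAt 𝓘(ℝ, F) (1 : G) 1) h2 contDiffAt_snd.contMDiffAt
  exact ContMDiffAt.comp (y, extChartAt 𝓘(ℝ, F) (1 : G) 1) h3 (h4.mul h5)

theorem injective_leftTriv {g₀ g : G} (hg : g ∈ (chartAt F g₀).source) {ξ : LieAlg F G}
    (hξ : leftTriv g₀ g ξ = 0) : ξ = 0 := by
  have h1 : mulInvariantVectorField (I := 𝓘(ℝ, F)) (ξ : GroupLieAlgebra 𝓘(ℝ, F) G) g = 0 := by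
    have h2 := isInvertible_mfderiv_extChartAt (I := 𝓘(ℝ, F)) (x := g₀) (y := g)
      (by rwa [extChartAt_source])
    exact h2.injective (hξ.trans (map_zero _).symm)
  have hm : ∀ (a b : G), MDifferentiableAt 𝓘(ℝ, F) 𝓘(ℝ, F) (a * ·) b := fun a b =>
    (contMDiff_mul_left (I := 𝓘(ℝ, F)) (n := ∞)).mdifferentiableAt (by simp)
  have h3 := mfderiv_comp (1 : G) (hm g⁻¹ (g * 1)) (hm g 1)
  have h4 : (g⁻¹ * ·) ∘ (g * ·) = (id : G → G) := by ext x; simp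
  rw [h4, mfderiv_id] at h3
  have h5 := congrArg (fun A : F →L[ℝ] F => A (ξ : F)) h3
  exact h5.trans ((congrArg (fun v : F => (mfderiv 𝓘(ℝ, F) 𝓘(ℝ, F) (g⁻¹ * ·) (g * 1) : F →L[ℝ] F) v)
    h1).trans (map_zero _))

end LeftTrivialization

section EmbedCoord

variable {E : Type*} [NormedAddCommGroup E] [NormedSpace ℝ E]
  {F : Type*} [NormedAddCommGroup F] [NormedSpace ℝ F]
  {G : Type*} [TopologicalSpace G] [ChartedSpace F G] [Group G] [LieGroup 𝓘(ℝ, F) ∞ G] {k : ℕ}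

theorem contDiffOn_embedCoord (g₀ : G) :
    ContDiffOn ℝ ∞ (embedCoord g₀ : HigherTangentModel E F G (k + 1) → HigherTangentModel E F G k)
      {x | x.2.1 ∈ (chartAt F g₀).target} := by
  have h1 : ContDiff ℝ ∞ (fun x : HigherTangentModel E F G (k + 1) =>
      (fun i : Fin (k + 1) => x.1 i.succ)) := by fun_prop
  have h2 : ContDiff ℝ ∞ (fun x : HigherTangentModel E F G (k + 1) =>
      (fun i : Fin k => x.2.2 i.succ)) := by fun_prop
  have h3 : ContDiff ℝ ∞ (fun x : HigherTangentModel E F G (k + 1) => (x.2.2 0 : LieAlg F G)) := by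
    fun_prop
  have h4 : ContDiffOn ℝ ∞ (fun x : HigherTangentModel E F G (k + 1) =>
      fderiv ℝ (mulCoord g₀ x.2.1) (extChartAt 𝓘(ℝ, F) (1 : G) 1) (x.2.2 0 : LieAlg F G))
      {x | x.2.1 ∈ (chartAt F g₀).target} := by
    refine ContDiffOn.clm_apply ?_ h3.contDiffOn
    exact (contDiffOn_fderiv_mulCoord g₀).comp (contDiff_fst.comp contDiff_snd).contDiffOn
      fun x hx => hx
  refine (h1.contDiffOn.prodMk (h4.prodMk h2.contDiffOn)).congr fun x hx => ?_
  exact Prod.ext rfl (Prod.ext (leftTriv_chartAt_symm hx _) rfl)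

/-- The coordinate expression of the embedding is linear in the variables `(q, ξ)`. -/
theorem embedCoord_add (g₀ : G) (x : HigherTangentModel E F G (k + 1))
    (hx : x.2.1 ∈ (chartAt F g₀).target) (q : Fin (k + 1 + 1) → E) (ξ : Fin (k + 1) → LieAlg F G)
    (t : ℝ) : embedCoord g₀ (x + t • ((q, 0, ξ) : HigherTangentModel E F G (k + 1))) =
      embedCoord g₀ x + t • (embedCoord g₀ (q, x.2.1, ξ) : HigherTangentModel E F G k) := by
  refine Prod.ext rfl (Prod.ext ?_ rfl)
  have h : (x + t • ((q, 0, ξ) : HigherTangentModel E F G (k + 1))).2.1 = x.2.1 := by simp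
  change leftTriv g₀ ((chartAt F g₀).symm (x + t • ((q, 0, ξ) :
    HigherTangentModel E F G (k + 1))).2.1) (x.2.2 0 + t • ξ 0) =
    leftTriv g₀ ((chartAt F g₀).symm x.2.1) (x.2.2 0) +
      t • leftTriv g₀ ((chartAt F g₀).symm x.2.1) (ξ 0)
  rw [h, leftTriv_chartAt_symm hx, leftTriv_chartAt_symm hx, leftTriv_chartAt_symm hx]
  exact (map_add _ _ _).trans (congrArg _ (map_smul _ _ _))

end EmbedCoord

/-! ### Splitting off the top-order coordinates and the momenta -/

section TopSplitting

variable {E : Type*} [NormedAddCommGroup E]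
  {F : Type*} [NormedAddCommGroup F] [NormedSpace ℝ F]
  {G : Type*} [TopologicalSpace G] [ChartedSpace F G] [Group G] {k : ℕ}

theorem embedCoord_eq_zero [LieGroup 𝓘(ℝ, F) ∞ G] {g₀ : G} {y : F} (hy : y ∈ (chartAt F g₀).target)
    {q : Fin (k + 1 + 1) → E} {ξ : Fin (k + 1) → LieAlg F G}
    (h : (embedCoord g₀ (q, y, ξ) : HigherTangentModel E F G k) = 0) :
    (∀ i : Fin (k + 1), q i.succ = 0) ∧ ξ = 0 := by
  have h1 := congrArg Prod.fst h
  have h2 := congrArg (fun x : HigherTangentModel E F G k => x.2.1) h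
  have h3 := congrArg (fun x : HigherTangentModel E F G k => x.2.2) h
  refine ⟨fun i => congrFun h1 i, funext fun i => ?_⟩
  induction i using Fin.cases with
  | zero => exact injective_leftTriv ((chartAt F g₀).map_target hy) h2
  | succ i => exact congrFun h3 i

variable [NormedSpace ℝ E]

variable (E F G k) in
/-- The splitting of the natural coordinates of `T^{k+1} (M × G)` into those of `T^k (M × G)` and
the top-order ones. -/
def topSplit : HigherTangentModel E F G (k + 1) ≃L[ℝ]
    HigherTangentModel E F G k × (E × LieAlg F G) where
  toFun x := ((fun i => x.1 i.castSucc, x.2.1, fun i => x.2.2 i.castSucc),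
    (x.1 (Fin.last (k + 1)), x.2.2 (Fin.last k)))
  invFun y := (Fin.snoc (α := fun _ => E) y.1.1 y.2.1, y.1.2.1,
    Fin.snoc (α := fun _ => LieAlg F G) y.1.2.2 y.2.2)
  map_add' _ _ := rfl
  map_smul' _ _ := rfl
  left_inv x := by
    refine Prod.ext ?_ (Prod.ext rfl ?_)
    · exact Fin.snoc_init_self x.1
    · exact Fin.snoc_init_self x.2.2
  right_inv y := by
    refine Prod.ext (Prod.ext ?_ (Prod.ext rfl ?_)) (Prod.ext ?_ ?_)
    · exact funext fun i => Fin.snoc_castSucc (α := fun _ => E) _ _ i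
    · exact funext fun i => Fin.snoc_castSucc (α := fun _ => LieAlg F G) _ _ i
    · exact Fin.snoc_last (α := fun _ => E) _ _
    · exact Fin.snoc_last (α := fun _ => LieAlg F G) _ _
  continuous_toFun := by fun_prop
  continuous_invFun := by
    refine Continuous.prodMk ?_ (Continuous.prodMk (by fun_prop) ?_)
    · exact Continuous.finSnoc (A := fun _ => E) (by fun_prop) (by fun_prop)
    · exact Continuous.finSnoc (A := fun _ => LieAlg F G) (by fun_prop) (by fun_prop)

variable (E F G k) in
/-- The natural coordinates of the Pontryagin bundle, split into base coordinates, momenta and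
top-order coordinates. -/
def phaseSplit : (HigherTangentModel E F G (k + 1) × (HigherTangentModel E F G k →L[ℝ] ℝ)) ≃L[ℝ]
    PhaseSpace (HigherTangentModel E F G k) (E × LieAlg F G) where
  toFun z := (((topSplit E F G k z.1).1, z.2), (topSplit E F G k z.1).2)
  invFun v := ((topSplit E F G k).symm (v.1.1, v.2), v.1.2)
  map_add' z z' := by simp
  map_smul' c z := by simp
  left_inv z := by simp
  right_inv v := by simp
  continuous_toFun := by fun_prop
  continuous_invFun := by fun_prop

variable (E F G k) in
/-- The natural coordinates of `T^{k+1} (M × G)` of a point of the Pontryagin bundle. -/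
def topJoin : PhaseSpace (HigherTangentModel E F G k) (E × LieAlg F G) →L[ℝ]
    HigherTangentModel E F G (k + 1) :=
  (topSplit E F G k).symm.toContinuousLinearMap.comp
    (((ContinuousLinearMap.fst ℝ _ _).comp (ContinuousLinearMap.fst ℝ _ _)).prod
      (ContinuousLinearMap.snd ℝ _ _))

theorem topJoin_apply (v : PhaseSpace (HigherTangentModel E F G k) (E × LieAlg F G)) :
    topJoin E F G k v = (topSplit E F G k).symm (v.1.1, v.2) := rfl

theorem surjective_topJoin : Function.Surjective (topJoin E F G k) := fun x =>
  ⟨(((topSplit E F G k x).1, 0), (topSplit E F G k x).2), by simp [topJoin_apply]⟩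

theorem topJoin_momentum (p : HigherTangentModel E F G k →L[ℝ] ℝ) :
    topJoin E F G k ((0, p), 0) = 0 := by
  rw [topJoin_apply]; exact map_zero (topSplit E F G k).symm

theorem topJoin_top (u : E × LieAlg F G) :
    topJoin E F G k (0, u) =
      ((Pi.single (Fin.last (k + 1)) u.1, 0, Pi.single (Fin.last k) u.2) :
        HigherTangentModel E F G (k + 1)) := by
  rw [topJoin_apply, ContinuousLinearEquiv.symm_apply_eq]
  refine Prod.ext (Prod.ext ?_ (Prod.ext rfl ?_)) (Prod.ext ?_ ?_)
  · funext i; simp [topSplit, Fin.castSucc_ne_last]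
  · funext i; simp [topSplit, Fin.castSucc_ne_last]
  · simp [topSplit]
  · simp [topSplit]

end TopSplitting

section PontryaginCharts

variable {E : Type*} [NormedAddCommGroup E] [NormedSpace ℝ E]
  {M : Type*} [TopologicalSpace M] [ChartedSpace E M] [IsManifold 𝓘(ℝ, E) ∞ M]
  {F : Type*} [NormedAddCommGroup F] [NormedSpace ℝ F]
  {G : Type*} [TopologicalSpace G] [ChartedSpace F G] [Group G] [LieGroup 𝓘(ℝ, F) ∞ G] {k : ℕ}

/-- The natural coordinates of the Pontryagin bundle around `w₀`. -/
def ponChart (w₀ : Pontryagin E M F G k) : OpenPartialHomeomorph (Pontryagin E M F G k)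
    (PhaseSpace (HigherTangentModel E F G k) (E × LieAlg F G)) :=
  (chartAt _ w₀).trans
    ((ponI E F G k).toHomeomorph.trans (phaseSplit E F G k).toHomeomorph).toOpenPartialHomeomorph

theorem ponChart_source (w₀ : Pontryagin E M F G k) :
    (ponChart w₀).source = (extChartAt (ponI E F G k) w₀).source := by
  simp [ponChart]

theorem ponChart_target (w₀ : Pontryagin E M F G k) :
    (ponChart w₀).target = (phaseSplit E F G k).symm ⁻¹' (extChartAt (ponI E F G k) w₀).target := by
  ext v
  simp [ponChart, preimage_comp]
  rfl

end PontryaginCharts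

/-! ### The presymplectic form in natural coordinates -/

/-- If `θ` is locally the pullback of the Liouville form `p db` by `f`, the form `-dθ` is the
pullback of the canonical symplectic form. -/
theorem DiffForm.neg_d_apply_eq_canPairing
    {E : Type*} [NormedAddCommGroup E] [NormedSpace ℝ E]
    {H : Type*} [TopologicalSpace H] {I : ModelWithCorners ℝ E H} [I.Boundaryless]
    {X : Type*} [TopologicalSpace X] [ChartedSpace H X] [IsManifold I ∞ X]
    {B : Type*} [NormedAddCommGroup B] [NormedSpace ℝ B] {θ : DiffForm I X 1}
    {f : X → B × (B →L[ℝ] ℝ)} {x : X} (hf : ContMDiffAt I 𝓘(ℝ, B × (B →L[ℝ] ℝ)) ∞ f x)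
    (hθ : ∀ᶠ y in 𝓝 x, θ y =
      (canLiouville B (f y)).compContinuousLinearMap (mfderiv I 𝓘(ℝ, B × (B →L[ℝ] ℝ)) f y))
    (Y Z : TangentSpace I x) :
    (-θ.d) x ![Y, Z] = canPairing (mfderiv I 𝓘(ℝ, B × (B →L[ℝ] ℝ)) f x Y : B × (B →L[ℝ] ℝ))
      (mfderiv I 𝓘(ℝ, B × (B →L[ℝ] ℝ)) f x Z : B × (B →L[ℝ] ℝ)) := by
  have h := DiffForm.d_eq_of_eventuallyEq (η := canLiouville B) hf
    (ContinuousLinearMap.differentiableAt _) hθ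
  rw [extDeriv_canLiouville] at h
  have h1 : θ.d x ![Y, Z] = -canForm B ![(mfderiv I 𝓘(ℝ, B × (B →L[ℝ] ℝ)) f x Y : B × (B →L[ℝ] ℝ)),
      (mfderiv I 𝓘(ℝ, B × (B →L[ℝ] ℝ)) f x Z : B × (B →L[ℝ] ℝ))] := by
    rw [h]
    change -canForm B _ = _
    congr 2
    funext i
    fin_cases i <;> rfl
  change -(θ.d x ![Y, Z]) = _
  rw [h1, neg_neg, canForm_apply]
  rfl

section PontryaginForm

variable {E : Type*} [NormedAddCommGroup E] [NormedSpace ℝ E]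
  {M : Type*} [TopologicalSpace M] [ChartedSpace E M] [IsManifold 𝓘(ℝ, E) ∞ M]
  {F : Type*} [NormedAddCommGroup F] [NormedSpace ℝ F]
  {G : Type*} [TopologicalSpace G] [ChartedSpace F G] [Group G] [LieGroup 𝓘(ℝ, F) ∞ G] {k : ℕ}

theorem contMDiffOn_ponChart (w₀ : Pontryagin E M F G k) :
    ContMDiffOn (ponI E F G k) 𝓘(ℝ, PhaseSpace (HigherTangentModel E F G k) (E × LieAlg F G)) ∞
      (ponChart w₀) (ponChart w₀).source := by
  rw [ponChart_source, extChartAt_source]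
  exact (phaseSplit E F G k).contDiff.contMDiff.comp_contMDiffOn contMDiffOn_extChartAt

theorem contMDiffOn_ponChart_symm (w₀ : Pontryagin E M F G k) :
    ContMDiffOn 𝓘(ℝ, PhaseSpace (HigherTangentModel E F G k) (E × LieAlg F G)) (ponI E F G k) ∞
      (ponChart w₀).symm (ponChart w₀).target := by
  rw [ponChart_target]
  exact (contMDiffOn_extChartAt_symm w₀).comp
    ((phaseSplit E F G k).symm.contDiff.contMDiff.contMDiffOn) fun v hv => hv

theorem fst_extChartAt_pon (w₀ w : Pontryagin E M F G k) :
    (extChartAt (ponI E F G k) w₀ w).1 = extChartAt (htI E F G (k + 1)) w₀.1 w.1 := by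
  rw [FiberBundle.extChartAt]
  rfl

theorem snd_extChartAt_pon (w₀ w : Pontryagin E M F G k) :
    (extChartAt (ponI E F G k) w₀ w).2 =
      ContinuousLinearMap.inCoordinates (HigherTangentModel E F G k)
        (TangentSpace (htI E F G k) (M := HigherTangent E M F G k)) ℝ
        (Bundle.Trivial (HigherTangent E M F G k) ℝ) (htProj E M F G k w₀.1)
        (htProj E M F G k w.1) (htProj E M F G k w₀.1) (htProj E M F G k w.1) w.2 := by
  rw [FiberBundle.extChartAt]
  rfl

theorem fst_mem_of_mem_extChartAt_pon_source {w₀ w : Pontryagin E M F G k}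
    (hw : w ∈ (extChartAt (ponI E F G k) w₀).source) :
    w.1 ∈ (extChartAt (htI E F G (k + 1)) w₀.1).source := by
  rw [FiberBundle.extChartAt] at hw
  exact hw.2.1

/-- The momenta are the components of the covector in the natural coordinates. -/
theorem snd_extChartAt_pon_apply {w₀ w : Pontryagin E M F G k}
    (hw : w.1 ∈ (extChartAt (htI E F G (k + 1)) w₀.1).source)
    (Y : TangentSpace (htI E F G k) (htProj E M F G k w.1)) :
    (extChartAt (ponI E F G k) w₀ w).2
      (mfderiv (htI E F G k) 𝓘(ℝ, HigherTangentModel E F G k)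
        (extChartAt (htI E F G k) (htProj E M F G k w₀.1)) (htProj E M F G k w.1) Y :
        HigherTangentModel E F G k) = w.covector Y := by
  have hb := htProj_mem_source hw
  have hb1 : htProj E M F G k w.1 ∈ (trivializationAt (HigherTangentModel E F G k)
      (TangentSpace (htI E F G k) (M := HigherTangent E M F G k))
      (htProj E M F G k w₀.1)).baseSet := by
    rwa [TangentBundle.trivializationAt_baseSet, ← extChartAt_source (htI E F G k)]
  rw [snd_extChartAt_pon]
  have h0 : ∀ (A : TangentSpace (htI E F G k) (htProj E M F G k w.1) →L[ℝ] ℝ)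
      (v : HigherTangentModel E F G k), ContinuousLinearMap.inCoordinates
        (HigherTangentModel E F G k)
        (TangentSpace (htI E F G k) (M := HigherTangent E M F G k)) ℝ
        (Bundle.Trivial (HigherTangent E M F G k) ℝ) (htProj E M F G k w₀.1)
        (htProj E M F G k w.1) (htProj E M F G k w₀.1) (htProj E M F G k w.1) A v =
      A ((trivializationAt (HigherTangentModel E F G k)
        (TangentSpace (htI E F G k) (M := HigherTangent E M F G k))
        (htProj E M F G k w₀.1)).symmL ℝ (htProj E M F G k w.1) v) := by
    intro A v
    rw [ContinuousLinearMap.inCoordinates_eq hb1 (mem_univ _)]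
    simp only [ContinuousLinearMap.comp_apply]
    simp
    exact congrArg A (Bundle.Trivialization.symmL_apply _ hb1 v).symm
  refine (h0 _ _).trans ?_
  rw [TangentBundle.symmL_trivializationAt (by rwa [extChartAt_source] at hb)]
  have h := congrArg (fun A => A Y) (mfderivWithin_extChartAt_symm_comp_mfderiv_extChartAt' hb)
  exact congrArg w.covector h

theorem fst_mem_of_mem_ponChart_source {w₀ w : Pontryagin E M F G k}
    (hw : w ∈ (ponChart w₀).source) : w.1 ∈ (extChartAt (htI E F G (k + 1)) w₀.1).source :=
  fst_mem_of_mem_extChartAt_pon_source (by rwa [← ponChart_source])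

theorem ponChart_base {w₀ w : Pontryagin E M F G k} (hw : w ∈ (ponChart w₀).source) :
    (ponChart w₀ w).1.1 = extChartAt (htI E F G k) (htProj E M F G k w₀.1)
      (htProj E M F G k w.1) := by
  rw [extChartAt_htProj (fst_mem_of_mem_ponChart_source hw), ← fst_extChartAt_pon]
  rfl

theorem ponChart_momentum (w₀ w : Pontryagin E M F G k) :
    (ponChart w₀ w).1.2 = (extChartAt (ponI E F G k) w₀ w).2 := rfl

theorem contMDiffAt_fst_ponChart {w₀ w : Pontryagin E M F G k} (hw : w ∈ (ponChart w₀).source) :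
    ContMDiffAt (ponI E F G k)
      𝓘(ℝ, HigherTangentModel E F G k × (HigherTangentModel E F G k →L[ℝ] ℝ)) ∞
      (fun w => (ponChart w₀ w).1) w :=
  contDiff_fst.contMDiff.contMDiffAt.comp w
    ((contMDiffOn_ponChart w₀).contMDiffAt ((ponChart w₀).open_source.mem_nhds hw))

theorem mfderiv_ponChart_base {w₀ w : Pontryagin E M F G k} (hw : w ∈ (ponChart w₀).source)
    (X : TangentSpace (ponI E F G k) w) :
    (mfderiv (ponI E F G k)
      𝓘(ℝ, HigherTangentModel E F G k × (HigherTangentModel E F G k →L[ℝ] ℝ))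
      (fun w => (ponChart w₀ w).1) w X :
        HigherTangentModel E F G k × (HigherTangentModel E F G k →L[ℝ] ℝ)).1 =
    mfderiv (htI E F G k) 𝓘(ℝ, HigherTangentModel E F G k)
      (extChartAt (htI E F G k) (htProj E M F G k w₀.1)) (htProj E M F G k w.1)
      (mfderiv (ponI E F G k) (htI E F G k)
        (fun w : Pontryagin E M F G k => htProj E M F G k w.1) w X) := by
  rw [fst_mfderiv ((contMDiffAt_fst_ponChart hw).mdifferentiableAt (by simp))]
  have h1 : (fun w => (ponChart w₀ w).1.1) =ᶠ[𝓝 w]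
      extChartAt (htI E F G k) (htProj E M F G k w₀.1) ∘
        fun w : Pontryagin E M F G k => htProj E M F G k w.1 := by
    filter_upwards [(ponChart w₀).open_source.mem_nhds hw] with y hy
    exact ponChart_base hy
  have h2 : MDifferentiableAt (htI E F G k) 𝓘(ℝ, HigherTangentModel E F G k)
      (extChartAt (htI E F G k) (htProj E M F G k w₀.1)) (htProj E M F G k w.1) :=
    mdifferentiableAt_extChartAt (by
      rw [← extChartAt_source (htI E F G k)]
      exact htProj_mem_source (fst_mem_of_mem_ponChart_source hw))
  have h3 : MDifferentiableAt (ponI E F G k) (htI E F G k)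
      (fun w : Pontryagin E M F G k => htProj E M F G k w.1) w :=
    (((htProj E M F G k).contMDiff.comp
      (Bundle.contMDiff_proj ((htProj E M F G k) *ᵖ (Cotangent E M F G k)))) w).mdifferentiableAt
        (by simp)
  rw [h1.mfderiv_eq, mfderiv_comp w h2 h3]
  rfl

/-- In natural coordinates, the Liouville form is `p db`. -/
theorem liouvilleForm_eq {w₀ w : Pontryagin E M F G k} (hw : w ∈ (ponChart w₀).source) :
    liouvilleForm E M F G k w =
      (canLiouville (HigherTangentModel E F G k) (ponChart w₀ w).1).compContinuousLinearMap
        (mfderiv (ponI E F G k)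
          𝓘(ℝ, HigherTangentModel E F G k × (HigherTangentModel E F G k →L[ℝ] ℝ))
          (fun w => (ponChart w₀ w).1) w) := by
  ext v
  change w.covector (mfderiv (ponI E F G k) (htI E F G k)
    (fun w : Pontryagin E M F G k => htProj E M F G k w.1) w (v 0)) =
    (extChartAt (ponI E F G k) w₀ w).2 (mfderiv (ponI E F G k)
      𝓘(ℝ, HigherTangentModel E F G k × (HigherTangentModel E F G k →L[ℝ] ℝ))
      (fun w => (ponChart w₀ w).1) w (v 0) :
        HigherTangentModel E F G k × (HigherTangentModel E F G k →L[ℝ] ℝ)).1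
  rw [mfderiv_ponChart_base hw,
    snd_extChartAt_pon_apply (fst_mem_of_mem_ponChart_source hw)]

/-- In natural coordinates, the presymplectic form is `db ∧ dp`. -/
theorem presymplecticForm_eq {w₀ w : Pontryagin E M F G k} (hw : w ∈ (ponChart w₀).source)
    (X Z : TangentSpace (ponI E F G k) w) :
    presymplecticForm E M F G k w ![X, Z] =
      canPairing (phaseDeriv (ponI E F G k) (ponChart w₀) w X).1
        (phaseDeriv (ponI E F G k) (ponChart w₀) w Z).1 := by
  have h1 : ∀ᶠ y in 𝓝 w, liouvilleForm E M F G k y =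
      (canLiouville (HigherTangentModel E F G k) (ponChart w₀ y).1).compContinuousLinearMap
        (mfderiv (ponI E F G k)
          𝓘(ℝ, HigherTangentModel E F G k × (HigherTangentModel E F G k →L[ℝ] ℝ))
          (fun w => (ponChart w₀ w).1) y) := by
    filter_upwards [(ponChart w₀).open_source.mem_nhds hw] with y hy
    exact liouvilleForm_eq hy
  have h3 : ∀ X : TangentSpace (ponI E F G k) w,
      (phaseDeriv (ponI E F G k) (ponChart w₀) w X).1 = mfderiv (ponI E F G k)
          𝓘(ℝ, HigherTangentModel E F G k × (HigherTangentModel E F G k →L[ℝ] ℝ))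
          (fun w => (ponChart w₀ w).1) w X :=
    fst_mfderiv (((contMDiffOn_ponChart w₀).contMDiffAt
      ((ponChart w₀).open_source.mem_nhds hw)).mdifferentiableAt (by simp))
  rw [h3, h3]
  exact DiffForm.neg_d_apply_eq_canPairing (contMDiffAt_fst_ponChart hw) h1 X Z

end PontryaginForm

/-! ### Hamiltonians linear in the momenta -/

section Slices

variable {V U W : Type*} [NormedAddCommGroup V] [NormedSpace ℝ V]
  [NormedAddCommGroup U] [NormedSpace ℝ U] [NormedAddCommGroup W] [NormedSpace ℝ W]

theorem fderiv_comp_add_clm {f : V → W} {v : V} (j : U →L[ℝ] V) {u : U}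
    (hf : DifferentiableAt ℝ f (v + j u)) :
    fderiv ℝ (fun u => f (v + j u)) u = (fderiv ℝ f (v + j u)).comp j :=
  (hf.hasFDerivAt.comp u (j.hasFDerivAt.const_add v)).fderiv

theorem fderiv_fderiv_comp_add_clm {f : V → ℝ} {v : V} (j : U →L[ℝ] V)
    (hf : ContDiffAt ℝ ∞ f v) (u u' : U) :
    fderiv ℝ (fderiv ℝ fun u => f (v + j u)) 0 u u' = fderiv ℝ (fderiv ℝ f) v (j u) (j u') := by
  have h0 : v + j 0 = v := by simp
  have h1 : fderiv ℝ (fun u => f (v + j u)) =ᶠ[𝓝 0] fun u => (fderiv ℝ f (v + j u)).comp j := by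
    have h2 : ∀ᶠ x in 𝓝 (v + j 0), DifferentiableAt ℝ f x := by
      rw [h0]
      exact ((hf.of_le (m := 1) (by simp)).eventually (by simp)).mono fun x hx =>
        hx.differentiableAt (by simp)
    have hc : ContinuousAt (fun u => v + j u) 0 := by fun_prop
    filter_upwards [hc.eventually h2] with u hu
    exact fderiv_comp_add_clm j hu
  have h3 : DifferentiableAt ℝ (fderiv ℝ f) (v + j 0) := by
    rw [h0]
    exact (hf.fderiv_right (m := ∞) (n := ∞) le_rfl).differentiableAt (by simp)
  have h4 := (ContinuousLinearMap.compL ℝ U V ℝ).flip j |>.hasFDerivAt.comp (0 : U)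
    (h3.hasFDerivAt.comp (0 : U) (j.hasFDerivAt.const_add v))
  have h5 : HasFDerivAt (fderiv ℝ fun u => f (v + j u)) _ 0 := h4.congr_of_eventuallyEq h1
  rw [h5.fderiv, h0]
  rfl

end Slices

section BorderedKernel

variable {U U' : Type*} [NormedAddCommGroup U] [NormedSpace ℝ U]
  [NormedAddCommGroup U'] [NormedSpace ℝ U'] {n : ℕ}

/-- The Hessian of `f` at `0`, bordered by the derivatives of the `φ^a`, has trivial kernel. -/
def IsBorderedNondegenerate (f : U → ℝ) (φ : Fin n → U → ℝ) : Prop :=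
  ∀ (u : U) (μ : Fin n → ℝ),
    (∀ u' : U, fderiv ℝ (fderiv ℝ f) 0 u u' + ∑ a, μ a * fderiv ℝ (φ a) 0 u' = 0) →
    (∀ a, fderiv ℝ (φ a) 0 u = 0) → u = 0 ∧ μ = 0

theorem IsBorderedNondegenerate.comp_equiv {f : U → ℝ} {φ : Fin n → U → ℝ}
    (h : IsBorderedNondegenerate f φ) (T : U' ≃L[ℝ] U) :
    IsBorderedNondegenerate (fun u => f (T u)) fun a u => φ a (T u) := by
  intro u μ h1 h2
  have hφ : ∀ a, fderiv ℝ (fun u => φ a (T u)) 0 = (fderiv ℝ (φ a) 0).comp T.toContinuousLinearMap := by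
    intro a
    have := T.comp_right_fderiv (f := φ a) (x := 0)
    rwa [map_zero] at this
  have hf : ∀ u u', fderiv ℝ (fderiv ℝ fun u => f (T u)) 0 u u' =
      fderiv ℝ (fderiv ℝ f) 0 (T u) (T u') := by
    intro u u'
    have h3 : (fderiv ℝ fun u => f (T u)) =
        (T.symm.arrowCongr (ContinuousLinearEquiv.refl ℝ ℝ)) ∘ (fderiv ℝ f ∘ T) := by
      funext x
      have := T.comp_right_fderiv (f := f) (x := x)
      rw [Function.comp_def] at this
      rw [this]
      ext y
      simp
    rw [h3, ContinuousLinearEquiv.comp_fderiv, T.comp_right_fderiv, map_zero]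
    simp
  have h3 := h (T u) μ (fun u' => by
    have h4 := h1 (T.symm u')
    simpa [hf, hφ] using h4) (fun a => by simpa [hφ] using h2 a)
  exact ⟨by simpa using h3.1, h3.2⟩

end BorderedKernel

section LocalSystemOfPairing

set_option synthInstance.maxHeartbeats 200000

variable {A B U : Type*} [NormedAddCommGroup A] [NormedSpace ℝ A]
  [NormedAddCommGroup B] [NormedSpace ℝ B] [NormedAddCommGroup U] [NormedSpace ℝ U] {n : ℕ}
  {O : Set (PhaseSpace B U)} {H : PhaseSpace B U → ℝ} {Φ : Fin n → PhaseSpace B U → ℝ}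
  {T : PhaseSpace B U →L[ℝ] A} {D : Set A} {J : A → B} {L : A → ℝ} {φ : Fin n → A → ℝ}

/-- The data of a Hamiltonian `⟨p, J⟩ - L` and of constraints `φ^a`, where `J`, `L` and `φ^a` are
functions of `(b, u)`. The map `J` is affine and injective as a function of `u`. -/
structure IsPairingSystem (O : Set (PhaseSpace B U)) (H : PhaseSpace B U → ℝ)
    (Φ : Fin n → PhaseSpace B U → ℝ) (T : PhaseSpace B U →L[ℝ] A) (D : Set A) (J : A → B)
    (L : A → ℝ) (φ : Fin n → A → ℝ) : Prop where
  isOpen : IsOpen O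
  surjective : Function.Surjective T
  momentum : ∀ p : B →L[ℝ] ℝ, T ((0, p), 0) = 0
  isOpen_domain : IsOpen D
  mapsTo : MapsTo T O D
  smooth : ContDiffOn ℝ ∞ J D
  smooth_lagrangian : ContDiffOn ℝ ∞ L D
  smooth_constraint : ∀ a, ContDiffOn ℝ ∞ (φ a) D
  hamiltonian_eq : ∀ v ∈ O, H v = v.1.2 (J (T v)) - L (T v)
  constraint_eq : ∀ v ∈ O, ∀ a, Φ a v = φ a (T v)
  affine : ∀ x ∈ D, ∀ u : U, J (x + T (0, u)) = J x + fderiv ℝ J x (T (0, u))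
  injective : ∀ x ∈ D, ∀ u : U, fderiv ℝ J x (T (0, u)) = 0 → u = 0
  linearIndependent : ∀ x ∈ D, (∀ a, φ a x = 0) → LinearIndependent ℝ fun a => fderiv ℝ (φ a) x

namespace IsPairingSystem

theorem fderiv_constraint (h : IsPairingSystem O H Φ T D J L φ) {v : PhaseSpace B U} (hv : v ∈ O)
    (a : Fin n) : fderiv ℝ (Φ a) v = (fderiv ℝ (φ a) (T v)).comp T := by
  have h1 : Φ a =ᶠ[𝓝 v] fun v => φ a (T v) := by
    filter_upwards [h.isOpen.mem_nhds hv] with w hw using h.constraint_eq w hw a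
  rw [h1.fderiv_eq]
  have h2 : DifferentiableAt ℝ (φ a) (T v) :=
    ((h.smooth_constraint a).contDiffAt (h.isOpen_domain.mem_nhds (h.mapsTo hv))).differentiableAt
      (by simp)
  exact (h2.hasFDerivAt.comp v T.hasFDerivAt).fderiv

theorem contDiffOn_hamiltonian (h : IsPairingSystem O H Φ T D J L φ) : ContDiffOn ℝ ∞ H O := by
  have h1 : ContDiffOn ℝ ∞ (fun v : PhaseSpace B U => v.1.2 (J (T v)) - L (T v)) O :=
    ((contDiff_snd.comp contDiff_fst).contDiffOn.clm_apply
      (h.smooth.comp T.contDiff.contDiffOn h.mapsTo)).sub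
      (h.smooth_lagrangian.comp T.contDiff.contDiffOn h.mapsTo)
  exact h1.congr h.hamiltonian_eq

theorem fderiv_momentum (h : IsPairingSystem O H Φ T D J L φ) {v : PhaseSpace B U} (hv : v ∈ O)
    (p : B →L[ℝ] ℝ) : fderiv ℝ H v ((0, p), 0) = p (J (T v)) := by
  have h1 : HasFDerivAt H (fderiv ℝ H v) v :=
    ((h.contDiffOn_hamiltonian.contDiffAt (h.isOpen.mem_nhds hv)).differentiableAt
      (by simp)).hasFDerivAt
  -- along the line in the direction of `p` the Hamiltonian is affine
  have h2 : HasDerivAt (fun t : ℝ => v + t • (((0, p), 0) : PhaseSpace B U)) ((0, p), 0) 0 := by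
    simpa using ((hasDerivAt_id (0 : ℝ)).smul_const (((0, p), 0) : PhaseSpace B U)).const_add v
  have h0 : v + (0 : ℝ) • (((0, p), 0) : PhaseSpace B U) = v := by simp
  have h3 : HasDerivAt (fun t : ℝ => H (v + t • (((0, p), 0) : PhaseSpace B U)))
      (fderiv ℝ H v ((0, p), 0)) 0 :=
    HasFDerivAt.comp_hasDerivAt (0 : ℝ) (by rwa [h0]) h2
  have h4 : (fun t : ℝ => H (v + t • (((0, p), 0) : PhaseSpace B U))) =ᶠ[𝓝 0]
      fun t => (v.1.2 (J (T v)) - L (T v)) + t * p (J (T v)) := by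
    have hc : ContinuousAt (fun t : ℝ => v + t • (((0, p), 0) : PhaseSpace B U)) 0 := by fun_prop
    filter_upwards [hc.eventually_mem (h.isOpen.mem_nhds (by rwa [h0]))] with t ht
    rw [h.hamiltonian_eq _ ht, map_add, map_smul, h.momentum, smul_zero, add_zero]
    simp
    ring
  have h5 : HasDerivAt (fun t : ℝ => (v.1.2 (J (T v)) - L (T v)) + t * p (J (T v)))
      (p (J (T v))) 0 := by
    simpa using ((hasDerivAt_id (0 : ℝ)).mul_const (p (J (T v)))).const_add
      (v.1.2 (J (T v)) - L (T v))
  exact h3.unique (h5.congr_of_eventuallyEq h4)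

theorem fderiv_fderiv_momentum (h : IsPairingSystem O H Φ T D J L φ) {v : PhaseSpace B U}
    (hv : v ∈ O) (p : B →L[ℝ] ℝ) (X : PhaseSpace B U) :
    fderiv ℝ (fderiv ℝ H) v ((0, p), 0) X = p (fderiv ℝ J (T v) (T X)) := by
  have hH := h.contDiffOn_hamiltonian.contDiffAt (h.isOpen.mem_nhds hv)
  rw [fderiv_fderiv_symm hH]
  have h1 : DifferentiableAt ℝ (fderiv ℝ H) v :=
    (hH.fderiv_right (m := ∞) (n := ∞) le_rfl).differentiableAt (by simp)
  have h2 : HasFDerivAt (fun w => fderiv ℝ H w ((0, p), 0))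
      ((fderiv ℝ (fderiv ℝ H) v).flip ((0, p), 0)) v := by
    simpa using h1.hasFDerivAt.clm_apply (hasFDerivAt_const (((0, p), 0) : PhaseSpace B U) v)
  have h3 : HasFDerivAt (fun w => p (J (T w))) (p.comp ((fderiv ℝ J (T v)).comp T)) v :=
    p.hasFDerivAt.comp v ((((h.smooth.contDiffAt (h.isOpen_domain.mem_nhds
      (h.mapsTo hv))).differentiableAt (by simp)).hasFDerivAt).comp v T.hasFDerivAt)
  have h4 : (fun w => fderiv ℝ H w ((0, p), 0)) =ᶠ[𝓝 v] fun w => p (J (T w)) := by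
    filter_upwards [h.isOpen.mem_nhds hv] with w hw using h.fderiv_momentum hw p
  exact congrArg (fun S : PhaseSpace B U →L[ℝ] ℝ => S X)
    (h2.unique (h3.congr_of_eventuallyEq h4))

theorem isLocalSystem [FiniteDimensional ℝ B] (h : IsPairingSystem O H Φ T D J L φ) :
    IsLocalSystem O H Φ where
  isOpen := h.isOpen
  smooth := h.contDiffOn_hamiltonian
  smooth_constraint a := ((h.smooth_constraint a).comp T.contDiff.contDiffOn h.mapsTo).congr
    fun v hv => h.constraint_eq v hv a
  indep_momentum v hv a p := by
    rw [h.fderiv_constraint hv, ContinuousLinearMap.comp_apply, h.momentum, map_zero]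
  exists_momentum v hv ν := by
    let Λ : U →ₗ[ℝ] B := ((fderiv ℝ J (T v)).comp (T.comp (.inr ℝ _ U))).toLinearMap
    obtain ⟨P, hP⟩ := LinearMap.exists_leftInverse_of_injective Λ
      (LinearMap.ker_eq_bot'.2 fun u hu => h.injective _ (h.mapsTo hv) u hu)
    refine ⟨LinearMap.toContinuousLinearMap (ν.toLinearMap ∘ₗ P), fun u => ?_⟩
    rw [h.fderiv_fderiv_momentum hv]
    exact congrArg ν (LinearMap.congr_fun hP u)
  linearIndependent v hv h0 := by
    have h1 := h.linearIndependent _ (h.mapsTo hv) fun a => by rw [← h.constraint_eq v hv, h0]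
    have h2 := h1.map' ((ContinuousLinearMap.compL ℝ (PhaseSpace B U) A ℝ).flip T).toLinearMap
      (LinearMap.ker_eq_bot'.2 fun α hα => by
        ext x
        obtain ⟨w, rfl⟩ := h.surjective x
        exact congrArg (fun S : PhaseSpace B U →L[ℝ] ℝ => S w) hα)
    rwa [funext fun a => h.fderiv_constraint hv a]

/-- Up to sign, the bordered Hessian of `H + l_a Φ^a` in the directions of `U` is the one of
`L - l_a φ^a`. -/
theorem isLocallyRegular_iff (h : IsPairingSystem O H Φ T D J L φ) {v : PhaseSpace B U}
    (hv : v ∈ O) (l : Fin n → ℝ) :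
    IsLocallyRegular (.inr ℝ (B × (B →L[ℝ] ℝ)) U) H Φ v l ↔
      IsBorderedNondegenerate
        (fun u : U => L (T v + T (0, u)) - ∑ a, l a * φ a (T v + T (0, u)))
        fun a u => φ a (T v + T (0, u)) := by
  let j : U →L[ℝ] PhaseSpace B U := .inr ℝ (B × (B →L[ℝ] ℝ)) U
  have hD := h.isOpen_domain.mem_nhds (h.mapsTo hv)
  have hΦ : ∀ a, ContDiffAt ℝ ∞ (Φ a) v := fun a =>
    (((h.smooth_constraint a).comp T.contDiff.contDiffOn h.mapsTo).congr
      fun v hv => h.constraint_eq v hv a).contDiffAt (h.isOpen.mem_nhds hv)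
  have haug : ContDiffAt ℝ ∞ (augmented H Φ l) v :=
    contDiffAt_augmented (h.contDiffOn_hamiltonian.contDiffAt (h.isOpen.mem_nhds hv)) hΦ l
  have h1 : ∀ a (u : U), fderiv ℝ (fun u : U => φ a (T v + T (0, u))) 0 u =
      fderiv ℝ (Φ a) v (j u) := by
    intro a u
    have h2 := fderiv_comp_add_clm (f := φ a) (v := T v) (T.comp j) (u := 0) (by
      rw [map_zero, add_zero]
      exact ((h.smooth_constraint a).contDiffAt hD).differentiableAt (by simp))
    rw [map_zero, add_zero] at h2
    rw [h.fderiv_constraint hv]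
    exact congrArg (fun S : U →L[ℝ] ℝ => S u) h2
  have h2 : ∀ u u' : U, fderiv ℝ (fderiv ℝ fun u : U =>
      L (T v + T (0, u)) - ∑ a, l a * φ a (T v + T (0, u))) 0 u u' =
      -fderiv ℝ (fderiv ℝ (augmented H Φ l)) v (j u) (j u') := by
    intro u u'
    rw [← fderiv_fderiv_comp_add_clm j haug]
    let Λ : U →L[ℝ] ℝ := v.1.2.comp ((fderiv ℝ J (T v)).comp (T.comp j))
    have h3 : (fun u : U => L (T v + T (0, u)) - ∑ a, l a * φ a (T v + T (0, u))) =ᶠ[𝓝 0]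
        fun u => (v.1.2 (J (T v)) + Λ u) - augmented H Φ l (v + j u) := by
      have hc : ContinuousAt (fun u => v + j u) 0 := by fun_prop
      filter_upwards [hc.eventually_mem (h.isOpen.mem_nhds (by simpa using hv))] with u hu
      have h4 : T (v + j u) = T v + T (0, u) := map_add _ _ _
      have h5 : (v + j u).1.2 = v.1.2 := by simp [j]
      rw [augmented, h.hamiltonian_eq _ hu, h4, h5, h.affine _ (h.mapsTo hv), map_add]
      simp only [h.constraint_eq _ hu, h4]
      change _ = v.1.2 (J (T v)) + v.1.2 (fderiv ℝ J (T v) (T (0, u))) - _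
      ring
    have h6 : fderiv ℝ (fun u => (v.1.2 (J (T v)) + Λ u) - augmented H Φ l (v + j u)) =ᶠ[𝓝 0]
        fun u => Λ - fderiv ℝ (fun u => augmented H Φ l (v + j u)) u := by
      have h7 : ∀ᶠ x in 𝓝 (v + j 0), DifferentiableAt ℝ (augmented H Φ l) x := by
        rw [map_zero, add_zero]
        exact ((haug.of_le (m := 1) (by simp)).eventually (by simp)).mono fun x hx =>
          hx.differentiableAt (by simp)
      have hc : ContinuousAt (fun u => v + j u) 0 := by fun_prop
      filter_upwards [hc.eventually h7] with u hu
      exact ((Λ.hasFDerivAt.const_add _).sub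
        ((hu.comp u (by fun_prop : DifferentiableAt ℝ (fun u => v + j u) u)).hasFDerivAt)).fderiv
    rw [(h3.fderiv.trans h6).fderiv_eq, fderiv_const_sub]
    rfl
  have h3 : ∀ u (μ : Fin n → ℝ), (∀ u', fderiv ℝ (fderiv ℝ (augmented H Φ l)) v (j u) (j u') +
      ∑ a, μ a * fderiv ℝ (Φ a) v (j u') = 0) ↔
      ∀ u', -fderiv ℝ (fderiv ℝ (augmented H Φ l)) v (j u) (j u') +
        ∑ a, (-μ) a * fderiv ℝ (Φ a) v (j u') = 0 := by
    intro u μ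
    refine forall_congr' fun u' => ?_
    rw [← neg_eq_zero, neg_add]
    simp only [Pi.neg_apply, neg_mul, Finset.sum_neg_distrib]
  constructor
  · intro hr u μ hu hφ
    simp only [h1, h2] at hu hφ
    have h4 := hr u (-μ) ((h3 u (-μ)).2 (by rwa [neg_neg])) hφ
    exact ⟨h4.1, neg_eq_zero.1 h4.2⟩
  · intro hr u μ hu hφ
    have h4 := hr u (-μ) (by simpa only [h1, h2] using (h3 u μ).1 hu) (by simpa only [h1] using hφ)
    exact ⟨h4.1, neg_eq_zero.1 h4.2⟩

end IsPairingSystem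

end LocalSystemOfPairing

/-! ### The bordered matrix -/

section BorderedMatrix

variable {U : Type*} [NormedAddCommGroup U] [NormedSpace ℝ U] {ι : Type*} [Fintype ι]
  [DecidableEq ι] {n : ℕ}

/-- The bordered matrix in a basis is nondegenerate if and only if the bordered Hessian is. -/
theorem det_fromBlocks_ne_zero_iff (b : Module.Basis ι ℝ U) (f : U → ℝ) (φ : Fin n → U → ℝ) :
    (Matrix.fromBlocks (Matrix.of fun x y => fderiv ℝ (fderiv ℝ f) 0 (b x) (b y))
      (Matrix.of fun (c : Fin n) x => fderiv ℝ (φ c) 0 (b x)).transpose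
      (Matrix.of fun (c : Fin n) x => fderiv ℝ (φ c) 0 (b x)) 0).det ≠ 0 ↔
    IsBorderedNondegenerate f φ := by
  have hu : ∀ u : U, ∑ i, b.repr u i • b i = u := b.sum_repr
  have hx : ∀ x : ι → ℝ, (b.repr (∑ i, x i • b i) : ι → ℝ) = x := b.repr_sum_self
  have hess : ∀ (x : ι → ℝ) j, (Matrix.vecMul x
      (Matrix.of fun x y => fderiv ℝ (fderiv ℝ f) 0 (b x) (b y))) j =
      fderiv ℝ (fderiv ℝ f) 0 (∑ i, x i • b i) (b j) := by
    intro x j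
    simp [Matrix.vecMul, dotProduct, map_sum]
  have hjac : ∀ (μ : Fin n → ℝ) j, (Matrix.vecMul μ
      (Matrix.of fun (c : Fin n) x => fderiv ℝ (φ c) 0 (b x))) j =
      ∑ c, μ c * fderiv ℝ (φ c) 0 (b j) := by
    intro μ j
    simp [Matrix.vecMul, dotProduct]
  have hjact : ∀ (x : ι → ℝ) c, (Matrix.vecMul x
      (Matrix.of fun (c : Fin n) x => fderiv ℝ (φ c) 0 (b x)).transpose) c =
      fderiv ℝ (φ c) 0 (∑ i, x i • b i) := by
    intro x c
    simp [Matrix.vecMul, dotProduct, map_sum]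
  rw [Ne, ← Matrix.exists_vecMul_eq_zero_iff]
  constructor
  · intro h u μ h1 h2
    by_contra hne
    refine h ⟨Sum.elim (b.repr u) μ, fun h0 => hne ?_, ?_⟩
    · have h3 : b.repr u = 0 := by
        ext i; exact congrFun h0 (Sum.inl i)
      exact ⟨by simpa using h3, funext fun c => congrFun h0 (Sum.inr c)⟩
    · rw [Matrix.vecMul_fromBlocks]
      funext i
      rcases i with i | c
      · simp only [Sum.elim_inl, Sum.elim_comp_inl, Sum.elim_comp_inr, Pi.add_apply, hess, hjac, hu]
        exact h1 (b i)
      · simp only [Sum.elim_inr, Sum.elim_comp_inl, Sum.elim_comp_inr, hjact, hu,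
          Matrix.vecMul_zero, Pi.zero_apply, add_zero]
        exact h2 c
  · rintro h ⟨z, hz, h0⟩
    rw [← Sum.elim_comp_inl_inr z, Matrix.vecMul_fromBlocks] at h0
    obtain ⟨h3, h4⟩ := h (∑ i, z (Sum.inl i) • b i) (z ∘ Sum.inr) (fun u' => by
      have h5 : fderiv ℝ (fderiv ℝ f) 0 (∑ i, z (Sum.inl i) • b i) +
          ∑ c, (z ∘ Sum.inr) c • fderiv ℝ (φ c) 0 = 0 := by
        refine ContinuousLinearMap.coe_injective (b.ext fun j => ?_)
        have h6 := congrFun h0 (Sum.inl j)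
        simp only [Sum.elim_inl, Sum.elim_comp_inl, Sum.elim_comp_inr, Pi.add_apply, hess,
          hjac] at h6
        simpa using h6
      simpa using congrArg (fun S : U →L[ℝ] ℝ => S u') h5) (fun c => by
        have h6 := congrFun h0 (Sum.inr c)
        simp only [Sum.elim_inr, Sum.elim_comp_inl, Sum.elim_comp_inr, hjact,
          Matrix.vecMul_zero, Pi.zero_apply, add_zero] at h6
        exact h6)
    refine hz ?_
    have h7 := hx (z ∘ Sum.inl)
    simp only [Function.comp_apply, h3] at h7
    funext i
    rcases i with i | c
    · simpa using (congrFun h7 i).symm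
    · exact congrFun h4 c

end BorderedMatrix

section RegularityInCharts

variable {E : Type*} [NormedAddCommGroup E] [NormedSpace ℝ E]
  {M : Type*} [TopologicalSpace M] [ChartedSpace E M] [IsManifold 𝓘(ℝ, E) ∞ M]
  {F : Type*} [NormedAddCommGroup F] [NormedSpace ℝ F]
  {G : Type*} [TopologicalSpace G] [ChartedSpace F G] [Group G]
  {k n : ℕ} {L : HigherTangent E M F G (k + 1) → ℝ}
  {Φ : Fin n → HigherTangent E M F G (k + 1) → ℝ}

theorem det_borderedMatrix_ne_zero_iff {m d : ℕ} (bM : Module.Basis (Fin m) ℝ E)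
    (bG : Module.Basis (Fin d) ℝ (LieAlg F G)) (l : Fin n → ℝ)
    (e : OpenPartialHomeomorph M E) (he : e ∈ atlas E M) (a : HigherTangent E M F G (k + 1)) :
    (borderedMatrix L Φ bM bG l e he a).det ≠ 0 ↔
      IsBorderedNondegenerate
        (fun v => L (topShift e he a v) - ∑ c, l c * Φ c (topShift e he a v))
        fun c v => Φ c (topShift e he a v) :=
  det_fromBlocks_ne_zero_iff (bM.prod bG) _ _

/-- Nondegeneracy of the bordered Hessian does not depend on the natural coordinates. -/
theorem IsBorderedNondegenerate.of_chart {l : Fin n → ℝ} {e e' : OpenPartialHomeomorph M E}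
    (he : e ∈ atlas E M) (he' : e' ∈ atlas E M) {a : HigherTangent E M F G (k + 1)}
    (ha : a.1.base ∈ e.source) (ha' : a.1.base ∈ e'.source)
    (h : IsBorderedNondegenerate
      (fun v => L (topShift e he a v) - ∑ c, l c * Φ c (topShift e he a v))
      fun c v => Φ c (topShift e he a v)) :
    IsBorderedNondegenerate
      (fun v => L (topShift e' he' a v) - ∑ c, l c * Φ c (topShift e' he' a v))
      fun c v => Φ c (topShift e' he' a v) := by
  obtain ⟨T, hT⟩ := exists_topShift_eq he' he ha' ha
  simp only [hT]
  exact h.comp_equiv T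

theorem topShift_eq_extChartAt_symm {a₀ a : HigherTangent E M F G (k + 1)}
    (ha : a ∈ (extChartAt (htI E F G (k + 1)) a₀).source) (u : E × LieAlg F G) :
    topShift (chartAt E a₀.1.base) (chart_mem_atlas E a₀.1.base) a u =
      (extChartAt (htI E F G (k + 1)) a₀).symm
        (extChartAt (htI E F G (k + 1)) a₀ a + topJoin E F G k (0, u)) := by
  have ha' := mem_extChartAt_ht_source.1 ha
  rw [topJoin_top, extChartAt_ht_symm, extChartAt_ht_apply]
  refine Prod.ext rfl (Prod.ext ?_ rfl)
  change a.2.1 = (chartAt F a₀.2.1).symm (chartAt F a₀.2.1 a.2.1 + 0)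
  rw [add_zero, (chartAt F a₀.2.1).left_inv ha'.2]

end RegularityInCharts

/-! ### The Hamiltonian in natural coordinates -/

section CoordinateExpressions

variable {E : Type*} [NormedAddCommGroup E] [NormedSpace ℝ E]
  {M : Type*} [TopologicalSpace M] [ChartedSpace E M] [IsManifold 𝓘(ℝ, E) ∞ M]
  {F : Type*} [NormedAddCommGroup F] [NormedSpace ℝ F]
  {G : Type*} [TopologicalSpace G] [ChartedSpace F G] [Group G]
  {k n : ℕ} {L : HigherTangent E M F G (k + 1) → ℝ}
  {Φ : Fin n → HigherTangent E M F G (k + 1) → ℝ}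

theorem mem_chartAt_target_of_mem {a₀ : HigherTangent E M F G (k + 1)}
    {x : HigherTangentModel E F G (k + 1)}
    (hx : x ∈ (extChartAt (htI E F G (k + 1)) a₀).target) : x.2.1 ∈ (chartAt F a₀.2.1).target := by
  have h1 := (mem_extChartAt_ht_source.1 ((extChartAt (htI E F G (k + 1)) a₀).map_target hx)).2
  have h2 := congrArg (fun x : HigherTangentModel E F G (k + 1) => x.2.1)
    ((extChartAt (htI E F G (k + 1)) a₀).right_inv hx)
  rw [← h2]
  exact (chartAt F a₀.2.1).map_source h1

variable [LieGroup 𝓘(ℝ, F) ∞ G]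

theorem fderiv_embedCoord {g₀ : G} {x : HigherTangentModel E F G (k + 1)}
    (hx : x.2.1 ∈ (chartAt F g₀).target) (q : Fin (k + 1 + 1) → E)
    (ξ : Fin (k + 1) → LieAlg F G) :
    fderiv ℝ (embedCoord g₀ : HigherTangentModel E F G (k + 1) → HigherTangentModel E F G k) x
      (q, 0, ξ) = embedCoord g₀ (q, x.2.1, ξ) := by
  have ho : IsOpen {x : HigherTangentModel E F G (k + 1) | x.2.1 ∈ (chartAt F g₀).target} :=
    (chartAt F g₀).open_target.preimage (continuous_fst.comp continuous_snd)
  have h1 := (((contDiffOn_embedCoord (E := E) g₀).contDiffAt (ho.mem_nhds hx)).differentiableAt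
    (by simp)).hasFDerivAt.hasLineDerivAt ((q, 0, ξ) : HigherTangentModel E F G (k + 1))
  have h2 : HasDerivAt (fun t : ℝ => embedCoord g₀ x +
      t • (embedCoord g₀ (q, x.2.1, ξ) : HigherTangentModel E F G k))
      (embedCoord g₀ (q, x.2.1, ξ)) 0 := by
    simpa using ((hasDerivAt_id (0 : ℝ)).smul_const
      (embedCoord g₀ (q, x.2.1, ξ) : HigherTangentModel E F G k)).const_add (embedCoord g₀ x)
  refine HasDerivAt.unique h1 (h2.congr_of_eventuallyEq (.of_forall fun t => ?_))
  exact embedCoord_add g₀ x hx q ξ t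

theorem topJoin_ponChart (w₀ w : Pontryagin E M F G k) :
    topJoin E F G k (ponChart w₀ w) = extChartAt (htI E F G (k + 1)) w₀.1 w.1 := by
  rw [← fst_extChartAt_pon, topJoin_apply, ContinuousLinearEquiv.symm_apply_eq]
  rfl

theorem linearIndependent_fderiv_comp_symm {A : Type*} [NormedAddCommGroup A] [NormedSpace ℝ A]
    {H : Type*} [TopologicalSpace H] {I : ModelWithCorners ℝ A H} [I.Boundaryless]
    {X : Type*} [TopologicalSpace X] [ChartedSpace H X] [IsManifold I ∞ X] {φ : Fin n → X → ℝ}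
    {x₀ : X} {x : A} (hx : x ∈ (extChartAt I x₀).target)
    (hφ : ∀ a, MDifferentiableAt I 𝓘(ℝ, ℝ) (φ a) ((extChartAt I x₀).symm x))
    (hind : LinearIndependent ℝ fun a => differential I (φ a) ((extChartAt I x₀).symm x)) :
    LinearIndependent ℝ fun a => fderiv ℝ (φ a ∘ (extChartAt I x₀).symm) x := by
  have hs : MDifferentiableAt 𝓘(ℝ, A) I (extChartAt I x₀).symm x :=
    ((contMDiffOn_extChartAt_symm (I := I) (n := ∞) x₀).contMDiffAt
      ((isOpen_extChartAt_target x₀).mem_nhds hx)).mdifferentiableAt (by simp)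
  have : IsManifold I 1 X := IsManifold.of_le (n := ∞) (by simp)
  have hinv := isInvertible_mfderivWithin_extChartAt_symm (I := I) hx
  rw [I.range_eq_univ, mfderivWithin_univ] at hinv
  let S : A →L[ℝ] A := mfderiv 𝓘(ℝ, A) I (extChartAt I x₀).symm x
  have hS : Function.Surjective S := hinv.surjective
  have h1 : ∀ a, fderiv ℝ (φ a ∘ (extChartAt I x₀).symm) x =
      (differential I (φ a) ((extChartAt I x₀).symm x) : A →L[ℝ] ℝ).comp S := by
    intro a
    rw [← mfderiv_eq_fderiv]
    exact mfderiv_comp x (hφ a) hs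
  rw [funext h1]
  refine hind.map' ((ContinuousLinearMap.compL ℝ A A ℝ).flip S).toLinearMap
    (LinearMap.ker_eq_bot'.2 fun α hα => ?_)
  refine ContinuousLinearMap.ext fun y => ?_
  obtain ⟨z, rfl⟩ := hS y
  exact congrArg (fun R : A →L[ℝ] ℝ => R z) hα

theorem contDiffOn_comp_extChartAt_ht_symm {f : HigherTangent E M F G (k + 1) → ℝ}
    (hf : ContMDiff (htI E F G (k + 1)) 𝓘(ℝ, ℝ) ∞ f) (a₀ : HigherTangent E M F G (k + 1)) :
    ContDiffOn ℝ ∞ (f ∘ (extChartAt (htI E F G (k + 1)) a₀).symm)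
      (extChartAt (htI E F G (k + 1)) a₀).target := by
  rw [← contMDiffOn_iff_contDiffOn]
  exact hf.comp_contMDiffOn (contMDiffOn_extChartAt_symm a₀)

/-- In natural coordinates, the Hamiltonian is `⟨p, J⟩ - L`, where `J` is the coordinate expression of
the embedding `T^{k+1} (M × G) → T (T^k (M × G))`. -/
theorem isPairingSystem_ponChart (hL : ContMDiff (htI E F G (k + 1)) 𝓘(ℝ, ℝ) ∞ L)
    (hΦ : ∀ a, ContMDiff (htI E F G (k + 1)) 𝓘(ℝ, ℝ) ∞ (Φ a))
    (hind : ∀ x, (∀ a, Φ a x = 0) →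
      LinearIndependent ℝ fun a => differential (htI E F G (k + 1)) (Φ a) x)
    (w₀ : Pontryagin E M F G k) :
    IsPairingSystem (ponChart w₀).target (hamiltonian L ∘ (ponChart w₀).symm)
      (fun a => (fun w : Pontryagin E M F G k => Φ a w.1) ∘ (ponChart w₀).symm) (topJoin E F G k)
      (extChartAt (htI E F G (k + 1)) w₀.1).target (embedCoord w₀.1.2.1)
      (L ∘ (extChartAt (htI E F G (k + 1)) w₀.1).symm)
      (fun a => Φ a ∘ (extChartAt (htI E F G (k + 1)) w₀.1).symm) := by
  have hs : ∀ v ∈ (ponChart w₀).target, ((ponChart w₀).symm v).1 ∈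
      (extChartAt (htI E F G (k + 1)) w₀.1).source := fun v hv =>
    fst_mem_of_mem_ponChart_source ((ponChart w₀).map_target hv)
  have hT : ∀ v ∈ (ponChart w₀).target, topJoin E F G k v =
      extChartAt (htI E F G (k + 1)) w₀.1 ((ponChart w₀).symm v).1 := fun v hv => by
    rw [← topJoin_ponChart, (ponChart w₀).right_inv hv]
  have hT' : ∀ v ∈ (ponChart w₀).target, (extChartAt (htI E F G (k + 1)) w₀.1).symm
      (topJoin E F G k v) = ((ponChart w₀).symm v).1 := fun v hv => by
    rw [hT v hv, (extChartAt (htI E F G (k + 1)) w₀.1).left_inv (hs v hv)]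
  exact
  { isOpen := (ponChart w₀).open_target
    surjective := surjective_topJoin
    momentum := topJoin_momentum
    isOpen_domain := isOpen_extChartAt_target w₀.1
    mapsTo := fun v hv => by
      rw [hT v hv]
      exact (extChartAt (htI E F G (k + 1)) w₀.1).map_source (hs v hv)
    smooth := (contDiffOn_embedCoord w₀.1.2.1).mono fun x hx => mem_chartAt_target_of_mem hx
    smooth_lagrangian := contDiffOn_comp_extChartAt_ht_symm hL w₀.1
    smooth_constraint := fun a => contDiffOn_comp_extChartAt_ht_symm (hΦ a) w₀.1
    hamiltonian_eq := fun v hv => by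
      set w := (ponChart w₀).symm v with hw
      have hv1 : v.1.2 = (extChartAt (ponI E F G k) w₀ w).2 := by
        rw [← ponChart_momentum, hw, (ponChart w₀).right_inv hv]
      change w.covector (htEmbed w.1) - L w.1 = _
      rw [Function.comp_apply, hT' v hv, hT v hv, hv1, ← mfderiv_extChartAt_htEmbed (hs v hv),
        snd_extChartAt_pon_apply (hs v hv)]
    constraint_eq := fun v hv a => congrArg (Φ a) (hT' v hv).symm
    affine := fun x hx u => by
      rw [topJoin_top, fderiv_embedCoord (mem_chartAt_target_of_mem hx)]
      simpa using embedCoord_add w₀.1.2.1 x (mem_chartAt_target_of_mem hx)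
        (Pi.single (Fin.last (k + 1)) u.1) (Pi.single (Fin.last k) u.2) 1
    injective := fun x hx u hu => by
      rw [topJoin_top, fderiv_embedCoord (mem_chartAt_target_of_mem hx)] at hu
      obtain ⟨h1, h2⟩ := embedCoord_eq_zero (mem_chartAt_target_of_mem hx) hu
      refine Prod.ext ?_ ?_
      · simpa [← Fin.succ_last] using h1 (Fin.last k)
      · simpa using congrFun h2 (Fin.last k)
    linearIndependent := fun x hx h0 =>
      linearIndependent_fderiv_comp_symm hx (fun a => (hΦ a _).mdifferentiableAt (by simp))
        (hind _ h0) }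

theorem isAdaptedChart_ponChart [FiniteDimensional ℝ E] [FiniteDimensional ℝ F]
    (hL : ContMDiff (htI E F G (k + 1)) 𝓘(ℝ, ℝ) ∞ L)
    (hΦ : ∀ a, ContMDiff (htI E F G (k + 1)) 𝓘(ℝ, ℝ) ∞ (Φ a))
    (hind : ∀ x, (∀ a, Φ a x = 0) →
      LinearIndependent ℝ fun a => differential (htI E F G (k + 1)) (Φ a) x)
    (w₀ : Pontryagin E M F G k) :
    IsAdaptedChart (presymplecticForm E M F G k) (hamiltonian L)
      (fun a (w : Pontryagin E M F G k) => Φ a w.1) (ponChart w₀) where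
  contMDiffOn := contMDiffOn_ponChart w₀
  contMDiffOn_symm := contMDiffOn_ponChart_symm w₀
  form _ hw X Z := presymplecticForm_eq hw X Z
  isLocalSystem :=
    haveI : FiniteDimensional ℝ (LieAlg F G) := inferInstanceAs (FiniteDimensional ℝ F)
    (isPairingSystem_ponChart hL hΦ hind w₀).isLocalSystem

/-- The intrinsic nondegeneracy condition in an adapted chart is the nondegeneracy of the bordered
matrix in natural coordinates. -/
theorem isLocallyRegular_ponChart_iff {m d : ℕ} (bM : Module.Basis (Fin m) ℝ E)
    (bG : Module.Basis (Fin d) ℝ (LieAlg F G))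
    (hL : ContMDiff (htI E F G (k + 1)) 𝓘(ℝ, ℝ) ∞ L)
    (hΦ : ∀ a, ContMDiff (htI E F G (k + 1)) 𝓘(ℝ, ℝ) ∞ (Φ a))
    (hind : ∀ x, (∀ a, Φ a x = 0) →
      LinearIndependent ℝ fun a => differential (htI E F G (k + 1)) (Φ a) x)
    {w₀ w : Pontryagin E M F G k} (hw : w ∈ (ponChart w₀).source) (l : Fin n → ℝ)
    {e : OpenPartialHomeomorph M E} (he : e ∈ atlas E M) (hwe : w.1.1.base ∈ e.source) :
    IsLocallyRegular (.inr ℝ (HigherTangentModel E F G k × (HigherTangentModel E F G k →L[ℝ] ℝ))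
        (E × LieAlg F G)) (hamiltonian L ∘ (ponChart w₀).symm)
      (fun a => (fun w : Pontryagin E M F G k => Φ a w.1) ∘ (ponChart w₀).symm) (ponChart w₀ w) l ↔
    (borderedMatrix L Φ bM bG l e he w.1).det ≠ 0 := by
  have hs := fst_mem_of_mem_ponChart_source hw
  have hb := (mem_extChartAt_ht_source.1 hs).1
  rw [det_borderedMatrix_ne_zero_iff, (isPairingSystem_ponChart hL hΦ hind w₀).isLocallyRegular_iff
    ((ponChart w₀).map_source hw)]
  simp only [topJoin_ponChart, Function.comp_apply, ← topShift_eq_extChartAt_symm hs]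
  exact ⟨IsBorderedNondegenerate.of_chart (chart_mem_atlas E _) he hb hwe,
    IsBorderedNondegenerate.of_chart he (chart_mem_atlas E _) hwe hb⟩

end CoordinateExpressions

/-! ### Symplecticity and dynamics -/

section RegularCharts

variable {E : Type*} [NormedAddCommGroup E] [NormedSpace ℝ E]
  {M : Type*} [TopologicalSpace M] [ChartedSpace E M] [IsManifold 𝓘(ℝ, E) ∞ M]
  {F : Type*} [NormedAddCommGroup F] [NormedSpace ℝ F]
  {G : Type*} [TopologicalSpace G] [ChartedSpace F G] [Group G] [LieGroup 𝓘(ℝ, F) ∞ G]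
  {k n : ℕ} {L : HigherTangent E M F G (k + 1) → ℝ}
  {Φ : Fin n → HigherTangent E M F G (k + 1) → ℝ}

theorem mem_ponChart_source (w : Pontryagin E M F G k) : w ∈ (ponChart w).source := by
  rw [ponChart_source]
  exact mem_extChartAt_source w

theorem IsRegularAlong.isRegularChart_ponChart [FiniteDimensional ℝ E] [FiniteDimensional ℝ F]
    {m d : ℕ} {bM : Module.Basis (Fin m) ℝ E} {bG : Module.Basis (Fin d) ℝ (LieAlg F G)}
    (hL : ContMDiff (htI E F G (k + 1)) 𝓘(ℝ, ℝ) ∞ L)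
    (hΦ : ∀ a, ContMDiff (htI E F G (k + 1)) 𝓘(ℝ, ℝ) ∞ (Φ a))
    (hind : ∀ x, (∀ a, Φ a x = 0) →
      LinearIndependent ℝ fun a => differential (htI E F G (k + 1)) (Φ a) x)
    (h : IsRegularAlong L Φ bM bG) (w₀ : Pontryagin E M F G k) :
    IsRegularChart (presymplecticForm E M F G k) (hamiltonian L)
      (fun a (w : Pontryagin E M F G k) => Φ a w.1) (ponChart w₀) where
  toIsAdaptedChart := isAdaptedChart_ponChart hL hΦ hind w₀
  regular w hw hwc l hl := (isLocallyRegular_ponChart_iff bM bG hL hΦ hind hw l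
    (chart_mem_atlas E w.1.1.base) (mem_chart_source E w.1.1.base)).2
      (h w hwc l hl _ _ (mem_chart_source E w.1.1.base))

theorem exists_isRegularChart [FiniteDimensional ℝ E] [FiniteDimensional ℝ F]
    {m d : ℕ} {bM : Module.Basis (Fin m) ℝ E} {bG : Module.Basis (Fin d) ℝ (LieAlg F G)}
    (hL : ContMDiff (htI E F G (k + 1)) 𝓘(ℝ, ℝ) ∞ L)
    (hΦ : ∀ a, ContMDiff (htI E F G (k + 1)) 𝓘(ℝ, ℝ) ∞ (Φ a))
    (hind : ∀ x, (∀ a, Φ a x = 0) →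
      LinearIndependent ℝ fun a => differential (htI E F G (k + 1)) (Φ a) x)
    (h : IsRegularAlong L Φ bM bG) :
    ∀ w ∈ formCompatSet (presymplecticForm E M F G k) (hamiltonian L)
        (fun a (w : Pontryagin E M F G k) => Φ a w.1),
      ∃ κ : OpenPartialHomeomorph (Pontryagin E M F G k)
        (PhaseSpace (HigherTangentModel E F G k) (E × LieAlg F G)),
        w ∈ κ.source ∧ IsRegularChart (presymplecticForm E M F G k) (hamiltonian L)
          (fun a (w : Pontryagin E M F G k) => Φ a w.1) κ := fun w _ =>
  ⟨ponChart w, mem_ponChart_source w, h.isRegularChart_ponChart hL hΦ hind w⟩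

theorem IsSymplecticSubmanifold.isRegularAlong [FiniteDimensional ℝ E] [FiniteDimensional ℝ F]
    {m d : ℕ} (bM : Module.Basis (Fin m) ℝ E) (bG : Module.Basis (Fin d) ℝ (LieAlg F G))
    (hL : ContMDiff (htI E F G (k + 1)) 𝓘(ℝ, ℝ) ∞ L)
    (hΦ : ∀ a, ContMDiff (htI E F G (k + 1)) 𝓘(ℝ, ℝ) ∞ (Φ a))
    (hind : ∀ x, (∀ a, Φ a x = 0) →
      LinearIndependent ℝ fun a => differential (htI E F G (k + 1)) (Φ a) x)
    (h : IsSymplecticSubmanifold (presymplecticForm E M F G k)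
      (formCompatSet (presymplecticForm E M F G k) (hamiltonian L)
        (fun a (w : Pontryagin E M F G k) => Φ a w.1))) : IsRegularAlong L Φ bM bG := by
  have : FiniteDimensional ℝ (LieAlg F G) := inferInstanceAs (FiniteDimensional ℝ F)
  obtain ⟨r, hc, -, hS, hω⟩ := h
  intro w hw l hl e he hwe
  exact (isLocallyRegular_ponChart_iff bM bG hL hΦ hind (mem_ponChart_source w) l he hwe).1
    ((isAdaptedChart_ponChart hL hΦ hind w).isLocallyRegular hS hω.nondegenerate ⟨w, hw⟩
      (mem_ponChart_source w) hl)

variable {r : ℕ}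

theorem solvesDynamics_iff [ChartedSpace (EuclideanSpace ℝ (Fin r)) (compatSet L Φ)]
    {X Y : ∀ x : compatSet L Φ, TangentSpace (𝓡 r) x}
    (hX : ∀ (x : compatSet L Φ) (v : TangentSpace (𝓡 r) x), (∀ u : TangentSpace (𝓡 r) x,
      (presymplecticForm E M F G k).pullback (I := 𝓡 r) (Subtype.val : compatSet L Φ → _) x ![v, u]
      = differential (𝓡 r) (fun y : compatSet L Φ => hamiltonian L y.1) x u) ↔ v = X x) :
    SolvesDynamics Y ↔ Y = X :=
  (forall_congr' fun x => hX x (Y x)).trans funext_iff.symm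

theorem solvesExtrinsicDynamics_iff [FiniteDimensional ℝ E] [FiniteDimensional ℝ F]
    {m d : ℕ} {bM : Module.Basis (Fin m) ℝ E} {bG : Module.Basis (Fin d) ℝ (LieAlg F G)}
    (hL : ContMDiff (htI E F G (k + 1)) 𝓘(ℝ, ℝ) ∞ L)
    (hΦ : ∀ a, ContMDiff (htI E F G (k + 1)) 𝓘(ℝ, ℝ) ∞ (Φ a))
    (hind : ∀ x, (∀ a, Φ a x = 0) →
      LinearIndependent ℝ fun a => differential (htI E F G (k + 1)) (Φ a) x)
    (h : IsRegularAlong L Φ bM bG)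
    [hc : ChartedSpace (EuclideanSpace ℝ (Fin r)) (compatSet L Φ)]
    (hS : Manifold.IsSmoothEmbedding (𝓡 r) (ponI E F G k) ∞
      (Subtype.val : compatSet L Φ → Pontryagin E M F G k))
    (Y : ∀ x : compatSet L Φ, TangentSpace (𝓡 r) x) :
    SolvesExtrinsicDynamics Y ↔ SolvesDynamics Y := by
  let _ : ChartedSpace (EuclideanSpace ℝ (Fin r)) (formCompatSet (presymplecticForm E M F G k)
    (hamiltonian L) fun a (w : Pontryagin E M F G k) => Φ a w.1) := hc
  have : FiniteDimensional ℝ (LieAlg F G) := inferInstanceAs (FiniteDimensional ℝ F)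
  refine forall_congr' fun x => ?_
  exact (h.isRegularChart_ponChart hL hΦ hind x.1).extrinsic_iff hS x (mem_ponChart_source x.1) (Y x)

theorem exists_smooth_solution_compatSet [FiniteDimensional ℝ E] [FiniteDimensional ℝ F]
    {m d : ℕ} {bM : Module.Basis (Fin m) ℝ E} {bG : Module.Basis (Fin d) ℝ (LieAlg F G)}
    (hL : ContMDiff (htI E F G (k + 1)) 𝓘(ℝ, ℝ) ∞ L)
    (hΦ : ∀ a, ContMDiff (htI E F G (k + 1)) 𝓘(ℝ, ℝ) ∞ (Φ a))
    (hind : ∀ x, (∀ a, Φ a x = 0) →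
      LinearIndependent ℝ fun a => differential (htI E F G (k + 1)) (Φ a) x)
    (h : IsRegularAlong L Φ bM bG)
    [hc : ChartedSpace (EuclideanSpace ℝ (Fin r)) (compatSet L Φ)]
    [hM : IsManifold (𝓡 r) ∞ (compatSet L Φ)]
    (hS : Manifold.IsSmoothEmbedding (𝓡 r) (ponI E F G k) ∞
      (Subtype.val : compatSet L Φ → Pontryagin E M F G k)) :
    ∃ X : ∀ x : compatSet L Φ, TangentSpace (𝓡 r) x,
      ContMDiff (𝓡 r) (𝓡 r).tangent ∞
        (fun x => (⟨x, X x⟩ : TangentBundle (𝓡 r) (compatSet L Φ))) ∧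
      ∀ (x : compatSet L Φ) (v : TangentSpace (𝓡 r) x), (∀ u : TangentSpace (𝓡 r) x,
        (presymplecticForm E M F G k).pullback (I := 𝓡 r) (Subtype.val : compatSet L Φ → _) x
          ![v, u]
        = differential (𝓡 r) (fun y : compatSet L Φ => hamiltonian L y.1) x u) ↔ v = X x := by
  have : FiniteDimensional ℝ (LieAlg F G) := inferInstanceAs (FiniteDimensional ℝ F)
  let _ : ChartedSpace (EuclideanSpace ℝ (Fin r)) (formCompatSet (presymplecticForm E M F G k)
    (hamiltonian L) fun a (w : Pontryagin E M F G k) => Φ a w.1) := hc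
  have : IsManifold (𝓡 r) ∞ (formCompatSet (presymplecticForm E M F G k)
    (hamiltonian L) fun a (w : Pontryagin E M F G k) => Φ a w.1) := hM
  exact exists_smooth_solution (exists_isRegularChart hL hΦ hind h) hS

end RegularCharts

end

theorem mainTheorem1
    {E : Type*} [NormedAddCommGroup E] [NormedSpace ℝ E]
    {M : Type*} [TopologicalSpace M] [ChartedSpace E M] [IsManifold 𝓘(ℝ, E) ∞ M]
    {F : Type*} [NormedAddCommGroup F] [NormedSpace ℝ F]
    {G : Type*} [TopologicalSpace G] [ChartedSpace F G] [Group G] [LieGroup 𝓘(ℝ, F) ∞ G]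
    {m d : ℕ} (bM : Module.Basis (Fin m) ℝ E) (bG : Module.Basis (Fin d) ℝ (LieAlg F G))
    (k n : ℕ) (L : HigherTangent E M F G (k + 1) → ℝ)
    (hL : ContMDiff (htI E F G (k + 1)) 𝓘(ℝ, ℝ) ∞ L)
    (Φ : Fin n → HigherTangent E M F G (k + 1) → ℝ)
    (hΦ : ∀ a, ContMDiff (htI E F G (k + 1)) 𝓘(ℝ, ℝ) ∞ (Φ a))
    (hind : ∀ x, (∀ a, Φ a x = 0) →
      LinearIndependent ℝ fun a => differential (htI E F G (k + 1)) (Φ a) x) :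
    (IsSymplecticSubmanifold (presymplecticForm E M F G k) (compatSet L Φ) ↔
      IsRegularAlong L Φ bM bG) ∧
    (IsRegularAlong L Φ bM bG →
      ∀ (r : ℕ) [ChartedSpace (EuclideanSpace ℝ (Fin r)) (compatSet L Φ)]
        [IsManifold (𝓡 r) ∞ (compatSet L Φ)],
        Manifold.IsSmoothEmbedding (𝓡 r) (ponI E F G k) ∞
          (Subtype.val : compatSet L Φ → Pontryagin E M F G k) →
        ∃ X : ∀ x : compatSet L Φ, TangentSpace (𝓡 r) x,
          ContMDiff (𝓡 r) (𝓡 r).tangent ∞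
            (fun x => (⟨x, X x⟩ : TangentBundle (𝓡 r) (compatSet L Φ))) ∧
          ∀ Y : ∀ x : compatSet L Φ, TangentSpace (𝓡 r) x,
            (SolvesDynamics Y ↔ Y = X) ∧ (SolvesExtrinsicDynamics Y ↔ Y = X)) := by
  have : FiniteDimensional ℝ E := Module.Finite.of_basis bM
  have : FiniteDimensional ℝ (LieAlg F G) := Module.Finite.of_basis bG
  have : FiniteDimensional ℝ F := inferInstanceAs (FiniteDimensional ℝ (LieAlg F G))
  refine ⟨⟨IsSymplecticSubmanifold.isRegularAlong bM bG hL hΦ hind, fun h =>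
    isSymplecticSubmanifold_of_regular (HigherTangentModel E F G k) (E × LieAlg F G)
      (exists_isRegularChart hL hΦ hind h)⟩, ?_⟩
  intro h r _ _ hS
  obtain ⟨X, hX, hsol⟩ := exists_smooth_solution_compatSet hL hΦ hind h hS
  exact ⟨X, hX, fun Y => ⟨solvesDynamics_iff hsol,
    (solvesExtrinsicDynamics_iff hL hΦ hind h hS Y).trans (solvesDynamics_iff hsol)⟩⟩
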